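/- Let $\alpha,\beta,\gamma,\delta\in\mathbb R$ and let $p_1,q_1,p_2,q_2$ be odd positive integers with $\gcd(p_1,q_1)=\gcd(p_2,q_2)=1$; put $k_1=p_1/q_1$, $k_2=p_2/q_2$. Use positions $(r,\theta_1,\theta_2)$ with conjugate momenta $(p_r,p_{\theta_1},p_{\theta_2})$, the bracket $\{f,g\}=\sum_j(\partial_{x_j}f\,\partial_{p_{x_j}}g-\partial_{p_{x_j}}f\,\partial_{x_j}g)$, and the region $D$: $r>0$, $\sin k_1\theta_1,\cos k_1\theta_1,\sin k_2\theta_2,\cos k_2\theta_2\neq0$. The extended Kepler–Coulomb system is $$\mathcal H=p_r^2+\frac{\alpha}{r}+\frac{\mathcal L_2}{r^2},\quad \mathcal L_2=p_{\theta_1}^2+\frac{\mathcal L_3}{\sin^2 k_1\theta_1}+\frac{\delta}{\cos^2k_1\theta_1},\quad \mathcal L_3=p_{\theta_2}^2+\frac{\beta}{\cos^2k_2\theta_2}+\frac{\gamma}{\sin^2k_2\theta_2}.$$ Set $$X_1=\sqrt{\mathcal L_2}\sin(2k_1\theta_1)p_{\theta_1}+i(-\mathcal L_2\cos 2k_1\theta_1+\delta-\mathcal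 L_3),\quad Y_1=2\sqrt{\mathcal L_2}\,p_r-i\Big(\alpha+\frac{2\mathcal L_2}{r}\Big),$$ $$X_2=-\sqrt{\mathcal L_3}\sin(2k_2\theta_2)p_{\theta_2}+i(\mathcal L_3\cos2k_2\theta_2+\gamma-\beta),$$ $$Y_2=-2\mathcal L_3\cot^2k_1\theta_1+(\mathcal L_2-\mathcal L_3-\delta)-2i\sqrt{\mathcal L_3}\cot(k_1\theta_1)p_{\theta_1},$$ let $\overline{X_j},\overline{Y_j}$ arise from $i\mapsto-i$ (with the square roots kept), and put $$\mathcal J^+=X_1^{q_1}\overline{Y_1}^{2p_1},\ \mathcal J^-=\overline{X_1}^{q_1}Y_1^{2p_1},\ \mathcal K^+=X_2^{p_1q_2}\overline{Y_2}^{p_2q_1},\ \mathcal K^-=\overline{X_2}^{p_1q_2}Y_2^{p_2q_1}.$$ With $Q=(\mathcal L_3-\mathcal L_2-\delta)^2-4\delta\mathcal L_2=\mathcal L_3^2-2\mathcal L_3(\mathcal L_2+\delta)+(\mathcal L_2-\delta)^2$ let $$\mathcal P_1=Q^{q_1}(\alpha^2+4\mathcal H\mathcal L_2)^{2p_1},\quad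 \mathcal P_2=[(\beta-\gamma-\mathcal L_3)^2-4\gamma\mathcal L_3]^{p_1q_2}Q^{p_2q_1},$$ $$\mathcal D_1=2(-1)^{(q_1-1)/2}(\delta-\mathcal L_3)^{q_1}\alpha^{2p_1},\quad \mathcal D_2=2(-1)^{(p_1q_2+1)/2}(\gamma-\beta)^{p_1q_2}(\mathcal L_2-\delta)^{p_2q_1},$$ regarded as polynomials in $\mathcal H,\mathcal L_2,\mathcal L_3$. "Polynomial" functions on phase space below are polynomials in the momenta with coefficients analytic on $D$; the order is the degree in the momenta. Then the following hold. 1. There are real polynomial functions $\mathcal J_1,\mathcal J_2,\mathcal K_1,\mathcal K_2,\mathcal J_0,\mathcal K_0$ with $$\sqrt{\mathcal L_2}\,\mathcal J_1=\mathcal J^-+\mathcal J^+,\quad i\mathcal J_2=\mathcal J^--\mathcal J^+,\quad\sqrt{\mathcal L_3}\,\mathcal K_1=\mathcal K^-+\mathcal K^+,\quad i\mathcal K_2=\mathcal K^--\mathcal K^+,$$ $$\mathcal J_2=\mathcal L_2\mathcal J_0+\mathcal D_1,\quad \mathcal K_2=\mathcal L_3\mathcal K_0+\mathcal D_2$$ (for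 either choice of the complex square roots), and $\mathcal J^+\mathcal J^-=\mathcal P_1$, $\mathcal K^+\mathcal K^-=\mathcal P_2$. The orders of $\mathcal J_2,\mathcal J_1,\mathcal J_0$ are $N,N-1,N-2$ with $N=2q_1+4p_1$, and those of $\mathcal K_2,\mathcal K_1,\mathcal K_0$ are $M,M-1,M-2$ with $M=2p_1q_2+2p_2q_1$; $\mathcal H,\mathcal L_2,\mathcal L_3$ have order $2$. 2. $\mathcal L_2,\mathcal L_3,\mathcal J_0,\mathcal J_1,\mathcal J_2,\mathcal K_0,\mathcal K_1,\mathcal K_2$ are constants of the motion, $\{\mathcal L_2,\mathcal L_3\}=0$, and the five constants $\mathcal H,\mathcal L_2,\mathcal L_3,\mathcal J_0,\mathcal K_0$ are functionally independent (their differentials are linearly independent on an open dense subset of the phase space over $D$); so the system is maximally polynomially superintegrable. 3. For $j,k\in\{1,2\}$, $$Q\{\mathcal J_j,\mathcal K_k\}=4q_1p_1p_2\big[\mathcal J_{3-j}\mathcal K_k(-\mathcal L_2)^{j-1}(\mathcal L_2-\mathcal L_3-\delta)+\mathcal J_j\mathcal K_{3-k}(-\mathcal L_3)^{k-1}(\mathcal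 L_2-\mathcal L_3+\delta)\big].$$ Moreover $\{\mathcal L_2,\mathcal J_2\}=4p_1\mathcal L_2\mathcal J_1$, $\{\mathcal L_2,\mathcal J_1\}=-4p_1\mathcal J_2$, $\{\mathcal L_3,\mathcal K_2\}=4p_1p_2\mathcal L_3\mathcal K_1$, $\{\mathcal L_3,\mathcal K_1\}=-4p_1p_2\mathcal K_2$, $\{\mathcal L_3,\mathcal J_l\}=\{\mathcal L_2,\mathcal K_l\}=0$ for $l=0,1,2$, and $$\mathcal J_2^2=-\mathcal L_2\mathcal J_1^2+4\mathcal P_1,\quad\mathcal K_2^2=-\mathcal L_3\mathcal K_1^2+4\mathcal P_2,$$ $$\{\mathcal J_1,\mathcal J_2\}=-2p_1\mathcal J_1^2+8p_1\frac{\partial\mathcal P_1}{\partial\mathcal L_2},\quad\{\mathcal K_1,\mathcal K_2\}=-2p_1p_2\mathcal K_1^2+8p_1p_2\frac{\partial\mathcal P_2}{\partial\mathcal L_3}.$$ 4. Let $\mathcal R_1=\{\mathcal L_2,\mathcal J_0\}$, $\mathcal R_2=\{\mathcal L_3,\mathcal K_0\}$, $\mathcal R_3=\{\mathcal J_0,\mathcal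 K_0\}$. Then $\mathcal R_1=4p_1\mathcal J_1$, $\mathcal R_2=4p_1p_2\mathcal K_1$, $$\frac{\mathcal R_1^2}{16p_1^2}=-\mathcal L_2\mathcal J_0^2-2\mathcal D_1\mathcal J_0+\frac{4\mathcal P_1-\mathcal D_1^2}{\mathcal L_2},\quad\frac{\mathcal R_2^2}{16p_1^2p_2^2}=-\mathcal L_3\mathcal K_0^2-2\mathcal D_2\mathcal K_0+\frac{4\mathcal P_2-\mathcal D_2^2}{\mathcal L_3},$$ where both quotients are polynomials in $\mathcal H,\mathcal L_2,\mathcal L_3$, and $$\mathcal L_2\mathcal L_3Q\,\mathcal R_3=\mathcal L_2\Big[Q\frac{\partial\mathcal D_2}{\partial\mathcal L_2}-q_1p_2(\mathcal L_3\mathcal K_0+\mathcal D_2)(\mathcal L_2-\mathcal L_3-\delta)\Big]\mathcal R_1-\mathcal L_3\Big[Q\frac{\partial\mathcal D_1}{\partial\mathcal L_3}+q_1(\mathcal L_2\mathcal J_0+\mathcal D_1)(\mathcal L_2-\mathcal L_3+\delta)\Big]\mathcal R_2.$$ 5. The algebra generated by $\mathcal H,\mathcal L_2,\mathcal L_3,\mathcal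 J_0,\mathcal K_0$ does not close polynomially: $\mathcal R_1\mathcal R_2$ is not a polynomial in these five generators, and not all second commutators $\{G,\{G',G''\}\}$ of generators are polynomials in the generators. 6. It closes rationally: for every $f$ obtained from the five generators by finitely many scalar multiples, sums, products and Poisson brackets there is $m\ge0$ such that $(\mathcal L_2\mathcal L_3Q)^mf$ is a polynomial in $\mathcal H,\mathcal L_2,\mathcal L_3,\mathcal J_0,\mathcal K_0,\mathcal R_1,\mathcal R_2$; and each of $\mathcal R_1,\mathcal R_2,\mathcal R_3$ is a root of a polynomial of positive degree whose coefficients are polynomials in the five generators. -/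

import Mathlib

/-! ### Hamiltonian mechanics on `T*D`, with `D` a region of `ℝⁿ` -/

/-- Phase space: a point is a pair `(q, p)` of positions and conjugate momenta. -/
abbrev PhaseSpace (n : ℕ) : Type := (Fin n → ℝ) × (Fin n → ℝ)

/-- The Poisson bracket `{f, g} = ∑ⱼ (∂f/∂qⱼ ∂g/∂pⱼ - ∂f/∂pⱼ ∂g/∂qⱼ)`, so that `{qⱼ, pⱼ} = 1`. -/
noncomputable def poisson {n : ℕ} (f g : PhaseSpace n → ℝ) (x : PhaseSpace n) : ℝ :=
  ∑ j, (fderiv ℝ f x (Pi.single j 1, 0) * fderiv ℝ g x (0, Pi.single j 1) -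
    fderiv ℝ f x (0, Pi.single j 1) * fderiv ℝ g x (Pi.single j 1, 0))

/-- `f` is a constant of the motion of `H` over the configuration region `D`. -/
def IsConstantOfMotion {n : ℕ} (D : Set (Fin n → ℝ)) (H f : PhaseSpace n → ℝ) : Prop :=
  ∀ x : PhaseSpace n, x.1 ∈ D → poisson H f x = 0

/-- Over `D`, the function `f` is a polynomial of order (exactly) `d` in the momenta, with
coefficients that are analytic functions of the position on all of `D`. -/
def HasMomentumOrder {n : ℕ} (D : Set (Fin n → ℝ)) (f : PhaseSpace n → ℝ) (d : ℕ) : Prop :=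
  ∃ P : (Fin n → ℝ) → MvPolynomial (Fin n) ℝ,
    (∀ m : Fin n →₀ ℕ, AnalyticOnNhd ℝ (fun q => (P q).coeff m) D) ∧
    (∀ q ∈ D, (P q).totalDegree ≤ d) ∧
    (∃ q ∈ D, (P q).totalDegree = d) ∧
    ∀ q ∈ D, ∀ p : Fin n → ℝ, f (q, p) = MvPolynomial.eval p (P q)

/-- The differentials of the `G i` are linearly independent at all points of an open dense subset
of the phase space over `D`. -/
def FunctionallyIndependent {n m : ℕ} (D : Set (Fin n → ℝ)) (G : Fin m → PhaseSpace n → ℝ) :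
    Prop :=
  ∃ U : Set (PhaseSpace n), IsOpen U ∧ U ⊆ {x | x.1 ∈ D} ∧ {x | x.1 ∈ D} ⊆ closure U ∧
    ∀ x ∈ U, LinearIndependent ℝ (fun i => fderiv ℝ (G i) x)

/-- The `2 n - 1` functions `G i` make the system with Hamiltonian `H` maximally (polynomially)
superintegrable. -/
def MaximallySuperintegrableBy {n : ℕ} (D : Set (Fin n → ℝ)) (H : PhaseSpace n → ℝ)
    (G : Fin (2 * n - 1) → PhaseSpace n → ℝ) : Prop :=
  (∀ i, ∃ d, HasMomentumOrder D (G i) d) ∧ (∀ i, IsConstantOfMotion D H (G i)) ∧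
    FunctionallyIndependent D G

/-- Over `D`, the function `f` is a polynomial (with constant coefficients) in the `G i`. -/
def IsPolynomialIn {n m : ℕ} (D : Set (Fin n → ℝ)) (G : Fin m → PhaseSpace n → ℝ)
    (f : PhaseSpace n → ℝ) : Prop :=
  ∃ F : MvPolynomial (Fin m) ℝ, ∀ x : PhaseSpace n, x.1 ∈ D →
    f x = MvPolynomial.eval (fun i => G i x) F

/-- Over `D`, the function `f` is a root of a polynomial of positive degree whose coefficients are
polynomials in the `G i`. -/
def SatisfiesPolynomialEquation {n m : ℕ} (D : Set (Fin n → ℝ)) (G : Fin m → PhaseSpace n → ℝ)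
    (f : PhaseSpace n → ℝ) : Prop :=
  ∃ F : Polynomial (MvPolynomial (Fin m) ℝ), 0 < F.natDegree ∧
    ∀ x : PhaseSpace n, x.1 ∈ D →
      F.eval₂ (MvPolynomial.eval (fun i => G i x)) (f x) = 0

/-- Polynomial closure: all second commutators of the generators `G i` are polynomials in the
generators. -/
def ClosesPolynomially {n m : ℕ} (D : Set (Fin n → ℝ)) (G : Fin m → PhaseSpace n → ℝ) : Prop :=
  ∀ i j k, IsPolynomialIn D G (poisson (G i) (poisson (G j) (G k)))

/-- The symmetry algebra generated by the `G i`: all finite combinations of scalar multiples, sums,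
products and Poisson brackets. -/
inductive SymmetryAlgebra {n m : ℕ} (G : Fin m → PhaseSpace n → ℝ) : (PhaseSpace n → ℝ) → Prop
  | gen (i : Fin m) : SymmetryAlgebra G (G i)
  | smul (c : ℝ) {f : PhaseSpace n → ℝ} : SymmetryAlgebra G f → SymmetryAlgebra G (c • f)
  | add {f g : PhaseSpace n → ℝ} :
      SymmetryAlgebra G f → SymmetryAlgebra G g → SymmetryAlgebra G (f + g)
  | mul {f g : PhaseSpace n → ℝ} :
      SymmetryAlgebra G f → SymmetryAlgebra G g → SymmetryAlgebra G (f * g)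
  | bracket {f g : PhaseSpace n → ℝ} :
      SymmetryAlgebra G f → SymmetryAlgebra G g → SymmetryAlgebra G (poisson f g)

/-! ### The extended Kepler-Coulomb system -/

/-- The parameters of the system, with `k₁ = p₁ / q₁` and `k₂ = p₂ / q₂`. -/
structure KeplerCoulomb where
  (α β γ δ : ℝ)
  (p₁ q₁ p₂ q₂ : ℕ)

namespace KeplerCoulomb

variable (S : KeplerCoulomb)

noncomputable def k₁ : ℝ := (S.p₁ : ℝ) / S.q₁

noncomputable def k₂ : ℝ := (S.p₂ : ℝ) / S.q₂

/-- The positions are `q = (r, θ₁, θ₂)`. This is the region where the Hamiltonian is defined. -/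
def region : Set (Fin 3 → ℝ) :=
  {q | 0 < q 0 ∧ Real.sin (S.k₁ * q 1) ≠ 0 ∧ Real.cos (S.k₁ * q 1) ≠ 0 ∧
    Real.sin (S.k₂ * q 2) ≠ 0 ∧ Real.cos (S.k₂ * q 2) ≠ 0}

noncomputable def L₃ (x : PhaseSpace 3) : ℝ :=
  x.2 2 ^ 2 + S.β / Real.cos (S.k₂ * x.1 2) ^ 2 + S.γ / Real.sin (S.k₂ * x.1 2) ^ 2

noncomputable def L₂ (x : PhaseSpace 3) : ℝ :=
  x.2 1 ^ 2 + S.L₃ x / Real.sin (S.k₁ * x.1 1) ^ 2 + S.δ / Real.cos (S.k₁ * x.1 1) ^ 2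

noncomputable def H (x : PhaseSpace 3) : ℝ :=
  x.2 0 ^ 2 + S.α / x.1 0 + S.L₂ x / x.1 0 ^ 2

/-! In the next four functions `s` and `t` stand for square roots of `L₂` and `L₃`, and `i` for one
of the two imaginary units `I` and `-I`; replacing `I` by `-I` gives the barred functions. -/

noncomputable def X₁ (i s : ℂ) (x : PhaseSpace 3) : ℂ :=
  s * (Real.sin (2 * S.k₁ * x.1 1) * x.2 1 : ℝ) +
    i * (-(S.L₂ x) * Real.cos (2 * S.k₁ * x.1 1) + S.δ - S.L₃ x : ℝ)

noncomputable def X₂ (i t : ℂ) (x : PhaseSpace 3) : ℂ :=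
  -t * (Real.sin (2 * S.k₂ * x.1 2) * x.2 2 : ℝ) +
    i * (S.L₃ x * Real.cos (2 * S.k₂ * x.1 2) + S.γ - S.β : ℝ)

noncomputable def Y₁ (i s : ℂ) (x : PhaseSpace 3) : ℂ :=
  2 * s * (x.2 0 : ℝ) - i * (S.α + 2 * S.L₂ x / x.1 0 : ℝ)

noncomputable def Y₂ (i t : ℂ) (x : PhaseSpace 3) : ℂ :=
  (-2 * S.L₃ x * Real.cot (S.k₁ * x.1 1) ^ 2 + (S.L₂ x - S.L₃ x - S.δ) : ℝ) -
    2 * i * t * (Real.cot (S.k₁ * x.1 1) * x.2 1 : ℝ)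

/-- The raising and lowering functions `J⁺`, `J⁻`, `K⁺`, `K⁻`. -/
noncomputable def Jplus (s : ℂ) (x : PhaseSpace 3) : ℂ :=
  S.X₁ Complex.I s x ^ S.q₁ * S.Y₁ (-Complex.I) s x ^ (2 * S.p₁)

noncomputable def Jminus (s : ℂ) (x : PhaseSpace 3) : ℂ :=
  S.X₁ (-Complex.I) s x ^ S.q₁ * S.Y₁ Complex.I s x ^ (2 * S.p₁)

noncomputable def Kplus (t : ℂ) (x : PhaseSpace 3) : ℂ :=
  S.X₂ Complex.I t x ^ (S.p₁ * S.q₂) * S.Y₂ (-Complex.I) t x ^ (S.p₂ * S.q₁)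

noncomputable def Kminus (t : ℂ) (x : PhaseSpace 3) : ℂ :=
  S.X₂ (-Complex.I) t x ^ (S.p₁ * S.q₂) * S.Y₂ Complex.I t x ^ (S.p₂ * S.q₁)

/-! Polynomials in three variables `X 0, X 1, X 2`, which stand for `H, L₂, L₃`. -/

open MvPolynomial in
/-- `(L₃ - L₂ - δ)² - 4 δ L₂`. -/
noncomputable def Q : MvPolynomial (Fin 3) ℝ :=
  (X 2 - X 1 - C S.δ) ^ 2 - 4 * C S.δ * X 1

open MvPolynomial in
noncomputable def P₁ : MvPolynomial (Fin 3) ℝ :=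
  (X 2 ^ 2 - 2 * X 2 * (X 1 + C S.δ) + (X 1 - C S.δ) ^ 2) ^ S.q₁ *
    (C S.α ^ 2 + 4 * X 0 * X 1) ^ (2 * S.p₁)

open MvPolynomial in
noncomputable def P₂ : MvPolynomial (Fin 3) ℝ :=
  ((C S.β - C S.γ - X 2) ^ 2 - 4 * C S.γ * X 2) ^ (S.p₁ * S.q₂) *
    (X 2 ^ 2 - 2 * X 2 * (X 1 + C S.δ) + (X 1 - C S.δ) ^ 2) ^ (S.p₂ * S.q₁)

open MvPolynomial in
noncomputable def D₁ : MvPolynomial (Fin 3) ℝ :=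
  2 * (-1) ^ ((S.q₁ - 1) / 2) * (C S.δ - X 2) ^ S.q₁ * C S.α ^ (2 * S.p₁)

open MvPolynomial in
noncomputable def D₂ : MvPolynomial (Fin 3) ℝ :=
  2 * (-1) ^ ((S.p₁ * S.q₂ + 1) / 2) * (C S.γ - C S.β) ^ (S.p₁ * S.q₂) *
    (X 1 - C S.δ) ^ (S.p₂ * S.q₁)

/-- The value of a polynomial at `(H, L₂, L₃)`. -/
noncomputable def val (F : MvPolynomial (Fin 3) ℝ) (x : PhaseSpace 3) : ℝ :=
  MvPolynomial.eval ![S.H x, S.L₂ x, S.L₃ x] F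

end KeplerCoulomb

/-! Choose formal roots u² = -L₂ and v² = -L₃. Up to powers of i, X₁ and the conjugate of Y₁ have
the form A + uB, while X₂ and the conjugate of Y₂ have the form A + vB, with A, B real and
polynomial in the momenta. So J⁺ and K⁺ become elements `zJ`, `zK` of two quadratic extensions of
the ring of functions. The functions J₁, J₂, K₁, K₂ are their components up to constants, and no
complex square root has to be chosen.

A Hamiltonian field tangent to the levels of L₂ treats u as a constant, so it differentiates A + uB
by the Leibniz rule. The four factors are eigenvectors of the fields of H, L₂ and L₃. Eigenvalues
are multiplied by exponents and added in products, and the exponents are those for which the sums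
cancel: `isEigen_H_zJ`, `isEigen_H_zK`, `isEigen_L₂_zK`. This yields every bracket with H, L₂, L₃.
Multiplicativity of the norm A² + L₂B² yields P₁, P₂ and the formulas for J₂² and K₂²; bracketing
these with J₁, J₂ (or K₁, K₂) determines {J₁, J₂} and {K₁, K₂}.

For the mixed brackets (`poisson_zJ_zK`), K commutes with L₂ and does not involve r or its momentum,
so only the factor X₁ of J contributes. Of the factors of K, only Y₂ depends on θ₁ and its momentum
once L₃ is fixed. What remains is an identity in one degree of freedom. The common norm Q of X₁ and
Y₂ is the denominator.

Modulo L₂ one has u² = 0, so the real part of `zJ` reduces to the product of the real parts of its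
factors; this explains D₁ and the quotient J₀, and D₂ and K₀ arise in the same way. Relations for J₀
and K₀ are found after multiplication by L₂ or L₃ and then divided, which is legitimate on a dense
set and extends by continuity (`GenericallyNonzero.eq_of_eq`). Orders are bounded above by counting
degrees of factors and attained along suitable rays at a point where both angles are π/4.

Independence follows because {L₂, ·} annihilates all generators but J₀, {L₃, ·} all but K₀, and H,
L₂, L₃ are triangular in the momenta. Hence the generators are algebraically independent
(`eq_zero_of_eval_eq_zero`). If R₁R₂, a multiple of J₁K₁, were a polynomial, then J₁²K₁², written in
the generators, would be a square of a real polynomial. But J₁² has leading term -L₂J₀² in J₀ and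
K₁² has -L₃K₀² in K₀, so the product is negative at some point with L₂ > 0 > L₃. The second
commutator {K₀, {L₂, J₀}} contains J₁K₁ and is excluded likewise.

With R₁ and R₂ adjoined, every bracket of generators becomes a polynomial after multiplication by
L₂L₃Q, and the Leibniz rule propagates this through the algebra. -/

open Filter Topology

/-! ### Hamiltonian vector fields -/

/-- The Hamiltonian vector field of `f`, whose derivation is `{f, ·}`. -/
noncomputable def hamiltonianVector {n : ℕ} (f : PhaseSpace n → ℝ) (x : PhaseSpace n) :
    PhaseSpace n :=
  (fun j => -fderiv ℝ f x (0, Pi.single j 1), fun j => fderiv ℝ f x (Pi.single j 1, 0))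

theorem PhaseSpace.eq_sum_single {n : ℕ} (w : PhaseSpace n) :
    w = ∑ j, (w.1 j • ((Pi.single j 1, 0) : PhaseSpace n) +
      w.2 j • ((0, Pi.single j 1) : PhaseSpace n)) := by
  ext i
  · simp [Prod.fst_sum, Finset.sum_apply, Pi.single_apply]
  · simp [Prod.snd_sum, Finset.sum_apply, Pi.single_apply]

theorem poisson_eq_fderiv {n : ℕ} (f g : PhaseSpace n → ℝ) (x : PhaseSpace n) :
    poisson f g x = fderiv ℝ g x (hamiltonianVector f x) := by
  conv_rhs => rw [PhaseSpace.eq_sum_single (hamiltonianVector f x)]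
  simp only [map_sum, map_add, map_smul, poisson, hamiltonianVector, smul_eq_mul]
  exact Finset.sum_congr rfl fun j _ => by ring

theorem poisson_antisymm {n : ℕ} (f g : PhaseSpace n → ℝ) (x : PhaseSpace n) :
    poisson f g x = -poisson g f x := by
  simp only [poisson, ← Finset.sum_neg_distrib]
  exact Finset.sum_congr rfl fun j _ => by ring

theorem poisson_eq_neg_fderiv {n : ℕ} (f g : PhaseSpace n → ℝ) (x : PhaseSpace n) :
    poisson f g x = -fderiv ℝ f x (hamiltonianVector g x) := by
  rw [poisson_antisymm, poisson_eq_fderiv]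

theorem poisson_self {n : ℕ} (f : PhaseSpace n → ℝ) (x : PhaseSpace n) : poisson f f x = 0 := by
  have := poisson_antisymm f f x
  linarith

theorem poisson_congr {n : ℕ} {f f' g g' : PhaseSpace n → ℝ} {x : PhaseSpace n}
    (hf : f =ᶠ[𝓝 x] f') (hg : g =ᶠ[𝓝 x] g') : poisson f g x = poisson f' g' x := by
  simp only [poisson, hf.fderiv_eq, hg.fderiv_eq]

section Leibniz

variable {n : ℕ} {f g h : PhaseSpace n → ℝ} {x : PhaseSpace n}

theorem poisson_add_right (f : PhaseSpace n → ℝ) (hg : DifferentiableAt ℝ g x)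
    (hh : DifferentiableAt ℝ h x) :
    poisson f (fun y => g y + h y) x = poisson f g x + poisson f h x := by
  simp only [poisson_eq_fderiv, fderiv_fun_add hg hh, add_apply]

theorem poisson_mul_right (f : PhaseSpace n → ℝ) (hg : DifferentiableAt ℝ g x)
    (hh : DifferentiableAt ℝ h x) :
    poisson f (fun y => g y * h y) x = g x * poisson f h x + h x * poisson f g x := by
  simp only [poisson_eq_fderiv, fderiv_fun_mul hg hh, add_apply,
    smul_apply, smul_eq_mul]

theorem poisson_const_mul_right (f : PhaseSpace n → ℝ) (c : ℝ) (hg : DifferentiableAt ℝ g x) :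
    poisson f (fun y => c * g y) x = c * poisson f g x := by
  simp only [poisson_eq_fderiv, fderiv_const_mul hg, smul_apply, smul_eq_mul]

theorem poisson_const_mul_left (c : ℝ) (g : PhaseSpace n → ℝ) (hf : DifferentiableAt ℝ f x) :
    poisson (fun y => c * f y) g x = c * poisson f g x := by
  rw [poisson_antisymm, poisson_const_mul_right g c hf, poisson_antisymm g f]
  ring

theorem poisson_mul_left (g : PhaseSpace n → ℝ) (hf : DifferentiableAt ℝ f x)
    (hh : DifferentiableAt ℝ h x) :
    poisson (fun y => f y * h y) g x = f x * poisson h g x + h x * poisson f g x := by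
  rw [poisson_antisymm, poisson_mul_right g hf hh, poisson_antisymm g h, poisson_antisymm g f]
  ring

end Leibniz

theorem differentiableAt_eval {n m : ℕ} {G : Fin m → PhaseSpace n → ℝ} {x : PhaseSpace n}
    (hG : ∀ i, DifferentiableAt ℝ (G i) x) (F : MvPolynomial (Fin m) ℝ) :
    DifferentiableAt ℝ (fun y => MvPolynomial.eval (fun i => G i y) F) x := by
  induction F using MvPolynomial.induction_on with
  | C a => simp
  | add p q hp hq => simpa only [map_add] using hp.fun_add hq
  | mul_X p i hp => simpa only [map_mul, MvPolynomial.eval_X] using hp.fun_mul (hG i)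

theorem fderiv_eval {n m : ℕ} {G : Fin m → PhaseSpace n → ℝ} {x : PhaseSpace n}
    (hG : ∀ i, DifferentiableAt ℝ (G i) x) (F : MvPolynomial (Fin m) ℝ) (w : PhaseSpace n) :
    fderiv ℝ (fun y => MvPolynomial.eval (fun i => G i y) F) x w =
      ∑ i, MvPolynomial.eval (fun i => G i x) (MvPolynomial.pderiv i F) *
        fderiv ℝ (G i) x w := by
  induction F using MvPolynomial.induction_on with
  | C a => simp
  | add p q hp hq =>
    simp only [map_add, add_mul, Finset.sum_add_distrib]
    rw [fderiv_fun_add (differentiableAt_eval hG p) (differentiableAt_eval hG q),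
      add_apply, hp, hq]
  | mul_X p i hp =>
    simp only [map_mul, MvPolynomial.eval_X]
    rw [fderiv_fun_mul (differentiableAt_eval hG p) (hG i)]
    simp only [add_apply, smul_apply, smul_eq_mul, hp,
      MvPolynomial.pderiv_mul, map_add, map_mul, MvPolynomial.eval_X, MvPolynomial.pderiv_X,
      add_mul, Finset.sum_add_distrib, Finset.mul_sum]
    rw [add_comm]
    congr 1
    · exact Finset.sum_congr rfl fun j _ => by ring
    · rw [Finset.sum_eq_single i]
      · simp
      · intro j _ hj
        simp [hj.symm]
      · simp

theorem poisson_eval_right {n m : ℕ} {G : Fin m → PhaseSpace n → ℝ} {x : PhaseSpace n}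
    (hG : ∀ i, DifferentiableAt ℝ (G i) x) (f : PhaseSpace n → ℝ) (F : MvPolynomial (Fin m) ℝ) :
    poisson f (fun y => MvPolynomial.eval (fun i => G i y) F) x =
      ∑ i, MvPolynomial.eval (fun i => G i x) (MvPolynomial.pderiv i F) * poisson f (G i) x := by
  simp only [poisson_eq_fderiv, fderiv_eval hG]

theorem poisson_eval_left {n m : ℕ} {G : Fin m → PhaseSpace n → ℝ} {x : PhaseSpace n}
    (hG : ∀ i, DifferentiableAt ℝ (G i) x) (g : PhaseSpace n → ℝ) (F : MvPolynomial (Fin m) ℝ) :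
    poisson (fun y => MvPolynomial.eval (fun i => G i y) F) g x =
      ∑ i, MvPolynomial.eval (fun i => G i x) (MvPolynomial.pderiv i F) * poisson (G i) g x := by
  simp only [poisson_eq_neg_fderiv, fderiv_eval hG, ← Finset.sum_neg_distrib, mul_neg]

theorem AnalyticOnNhd.poisson {n : ℕ} {f g : PhaseSpace n → ℝ} {s : Set (PhaseSpace n)}
    (hf : AnalyticOnNhd ℝ f s) (hg : AnalyticOnNhd ℝ g s) : AnalyticOnNhd ℝ (poisson f g) s := by
  have key : ∀ {h : PhaseSpace n → ℝ}, AnalyticOnNhd ℝ h s → ∀ w : PhaseSpace n,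
      AnalyticOnNhd ℝ (fun y => fderiv ℝ h y w) s := fun hh w y hy =>
    ((ContinuousLinearMap.apply ℝ ℝ w).analyticAt _).comp (hh.fderiv y hy)
  intro y hy
  refine Finset.analyticAt_fun_sum _ fun j _ => ?_
  exact ((key hf _ y hy).mul (key hg _ y hy)).sub ((key hf _ y hy).mul (key hg _ y hy))

theorem AnalyticOnNhd.eval {n m : ℕ} {G : Fin m → PhaseSpace n → ℝ} {s : Set (PhaseSpace n)}
    (hG : ∀ i, AnalyticOnNhd ℝ (G i) s) (F : MvPolynomial (Fin m) ℝ) :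
    AnalyticOnNhd ℝ (fun y => MvPolynomial.eval (fun i => G i y) F) s := by
  induction F using MvPolynomial.induction_on with
  | C a => simpa using analyticOnNhd_const
  | add p q hp hq =>
    simp only [map_add]
    exact fun y hy => (hp y hy).fun_add (hq y hy)
  | mul_X p i hp =>
    simp only [map_mul, MvPolynomial.eval_X]
    exact fun y hy => (hp y hy).fun_mul (hG i y hy)

/-! ### Functions that vanish only on a nowhere dense set -/

/-- Every neighbourhood of every point of `s` contains a point where `f` does not vanish. -/
def GenericallyNonzero {X : Type*} [TopologicalSpace X] (s : Set X) (f : X → ℝ) : Prop :=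
  ∀ x ∈ s, ∃ᶠ y in 𝓝 x, f y ≠ 0

/-- Near a point where `f` is nonzero it stays nonzero by continuity, and that neighbourhood
contains a point where `g` is nonzero. -/
theorem GenericallyNonzero.mul {X : Type*} [TopologicalSpace X] {s : Set X} {f g : X → ℝ}
    (hs : IsOpen s) (hf : ContinuousOn f s) (hf0 : GenericallyNonzero s f)
    (hg0 : GenericallyNonzero s g) : GenericallyNonzero s (fun x => f x * g x) := by
  intro x hx
  rw [frequently_nhds_iff]
  intro U hxU hU
  obtain ⟨y, ⟨hyU, hys⟩, hy⟩ :=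
    frequently_nhds_iff.1 (hf0 x hx) (U := U ∩ s) ⟨hxU, hx⟩ (hU.inter hs)
  have hev : ∀ᶠ z in 𝓝 y, f z ≠ 0 ∧ z ∈ U :=
    ((hf.continuousAt (hs.mem_nhds hys)).eventually_ne hy).and (hU.mem_nhds hyU)
  obtain ⟨z, hz, hz1, hz2⟩ := ((hg0 y hys).and_eventually hev).exists
  exact ⟨z, hz2, mul_ne_zero hz1 hz⟩

theorem GenericallyNonzero.subset_closure {X : Type*} [TopologicalSpace X] {s : Set X}
    {f : X → ℝ} (hs : IsOpen s) (h : GenericallyNonzero s f) :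
    s ⊆ closure {x | x ∈ s ∧ f x ≠ 0} := fun x hx =>
  mem_closure_iff_frequently.2 (((h x hx).and_eventually (hs.mem_nhds hx)).mono fun _ hy =>
    ⟨hy.2, hy.1⟩)

/-- Two continuous functions agree if they agree where a generically nonzero function does not
vanish. -/
theorem GenericallyNonzero.eq_of_eq {X : Type*} [TopologicalSpace X] {s : Set X}
    {w f g : X → ℝ} (hs : IsOpen s) (hw : GenericallyNonzero s w) (hf : ContinuousOn f s)
    (hg : ContinuousOn g s) (h : ∀ x ∈ s, w x ≠ 0 → f x = g x) : ∀ x ∈ s, f x = g x := by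
  intro x hx
  by_contra hne
  have hev : ∀ᶠ y in 𝓝 x, f y - g y ≠ 0 :=
    ((hf.continuousAt (hs.mem_nhds hx)).sub (hg.continuousAt (hs.mem_nhds hx))).eventually_ne
      (sub_ne_zero.2 hne)
  obtain ⟨y, hy, hy1, hy2⟩ := ((hw x hx).and_eventually (hev.and (hs.mem_nhds hx))).exists
  exact hy1 (sub_eq_zero.2 (h y hy2 hy))

/-- An analytic function over `D` that does not vanish identically on any fibre is generically
nonzero. -/
theorem genericallyNonzero_of_fibre {n : ℕ} {D : Set (Fin n → ℝ)} {f : PhaseSpace n → ℝ}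
    (hf : AnalyticOnNhd ℝ f {x | x.1 ∈ D}) (h : ∀ q ∈ D, ∃ p, f (q, p) ≠ 0) :
    GenericallyNonzero {x | x.1 ∈ D} f := by
  rintro ⟨q, p⟩ hx
  obtain ⟨p', hp'⟩ := h q hx
  -- The fibre is a vector space, so `p` and `p'` are joined by a line inside the domain even when
  -- `D` is disconnected; the identity theorem in one variable applies on that line.
  have hline : AnalyticOnNhd ℝ (fun t : ℝ => f (q, p + t • (p' - p))) Set.univ := by
    intro t _
    refine AnalyticAt.fun_comp (g := f) (hf _ hx) ?_
    fun_prop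
  have hfreq : ∃ᶠ t in 𝓝[≠] (0 : ℝ), f (q, p + t • (p' - p)) ≠ 0 := by
    by_contra hcon
    simp only [not_frequently, not_not] at hcon
    have := hline.eqOn_zero_of_preconnected_of_frequently_eq_zero isPreconnected_univ
      (Set.mem_univ 0) hcon.frequently (Set.mem_univ 1)
    simp at this
    exact hp' this
  have htend : Tendsto (fun t : ℝ => ((q, p + t • (p' - p)) : PhaseSpace n)) (𝓝[≠] 0)
      (𝓝 (q, p)) := by
    have : Continuous (fun t : ℝ => ((q, p + t • (p' - p)) : PhaseSpace n)) := by fun_prop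
    simpa using (this.tendsto 0).mono_left nhdsWithin_le_nhds
  exact htend.frequently hfreq

/-! ### Order in the momenta -/

/-- Over `D`, the function `f` is a polynomial of order at most `d` in the momenta, with analytic
coefficients. -/
def MomentumOrderLE {n : ℕ} (D : Set (Fin n → ℝ)) (f : PhaseSpace n → ℝ) (d : ℕ) : Prop :=
  ∃ P : (Fin n → ℝ) → MvPolynomial (Fin n) ℝ,
    (∀ m : Fin n →₀ ℕ, AnalyticOnNhd ℝ (fun q => (P q).coeff m) D) ∧
    (∀ q ∈ D, (P q).totalDegree ≤ d) ∧
    ∀ q ∈ D, ∀ p : Fin n → ℝ, f (q, p) = MvPolynomial.eval p (P q)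

namespace MomentumOrderLE

variable {n : ℕ} {D : Set (Fin n → ℝ)} {f g : PhaseSpace n → ℝ} {d e : ℕ}

theorem mono (h : MomentumOrderLE D f d) (hde : d ≤ e) : MomentumOrderLE D f e := by
  obtain ⟨P, h1, h2, h3⟩ := h
  exact ⟨P, h1, fun q hq => (h2 q hq).trans hde, h3⟩

theorem position {c : (Fin n → ℝ) → ℝ} (hc : AnalyticOnNhd ℝ c D) (d : ℕ) :
    MomentumOrderLE D (fun x => c x.1) d := by
  refine ⟨fun q => MvPolynomial.C (c q), fun m => ?_, fun q _ => by simp, fun q _ p => by simp⟩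
  simp only [MvPolynomial.coeff_C]
  split_ifs
  · exact hc
  · exact analyticOnNhd_const

theorem const (c : ℝ) (d : ℕ) : MomentumOrderLE D (fun _ => c) d :=
  position analyticOnNhd_const d

theorem momentum (i : Fin n) : MomentumOrderLE D (fun x => x.2 i) 1 :=
  ⟨fun _ => MvPolynomial.X i, fun _ => analyticOnNhd_const,
    fun _ _ => (MvPolynomial.totalDegree_X i).le, fun _ _ _ => by simp⟩

theorem add (hf : MomentumOrderLE D f d) (hg : MomentumOrderLE D g d) :
    MomentumOrderLE D (fun x => f x + g x) d := by
  obtain ⟨P, h1, h2, h3⟩ := hf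
  obtain ⟨R, h1', h2', h3'⟩ := hg
  refine ⟨fun q => P q + R q, fun m => ?_, fun q hq => ?_, fun q hq p => ?_⟩
  · simp only [MvPolynomial.coeff_add]
    exact fun q hq => (h1 m q hq).fun_add (h1' m q hq)
  · exact (MvPolynomial.totalDegree_add _ _).trans (max_le (h2 q hq) (h2' q hq))
  · simp [h3 q hq, h3' q hq]

theorem mul (hf : MomentumOrderLE D f d) (hg : MomentumOrderLE D g e) :
    MomentumOrderLE D (fun x => f x * g x) (d + e) := by
  obtain ⟨P, h1, h2, h3⟩ := hf
  obtain ⟨R, h1', h2', h3'⟩ := hg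
  refine ⟨fun q => P q * R q, fun m => ?_, fun q hq => ?_, fun q hq p => ?_⟩
  · simp only [MvPolynomial.coeff_mul]
    exact fun q hq => Finset.analyticAt_fun_sum _ fun a _ => (h1 a.1 q hq).mul (h1' a.2 q hq)
  · exact (MvPolynomial.totalDegree_mul _ _).trans (add_le_add (h2 q hq) (h2' q hq))
  · simp [h3 q hq, h3' q hq]

theorem const_mul (c : ℝ) (hf : MomentumOrderLE D f d) :
    MomentumOrderLE D (fun x => c * f x) d := by
  simpa using (const c 0).mul hf

theorem sub (hf : MomentumOrderLE D f d) (hg : MomentumOrderLE D g d) :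
    MomentumOrderLE D (fun x => f x - g x) d := by
  simpa [sub_eq_add_neg] using hf.add (hg.const_mul (-1))

end MomentumOrderLE

/-- An upper bound on the order is sharp as soon as growth of rate exactly `t ^ d` is seen along one
ray of momenta. -/
theorem HasMomentumOrder.of_le {n : ℕ} {D : Set (Fin n → ℝ)} {f : PhaseSpace n → ℝ} {d : ℕ}
    (h : MomentumOrderLE D f d) {q p : Fin n → ℝ} (hq : q ∈ D) {l : ℝ} (hl : l ≠ 0)
    (hlim : Tendsto (fun t : ℝ => f (q, t • p) / t ^ d) atTop (𝓝 l)) :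
    HasMomentumOrder D f d := by
  obtain ⟨P, h1, h2, h3⟩ := h
  refine ⟨P, h1, h2, ⟨q, hq, ?_⟩, h3⟩
  by_contra hne
  have hlt : (P q).totalDegree < d := lt_of_le_of_ne (h2 q hq) hne
  refine hl (tendsto_nhds_unique hlim ?_)
  -- If the degree at `q` were below `d`, each monomial divided by `t ^ d` would tend to 0.
  have hzero : Tendsto (fun t : ℝ => ∑ m ∈ (P q).support,
      ((P q).coeff m * ∏ i, p i ^ m i) * (t ^ m.degree / t ^ d)) atTop (𝓝 0) := by
    rw [← Finset.sum_const_zero (s := (P q).support)]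
    refine tendsto_finsetSum _ fun m hm => ?_
    rw [← mul_zero ((P q).coeff m * ∏ i, p i ^ m i)]
    refine Tendsto.const_mul _ (tendsto_pow_div_pow_atTop_zero ?_)
    exact (MvPolynomial.le_totalDegree hm).trans_lt hlt
  refine hzero.congr fun t => ?_
  rw [h3 q hq, MvPolynomial.eval_eq', Finset.sum_div]
  refine Finset.sum_congr rfl fun m _ => ?_
  simp only [Pi.smul_apply, smul_eq_mul, mul_pow, Finset.prod_mul_distrib,
    Finset.prod_pow_eq_pow_sum, ← Finsupp.degree_eq_sum]
  ring

/-! ### Quadratic extensions of the ring of functions on phase space -/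

section Quadratic

variable {n : ℕ} {L : PhaseSpace n → ℝ}

/-- The ring of functions `A + u B` on phase space, with `u² = -L`. -/
abbrev QuadraticFunctions {n : ℕ} (L : PhaseSpace n → ℝ) : Type :=
  QuadraticAlgebra (PhaseSpace n → ℝ) (-L) 0

namespace QuadraticFunctions

/-- The value at a point. -/
def value (x : PhaseSpace n) : QuadraticFunctions L →+* QuadraticAlgebra ℝ (-L x) 0 where
  toFun z := ⟨z.re x, z.im x⟩
  map_one' := by ext <;> simp [QuadraticAlgebra.re_one, QuadraticAlgebra.im_one]
  map_zero' := by ext <;> simp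
  map_add' z w := by ext <;> simp
  map_mul' z w := by ext <;> simp

@[simp]
theorem value_re (x : PhaseSpace n) (z : QuadraticFunctions L) : (value x z).re = z.re x := rfl

@[simp]
theorem value_im (x : PhaseSpace n) (z : QuadraticFunctions L) : (value x z).im = z.im x := rfl

/-- The value at a point, for a choice of the complex number `u`. -/
noncomputable def complexValue (x : PhaseSpace n) (u : ℂ) (hu : u ^ 2 = -(L x : ℂ)) :
    QuadraticFunctions L →+* ℂ where
  toFun z := z.re x + u * z.im x
  map_one' := by simp [QuadraticAlgebra.re_one, QuadraticAlgebra.im_one]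
  map_zero' := by simp
  map_add' z w := by
    simp only [QuadraticAlgebra.re_add, QuadraticAlgebra.im_add, Pi.add_apply]
    push_cast
    ring
  map_mul' z w := by
    simp only [QuadraticAlgebra.re_mul, QuadraticAlgebra.im_mul, Pi.add_apply, Pi.mul_apply,
      Pi.neg_apply, Pi.zero_apply]
    push_cast
    linear_combination (-(z.im x : ℂ) * w.im x) * hu

theorem complexValue_apply (x : PhaseSpace n) (u : ℂ) (hu : u ^ 2 = -(L x : ℂ))
    (z : QuadraticFunctions L) : complexValue x u hu z = z.re x + u * z.im x := rfl

/-- Both components are analytic on `s`. -/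
def IsAnalytic (s : Set (PhaseSpace n)) (z : QuadraticFunctions L) : Prop :=
  AnalyticOnNhd ℝ z.re s ∧ AnalyticOnNhd ℝ z.im s

theorem IsAnalytic.mul {s : Set (PhaseSpace n)} (hL : AnalyticOnNhd ℝ L s)
    {z w : QuadraticFunctions L} (hz : z.IsAnalytic s) (hw : w.IsAnalytic s) :
    (z * w).IsAnalytic s := by
  refine ⟨?_, ?_⟩
  · rw [QuadraticAlgebra.re_mul]
    exact (hz.1.mul hw.1).add ((hL.neg.mul hz.2).mul hw.2)
  · have : (z * w).im = z.re * w.im + z.im * w.re := by simp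
    rw [this]
    exact (hz.1.mul hw.2).add (hz.2.mul hw.1)

theorem IsAnalytic.pow {s : Set (PhaseSpace n)} (hL : AnalyticOnNhd ℝ L s)
    {z : QuadraticFunctions L} (hz : z.IsAnalytic s) (k : ℕ) : (z ^ k).IsAnalytic s := by
  induction k with
  | zero => exact ⟨analyticOnNhd_const (v := (1 : ℝ)), analyticOnNhd_const (v := (0 : ℝ))⟩
  | succ k ih => rw [pow_succ]; exact ih.mul hL hz

/-- The derivative at a point in a direction along which `L`, and hence `u`, is constant. -/
noncomputable def derivative (x w : PhaseSpace n) (z : QuadraticFunctions L) :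
    QuadraticAlgebra ℝ (-L x) 0 := ⟨fderiv ℝ z.re x w, fderiv ℝ z.im x w⟩

/-- The only term that could spoil the Leibniz rule is the derivative of `u² = -L`, and `hw` removes
it. -/
theorem derivative_mul {s : Set (PhaseSpace n)} {x w : PhaseSpace n} (hx : x ∈ s)
    (hL : AnalyticOnNhd ℝ L s) (hw : fderiv ℝ L x w = 0) {z z' : QuadraticFunctions L}
    (hz : z.IsAnalytic s) (hz' : z'.IsAnalytic s) :
    derivative x w (z * z') = derivative x w z * value x z' + value x z * derivative x w z' := by
  have dL := (hL x hx).differentiableAt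
  have d1 := (hz.1 x hx).differentiableAt
  have d2 := (hz.2 x hx).differentiableAt
  have d3 := (hz'.1 x hx).differentiableAt
  have d4 := (hz'.2 x hx).differentiableAt
  have h1 : (z * z').re = z.re * z'.re + -L * z.im * z'.im := by simp
  have h2 : (z * z').im = z.re * z'.im + z.im * z'.re := by simp
  ext
  · simp only [derivative, h1, QuadraticAlgebra.re_add, QuadraticAlgebra.re_mul, value_re,
      value_im]
    rw [fderiv_add (d1.mul d3) ((dL.neg.mul d2).mul d4), fderiv_mul d1 d3,
      fderiv_mul (dL.neg.mul d2) d4, fderiv_mul dL.neg d2, fderiv_neg]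
    simp only [add_apply, smul_apply, neg_apply, smul_eq_mul, hw, Pi.mul_apply, Pi.neg_apply]
    ring
  · simp only [derivative, h2, QuadraticAlgebra.im_add, QuadraticAlgebra.im_mul, value_re,
      value_im]
    rw [fderiv_add (d1.mul d4) (d2.mul d3), fderiv_mul d1 d4, fderiv_mul d2 d3]
    simp only [add_apply, smul_apply, smul_eq_mul]
    ring

theorem derivative_one (x w : PhaseSpace n) :
    derivative x w (1 : QuadraticFunctions L) = 0 := by
  ext <;> simp [derivative, QuadraticAlgebra.re_one, QuadraticAlgebra.im_one]

theorem derivative_pow {s : Set (PhaseSpace n)} {x w : PhaseSpace n} (hx : x ∈ s)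
    (hL : AnalyticOnNhd ℝ L s) (hw : fderiv ℝ L x w = 0) {z : QuadraticFunctions L}
    (hz : z.IsAnalytic s) (k : ℕ) :
    derivative x w (z ^ k) = k * value x z ^ (k - 1) * derivative x w z := by
  induction k with
  | zero => simp [derivative_one]
  | succ k ih =>
    rw [pow_succ, derivative_mul hx hL hw (hz.pow hL k) hz, ih, map_pow]
    rcases k with _ | k
    · simp
    · simp only [Nat.add_sub_cancel, pow_succ]
      push_cast
      ring

/-- `z` is an eigenvector with eigenvalue `u l` of the derivative at `x` along `w`. -/
def IsEigen (x w : PhaseSpace n) (z : QuadraticFunctions L) (l : ℝ) : Prop :=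
  derivative x w z = ⟨0, l⟩ * value x z

theorem IsEigen.mul {s : Set (PhaseSpace n)} {x w : PhaseSpace n} (hx : x ∈ s)
    (hL : AnalyticOnNhd ℝ L s) (hw : fderiv ℝ L x w = 0) {z z' : QuadraticFunctions L}
    (hz : z.IsAnalytic s) (hz' : z'.IsAnalytic s) {l l' : ℝ} (h : z.IsEigen x w l)
    (h' : z'.IsEigen x w l') : (z * z').IsEigen x w (l + l') := by
  unfold IsEigen at *
  have hadd : (⟨0, l + l'⟩ : QuadraticAlgebra ℝ (-L x) 0) = ⟨0, l⟩ + ⟨0, l'⟩ := by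
    ext <;> simp
  rw [derivative_mul hx hL hw hz hz', h, h', map_mul, hadd]
  ring

theorem IsEigen.pow {s : Set (PhaseSpace n)} {x w : PhaseSpace n} (hx : x ∈ s)
    (hL : AnalyticOnNhd ℝ L s) (hw : fderiv ℝ L x w = 0) {z : QuadraticFunctions L}
    (hz : z.IsAnalytic s) {l : ℝ} (h : z.IsEigen x w l) (k : ℕ) :
    (z ^ k).IsEigen x w (k * l) := by
  unfold IsEigen at *
  have hmul : (⟨0, k * l⟩ : QuadraticAlgebra ℝ (-L x) 0) = k * ⟨0, l⟩ := by
    ext <;> simp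
  rw [derivative_pow hx hL hw hz, h, hmul, map_pow]
  rcases k with _ | k
  · simp
  · simp only [Nat.add_sub_cancel, pow_succ]
    ring

theorem isEigen_iff {x w : PhaseSpace n} {z : QuadraticFunctions L} {l : ℝ} :
    z.IsEigen x w l ↔
      fderiv ℝ z.re x w = -(L x * l * z.im x) ∧ fderiv ℝ z.im x w = l * z.re x := by
  simp [IsEigen, QuadraticAlgebra.ext_iff, derivative]

/-- The components of `z` have the momentum orders `2 k + 2` and `2 k + 1`, and the real part is
`e` modulo a multiple of `L` of the same order. -/
def HasOrder (D : Set (Fin n → ℝ)) (z : QuadraticFunctions L) (e : PhaseSpace n → ℝ) (k : ℕ) :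
    Prop :=
  MomentumOrderLE D z.re (2 * k + 2) ∧ MomentumOrderLE D z.im (2 * k + 1) ∧
    MomentumOrderLE D e (2 * k + 2) ∧
    ∃ c, MomentumOrderLE D c (2 * k) ∧ ∀ x, z.re x = L x * c x + e x

/-- Modulo `L` the product of the imaginary parts disappears from the real part, so the remainders
`e`, `e'` simply multiply. The product of the imaginary parts goes into the quotient. -/
theorem HasOrder.mul {D : Set (Fin n → ℝ)} (hL : MomentumOrderLE D L 2)
    {z z' : QuadraticFunctions L} {e e' : PhaseSpace n → ℝ} {k k' : ℕ}
    (h : z.HasOrder D e k) (h' : z'.HasOrder D e' k') :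
    (z * z').HasOrder D (fun x => e x * e' x) (k + k' + 1) := by
  obtain ⟨h1, h2, h3, c, h4, h5⟩ := h
  obtain ⟨h1', h2', h3', c', h4', h5'⟩ := h'
  have hre : (z * z').re = fun x => z.re x * z'.re x - L x * (z.im x * z'.im x) := by
    funext x
    simp only [QuadraticAlgebra.re_mul, Pi.add_apply, Pi.mul_apply, Pi.neg_apply]
    ring
  have him : (z * z').im = fun x => z.re x * z'.im x + z.im x * z'.re x := by
    funext x
    simp
  refine ⟨?_, ?_, (h3.mul h3').mono (by omega), fun x => L x * (c x * c' x) +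
    (c x * e' x + e x * c' x) - z.im x * z'.im x, ?_, fun x => ?_⟩
  · rw [hre]
    exact ((h1.mul h1').mono (by omega)).sub ((hL.mul (h2.mul h2')).mono (by omega))
  · rw [him]
    exact ((h1.mul h2').mono (by omega)).add ((h2.mul h1').mono (by omega))
  · exact (((hL.mul (h4.mul h4')).mono (by omega)).add
      (((h4.mul h3').mono (by omega)).add ((h3.mul h4').mono (by omega)))).sub
      ((h2.mul h2').mono (by omega))
  · rw [hre]
    simp only [h5, h5']
    ring

theorem HasOrder.pow {D : Set (Fin n → ℝ)} (hL : MomentumOrderLE D L 2)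
    {z : QuadraticFunctions L} {e : PhaseSpace n → ℝ} (h : z.HasOrder D e 0) (k : ℕ) :
    (z ^ (k + 1)).HasOrder D (fun x => e x ^ (k + 1)) k := by
  induction k with
  | zero => simpa using h
  | succ k ih =>
    rw [pow_succ z]
    simp only [pow_succ _ (k + 1)]
    exact ih.mul hL h

/-- Along the ray `t ↦ (q, t p)`, the components of `z` divided by `t ^ (2 k + 2)` and
`t ^ (2 k + 1)` tend to those of `ζ`. -/
def HasSymbol (q p : Fin n → ℝ) {l : ℝ} (z : QuadraticFunctions L)
    (ζ : QuadraticAlgebra ℝ (-l) 0) (k : ℕ) : Prop :=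
  Tendsto (fun t : ℝ => z.re (q, t • p) / t ^ (2 * k + 2)) atTop (𝓝 ζ.re) ∧
    Tendsto (fun t : ℝ => z.im (q, t • p) / t ^ (2 * k + 1)) atTop (𝓝 ζ.im)

theorem HasSymbol.mul {q p : Fin n → ℝ} {l : ℝ}
    (hL : Tendsto (fun t : ℝ => L (q, t • p) / t ^ 2) atTop (𝓝 l)) {z z' : QuadraticFunctions L}
    {ζ ζ' : QuadraticAlgebra ℝ (-l) 0} {k k' : ℕ} (h : z.HasSymbol q p ζ k)
    (h' : z'.HasSymbol q p ζ' k') : (z * z').HasSymbol q p (ζ * ζ') (k + k' + 1) := by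
  refine ⟨?_, ?_⟩
  · have := (h.1.mul h'.1).sub (hL.mul (h.2.mul h'.2))
    have heq : (ζ * ζ').re = ζ.re * ζ'.re - l * (ζ.im * ζ'.im) := by
      simp only [QuadraticAlgebra.re_mul]
      ring
    rw [heq]
    refine this.congr' ?_
    filter_upwards [eventually_ne_atTop 0] with t ht
    simp only [QuadraticAlgebra.re_mul, Pi.add_apply, Pi.mul_apply, Pi.neg_apply]
    field_simp
    ring
  · have := (h.1.mul h'.2).add (h.2.mul h'.1)
    have heq : (ζ * ζ').im = ζ.re * ζ'.im + ζ.im * ζ'.re := by simp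
    rw [heq]
    refine this.congr' ?_
    filter_upwards [eventually_ne_atTop 0] with t ht
    have heq : (z * z').im (q, t • p) =
      z.re (q, t • p) * z'.im (q, t • p) + z.im (q, t • p) * z'.re (q, t • p) := by simp
    rw [heq]
    field_simp
    ring

theorem HasSymbol.pow {q p : Fin n → ℝ} {l : ℝ}
    (hL : Tendsto (fun t : ℝ => L (q, t • p) / t ^ 2) atTop (𝓝 l)) {z : QuadraticFunctions L}
    {ζ : QuadraticAlgebra ℝ (-l) 0} (h : z.HasSymbol q p ζ 0) (k : ℕ) :
    (z ^ (k + 1)).HasSymbol q p (ζ ^ (k + 1)) k := by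
  induction k with
  | zero => simpa using h
  | succ k ih =>
    rw [pow_succ z, pow_succ ζ]
    exact HasSymbol.mul (z := z ^ (k + 1)) (ζ := ζ ^ (k + 1)) (k := k) (k' := 0) hL ih h

end QuadraticFunctions

end Quadratic

/-- Reduces the explicit differentials to one-variable calculus along `t ↦ x + t • w`. -/
theorem fderiv_eq_of_hasDerivAt {n : ℕ} {f : PhaseSpace n → ℝ} {x w : PhaseSpace n} {v : ℝ}
    (hf : DifferentiableAt ℝ f x) (h : HasDerivAt (fun t : ℝ => f (x + t • w)) v 0) :
    fderiv ℝ f x w = v :=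
  (hf.hasFDerivAt.hasLineDerivAt w).unique h

theorem hasDerivAt_position {n : ℕ} (x w : PhaseSpace n) (i : Fin n) :
    HasDerivAt (fun t : ℝ => (x + t • w).1 i) (w.1 i) 0 := by
  simpa using ((hasDerivAt_id (0 : ℝ)).mul_const (w.1 i)).const_add (x.1 i)

theorem hasDerivAt_momentum {n : ℕ} (x w : PhaseSpace n) (i : Fin n) :
    HasDerivAt (fun t : ℝ => (x + t • w).2 i) (w.2 i) 0 := by
  simpa using ((hasDerivAt_id (0 : ℝ)).mul_const (w.2 i)).const_add (x.2 i)

theorem hasDerivAt_fderiv {n : ℕ} {f : PhaseSpace n → ℝ} {x : PhaseSpace n}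
    (hf : DifferentiableAt ℝ f x) (w : PhaseSpace n) :
    HasDerivAt (fun t : ℝ => f (x + t • w)) (fderiv ℝ f x w) 0 :=
  hf.hasFDerivAt.hasLineDerivAt w

/-! ### Differentials and brackets of `H`, `L₂`, `L₃`. -/

namespace KeplerCoulomb

variable (S : KeplerCoulomb)

/-- The phase space over the region. -/
def phase : Set (PhaseSpace 3) := {x | x.1 ∈ S.region}

theorem isOpen_region : IsOpen S.region := by
  have h : ∀ {g : (Fin 3 → ℝ) → ℝ}, Continuous g → IsOpen {q | g q ≠ 0} := fun hg =>
    isOpen_ne_fun hg continuous_const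
  refine (isOpen_lt continuous_const (continuous_apply 0)).inter ((h ?_).inter ((h ?_).inter
    ((h ?_).inter (h ?_)))) <;> fun_prop

theorem isOpen_phase : IsOpen S.phase := S.isOpen_region.preimage continuous_fst

variable {S}

theorem r_ne {x : PhaseSpace 3} (hx : x ∈ S.phase) : x.1 0 ≠ 0 := hx.1.ne'
theorem sin₁_ne {x : PhaseSpace 3} (hx : x ∈ S.phase) : Real.sin (S.k₁ * x.1 1) ≠ 0 := hx.2.1
theorem cos₁_ne {x : PhaseSpace 3} (hx : x ∈ S.phase) : Real.cos (S.k₁ * x.1 1) ≠ 0 := hx.2.2.1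
theorem sin₂_ne {x : PhaseSpace 3} (hx : x ∈ S.phase) : Real.sin (S.k₂ * x.1 2) ≠ 0 :=
  hx.2.2.2.1
theorem cos₂_ne {x : PhaseSpace 3} (hx : x ∈ S.phase) : Real.cos (S.k₂ * x.1 2) ≠ 0 :=
  hx.2.2.2.2

theorem analyticAt_position (x : PhaseSpace 3) (i : Fin 3) :
    AnalyticAt ℝ (fun y : PhaseSpace 3 => y.1 i) x :=
  ((ContinuousLinearMap.proj (R := ℝ) (φ := fun _ : Fin 3 => ℝ) i).comp
    (ContinuousLinearMap.fst ℝ _ _)).analyticAt x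

theorem analyticAt_momentum (x : PhaseSpace 3) (i : Fin 3) :
    AnalyticAt ℝ (fun y : PhaseSpace 3 => y.2 i) x :=
  ((ContinuousLinearMap.proj (R := ℝ) (φ := fun _ : Fin 3 => ℝ) i).comp
    (ContinuousLinearMap.snd ℝ _ _)).analyticAt x

theorem analyticAt_sin_mul (k : ℝ) (x : PhaseSpace 3) (i : Fin 3) :
    AnalyticAt ℝ (fun y : PhaseSpace 3 => Real.sin (k * y.1 i)) x :=
  (Real.analyticAt_sin).fun_comp (analyticAt_const.fun_mul (analyticAt_position x i))

theorem analyticAt_cos_mul (k : ℝ) (x : PhaseSpace 3) (i : Fin 3) :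
    AnalyticAt ℝ (fun y : PhaseSpace 3 => Real.cos (k * y.1 i)) x :=
  (Real.analyticAt_cos).fun_comp (analyticAt_const.fun_mul (analyticAt_position x i))

theorem analytic_L₃ : AnalyticOnNhd ℝ S.L₃ S.phase := fun x hx =>
  (((analyticAt_momentum x 2).fun_pow 2).fun_add (analyticAt_const.fun_div
    ((analyticAt_cos_mul _ x 2).fun_pow 2) (pow_ne_zero 2 (cos₂_ne hx)))).fun_add
    (analyticAt_const.fun_div ((analyticAt_sin_mul _ x 2).fun_pow 2) (pow_ne_zero 2 (sin₂_ne hx)))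

theorem analytic_L₂ : AnalyticOnNhd ℝ S.L₂ S.phase := fun x hx =>
  (((analyticAt_momentum x 1).fun_pow 2).fun_add ((analytic_L₃ x hx).fun_div
    ((analyticAt_sin_mul _ x 1).fun_pow 2) (pow_ne_zero 2 (sin₁_ne hx)))).fun_add
    (analyticAt_const.fun_div ((analyticAt_cos_mul _ x 1).fun_pow 2) (pow_ne_zero 2 (cos₁_ne hx)))

theorem analytic_H : AnalyticOnNhd ℝ S.H S.phase := fun x hx =>
  (((analyticAt_momentum x 0).fun_pow 2).fun_add (analyticAt_const.fun_div
    (analyticAt_position x 0) (r_ne hx))).fun_add ((analytic_L₂ x hx).fun_div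
    ((analyticAt_position x 0).fun_pow 2) (pow_ne_zero 2 (r_ne hx)))

theorem differentiableAt_L₃ {x : PhaseSpace 3} (hx : x ∈ S.phase) : DifferentiableAt ℝ S.L₃ x :=
  (analytic_L₃ x hx).differentiableAt

theorem differentiableAt_L₂ {x : PhaseSpace 3} (hx : x ∈ S.phase) : DifferentiableAt ℝ S.L₂ x :=
  (analytic_L₂ x hx).differentiableAt

theorem differentiableAt_H {x : PhaseSpace 3} (hx : x ∈ S.phase) : DifferentiableAt ℝ S.H x :=
  (analytic_H x hx).differentiableAt

theorem fderiv_L₃ {x : PhaseSpace 3} (hx : x ∈ S.phase) (w : PhaseSpace 3) :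
    fderiv ℝ S.L₃ x w = 2 * x.2 2 * w.2 2 +
      (2 * S.k₂ * S.β * Real.sin (S.k₂ * x.1 2) / Real.cos (S.k₂ * x.1 2) ^ 3 -
        2 * S.k₂ * S.γ * Real.cos (S.k₂ * x.1 2) / Real.sin (S.k₂ * x.1 2) ^ 3) * w.1 2 := by
  have h1 := sin₂_ne hx
  have h2 := cos₂_ne hx
  refine fderiv_eq_of_hasDerivAt (differentiableAt_L₃ hx) ?_
  have hs := ((hasDerivAt_position x w 2).const_mul S.k₂).sin.fun_pow 2
  have hc := ((hasDerivAt_position x w 2).const_mul S.k₂).cos.fun_pow 2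
  have h := (((hasDerivAt_momentum x w 2).fun_pow 2).fun_add
    ((hasDerivAt_const (0 : ℝ) S.β).fun_div hc (by simpa using h2))).fun_add
    ((hasDerivAt_const (0 : ℝ) S.γ).fun_div hs (by simpa using h1))
  refine h.congr_deriv ?_
  simp only [zero_smul, add_zero]
  push_cast
  field_simp
  ring

theorem fderiv_L₂ {x : PhaseSpace 3} (hx : x ∈ S.phase) (w : PhaseSpace 3) :
    fderiv ℝ S.L₂ x w = 2 * x.2 1 * w.2 1 + fderiv ℝ S.L₃ x w / Real.sin (S.k₁ * x.1 1) ^ 2 +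
      (2 * S.k₁ * S.δ * Real.sin (S.k₁ * x.1 1) / Real.cos (S.k₁ * x.1 1) ^ 3 -
        2 * S.k₁ * S.L₃ x * Real.cos (S.k₁ * x.1 1) / Real.sin (S.k₁ * x.1 1) ^ 3) * w.1 1 := by
  have h1 := sin₁_ne hx
  have h2 := cos₁_ne hx
  refine fderiv_eq_of_hasDerivAt (differentiableAt_L₂ hx) ?_
  have hs := ((hasDerivAt_position x w 1).const_mul S.k₁).sin.fun_pow 2
  have hc := ((hasDerivAt_position x w 1).const_mul S.k₁).cos.fun_pow 2
  have h := (((hasDerivAt_momentum x w 1).fun_pow 2).fun_add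
    ((hasDerivAt_fderiv (differentiableAt_L₃ hx) w).fun_div hs (by simpa using h1))).fun_add
    ((hasDerivAt_const (0 : ℝ) S.δ).fun_div hc (by simpa using h2))
  refine h.congr_deriv ?_
  simp only [zero_smul, add_zero]
  push_cast
  field_simp
  ring

theorem fderiv_H {x : PhaseSpace 3} (hx : x ∈ S.phase) (w : PhaseSpace 3) :
    fderiv ℝ S.H x w = 2 * x.2 0 * w.2 0 + fderiv ℝ S.L₂ x w / x.1 0 ^ 2 -
      (S.α / x.1 0 ^ 2 + 2 * S.L₂ x / x.1 0 ^ 3) * w.1 0 := by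
  have h1 := r_ne hx
  refine fderiv_eq_of_hasDerivAt (differentiableAt_H hx) ?_
  have hr := hasDerivAt_position x w 0
  have h := (((hasDerivAt_momentum x w 0).fun_pow 2).fun_add
    ((hasDerivAt_const (0 : ℝ) S.α).fun_div hr (by simpa using h1))).fun_add
    ((hasDerivAt_fderiv (differentiableAt_L₂ hx) w).fun_div (hr.fun_pow 2) (by simpa using h1))
  refine h.congr_deriv ?_
  simp only [zero_smul, add_zero]
  push_cast
  field_simp
  ring

section Hamiltonian

variable {x : PhaseSpace 3} (hx : x ∈ S.phase)
include hx

theorem hamiltonianVector_L₃ : hamiltonianVector S.L₃ x =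
    (![0, 0, -(2 * x.2 2)], ![0, 0,
      2 * S.k₂ * S.β * Real.sin (S.k₂ * x.1 2) / Real.cos (S.k₂ * x.1 2) ^ 3 -
        2 * S.k₂ * S.γ * Real.cos (S.k₂ * x.1 2) / Real.sin (S.k₂ * x.1 2) ^ 3]) := by
  ext i <;> fin_cases i <;> simp [hamiltonianVector, fderiv_L₃ hx]

theorem hamiltonianVector_L₂ : hamiltonianVector S.L₂ x =
    (![0, -(2 * x.2 1), 0], ![0,
      2 * S.k₁ * S.δ * Real.sin (S.k₁ * x.1 1) / Real.cos (S.k₁ * x.1 1) ^ 3 -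
        2 * S.k₁ * S.L₃ x * Real.cos (S.k₁ * x.1 1) / Real.sin (S.k₁ * x.1 1) ^ 3, 0]) +
      (Real.sin (S.k₁ * x.1 1) ^ 2)⁻¹ • hamiltonianVector S.L₃ x := by
  ext i <;> fin_cases i <;> simp [hamiltonianVector, fderiv_L₂ hx, Matrix.vecHead, Matrix.vecTail] <;> ring

/-- `θ₂` and its momentum enter `L₂` only through `L₃`, which accounts for the multiple of the field
of `L₃`. `H` is nested over `L₂` in the same way, so brackets with `H` reduce to those with `L₂`,
and these to those with `L₃`. -/
theorem hamiltonianVector_H : hamiltonianVector S.H x =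
    (![-(2 * x.2 0), 0, 0], ![-(S.α / x.1 0 ^ 2 + 2 * S.L₂ x / x.1 0 ^ 3), 0, 0]) +
      (x.1 0 ^ 2)⁻¹ • hamiltonianVector S.L₂ x := by
  ext i <;> fin_cases i <;> simp [hamiltonianVector, fderiv_H hx, Matrix.vecHead, Matrix.vecTail] <;> ring

theorem poisson_L₂_left (f : PhaseSpace 3 → ℝ) : poisson S.L₂ f x =
    fderiv ℝ f x (![0, -(2 * x.2 1), 0], ![0,
      2 * S.k₁ * S.δ * Real.sin (S.k₁ * x.1 1) / Real.cos (S.k₁ * x.1 1) ^ 3 -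
        2 * S.k₁ * S.L₃ x * Real.cos (S.k₁ * x.1 1) / Real.sin (S.k₁ * x.1 1) ^ 3, 0]) +
      poisson S.L₃ f x / Real.sin (S.k₁ * x.1 1) ^ 2 := by
  rw [poisson_eq_fderiv, poisson_eq_fderiv, hamiltonianVector_L₂ hx, map_add, map_smul,
    smul_eq_mul, ← div_eq_inv_mul]

theorem poisson_H_left (f : PhaseSpace 3 → ℝ) : poisson S.H f x =
    fderiv ℝ f x (![-(2 * x.2 0), 0, 0],
      ![-(S.α / x.1 0 ^ 2 + 2 * S.L₂ x / x.1 0 ^ 3), 0, 0]) +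
      poisson S.L₂ f x / x.1 0 ^ 2 := by
  rw [poisson_eq_fderiv, poisson_eq_fderiv, hamiltonianVector_H hx, map_add, map_smul,
    smul_eq_mul, ← div_eq_inv_mul]

theorem poisson_L₂_L₃ : poisson S.L₂ S.L₃ x = 0 := by
  rw [poisson_L₂_left hx, poisson_self, fderiv_L₃ hx]
  simp

theorem poisson_L₃_L₂ : poisson S.L₃ S.L₂ x = 0 := by
  rw [poisson_antisymm, poisson_L₂_L₃ hx, neg_zero]

theorem poisson_H_L₂ : poisson S.H S.L₂ x = 0 := by
  rw [poisson_H_left hx, poisson_self, fderiv_L₂ hx, fderiv_L₃ hx]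
  simp

theorem poisson_H_L₃ : poisson S.H S.L₃ x = 0 := by
  rw [poisson_H_left hx, poisson_L₂_L₃ hx, fderiv_L₃ hx]
  simp

end Hamiltonian

end KeplerCoulomb

/-! ### The ladder factors as elements of quadratic extensions. -/

namespace KeplerCoulomb

variable (S : KeplerCoulomb)

/-- `-i X₁`, with `u = -i √L₂`. -/
noncomputable def zX₁ : QuadraticFunctions S.L₂ where
  re x := -S.L₂ x * (Real.cos (S.k₁ * x.1 1) ^ 2 - Real.sin (S.k₁ * x.1 1) ^ 2) + S.δ - S.L₃ x
  im x := 2 * Real.sin (S.k₁ * x.1 1) * Real.cos (S.k₁ * x.1 1) * x.2 1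

/-- `-i` times the conjugate of `Y₁`, with `u = -i √L₂`. -/
noncomputable def zY₁ : QuadraticFunctions S.L₂ where
  re x := S.α + 2 * S.L₂ x / x.1 0
  im x := 2 * x.2 0

/-- `-i X₂`, with `u = i √L₃`. -/
noncomputable def zX₂ : QuadraticFunctions S.L₃ where
  re x := S.L₃ x * (Real.cos (S.k₂ * x.1 2) ^ 2 - Real.sin (S.k₂ * x.1 2) ^ 2) + S.γ - S.β
  im x := 2 * Real.sin (S.k₂ * x.1 2) * Real.cos (S.k₂ * x.1 2) * x.2 2

/-- The conjugate of `Y₂`, with `u = i √L₃`. -/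
noncomputable def zY₂ : QuadraticFunctions S.L₃ where
  re x := -2 * S.L₃ x * (Real.cos (S.k₁ * x.1 1) / Real.sin (S.k₁ * x.1 1)) ^ 2 +
    (S.L₂ x - S.L₃ x - S.δ)
  im x := 2 * (Real.cos (S.k₁ * x.1 1) / Real.sin (S.k₁ * x.1 1)) * x.2 1

noncomputable def zJ : QuadraticFunctions S.L₂ := S.zX₁ ^ S.q₁ * S.zY₁ ^ (2 * S.p₁)

noncomputable def zK : QuadraticFunctions S.L₃ :=
  S.zX₂ ^ (S.p₁ * S.q₂) * S.zY₂ ^ (S.p₂ * S.q₁)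

variable {S}

theorem analyticAt_cos_sq_sub_sin_sq (k : ℝ) (i : Fin 3) (x : PhaseSpace 3) :
    AnalyticAt ℝ (fun y : PhaseSpace 3 => Real.cos (k * y.1 i) ^ 2 - Real.sin (k * y.1 i) ^ 2) x :=
  ((analyticAt_cos_mul k x i).fun_pow 2).fun_sub ((analyticAt_sin_mul k x i).fun_pow 2)

theorem analyticAt_sin_mul_cos_mul_momentum (k : ℝ) (i : Fin 3) (x : PhaseSpace 3) :
    AnalyticAt ℝ (fun y : PhaseSpace 3 =>
      2 * Real.sin (k * y.1 i) * Real.cos (k * y.1 i) * y.2 i) x :=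
  (((analyticAt_const).fun_mul (analyticAt_sin_mul k x i)).fun_mul
    (analyticAt_cos_mul k x i)).fun_mul (analyticAt_momentum x i)

theorem isAnalytic_zX₁ : S.zX₁.IsAnalytic S.phase :=
  ⟨fun x hx => (((analytic_L₂ x hx).fun_neg.fun_mul
      (analyticAt_cos_sq_sub_sin_sq S.k₁ 1 x)).fun_add analyticAt_const).fun_sub (analytic_L₃ x hx),
    fun x _ => analyticAt_sin_mul_cos_mul_momentum S.k₁ 1 x⟩

theorem isAnalytic_zY₁ : S.zY₁.IsAnalytic S.phase :=
  ⟨fun x hx => analyticAt_const.fun_add ((analyticAt_const.fun_mul (analytic_L₂ x hx)).fun_div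
      (analyticAt_position x 0) (r_ne hx)),
    fun x _ => analyticAt_const.fun_mul (analyticAt_momentum x 0)⟩

theorem isAnalytic_zX₂ : S.zX₂.IsAnalytic S.phase :=
  ⟨fun x hx => (((analytic_L₃ x hx).fun_mul
      (analyticAt_cos_sq_sub_sin_sq S.k₂ 2 x)).fun_add analyticAt_const).fun_sub analyticAt_const,
    fun x _ => analyticAt_sin_mul_cos_mul_momentum S.k₂ 2 x⟩

theorem analyticAt_cot {x : PhaseSpace 3} (hx : x ∈ S.phase) : AnalyticAt ℝ
    (fun y : PhaseSpace 3 => Real.cos (S.k₁ * y.1 1) / Real.sin (S.k₁ * y.1 1)) x :=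
  (analyticAt_cos_mul S.k₁ x 1).fun_div (analyticAt_sin_mul S.k₁ x 1) (sin₁_ne hx)

theorem isAnalytic_zY₂ : S.zY₂.IsAnalytic S.phase :=
  ⟨fun x hx => ((analyticAt_const.fun_mul (analytic_L₃ x hx)).fun_mul
      ((analyticAt_cot hx).fun_pow 2)).fun_add
      (((analytic_L₂ x hx).fun_sub (analytic_L₃ x hx)).fun_sub analyticAt_const),
    fun x hx => (analyticAt_const.fun_mul (analyticAt_cot hx)).fun_mul (analyticAt_momentum x 1)⟩

theorem isAnalytic_zJ : S.zJ.IsAnalytic S.phase :=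
  (isAnalytic_zX₁.pow analytic_L₂ _).mul analytic_L₂ (isAnalytic_zY₁.pow analytic_L₂ _)

theorem isAnalytic_zK : S.zK.IsAnalytic S.phase :=
  (isAnalytic_zX₂.pow analytic_L₃ _).mul analytic_L₃ (isAnalytic_zY₂.pow analytic_L₃ _)

theorem fderiv_cos_sq_sub_sin_sq (k : ℝ) (i : Fin 3) (x w : PhaseSpace 3) :
    fderiv ℝ (fun y : PhaseSpace 3 => Real.cos (k * y.1 i) ^ 2 - Real.sin (k * y.1 i) ^ 2) x w =
      -(4 * k * Real.sin (k * x.1 i) * Real.cos (k * x.1 i)) * w.1 i := by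
  refine fderiv_eq_of_hasDerivAt (analyticAt_cos_sq_sub_sin_sq k i x).differentiableAt ?_
  have h := ((hasDerivAt_position x w i).const_mul k)
  refine ((h.cos.fun_pow 2).fun_sub (h.sin.fun_pow 2)).congr_deriv ?_
  simp only [zero_smul, add_zero]
  push_cast
  ring

theorem fderiv_sin_mul_cos_mul_momentum (k : ℝ) (i : Fin 3) (x w : PhaseSpace 3) :
    fderiv ℝ (fun y : PhaseSpace 3 =>
      2 * Real.sin (k * y.1 i) * Real.cos (k * y.1 i) * y.2 i) x w =
      2 * k * (Real.cos (k * x.1 i) ^ 2 - Real.sin (k * x.1 i) ^ 2) * x.2 i * w.1 i +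
        2 * Real.sin (k * x.1 i) * Real.cos (k * x.1 i) * w.2 i := by
  refine fderiv_eq_of_hasDerivAt (analyticAt_sin_mul_cos_mul_momentum k i x).differentiableAt ?_
  have h := ((hasDerivAt_position x w i).const_mul k)
  refine (((h.sin.const_mul 2).fun_mul h.cos).fun_mul (hasDerivAt_momentum x w i)).congr_deriv ?_
  simp only [zero_smul, add_zero]
  ring

theorem fderiv_zX₁_im (x w : PhaseSpace 3) : fderiv ℝ S.zX₁.im x w =
    2 * S.k₁ * (Real.cos (S.k₁ * x.1 1) ^ 2 - Real.sin (S.k₁ * x.1 1) ^ 2) * x.2 1 * w.1 1 +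
      2 * Real.sin (S.k₁ * x.1 1) * Real.cos (S.k₁ * x.1 1) * w.2 1 :=
  fderiv_sin_mul_cos_mul_momentum S.k₁ 1 x w

theorem fderiv_zX₂_im (x w : PhaseSpace 3) : fderiv ℝ S.zX₂.im x w =
    2 * S.k₂ * (Real.cos (S.k₂ * x.1 2) ^ 2 - Real.sin (S.k₂ * x.1 2) ^ 2) * x.2 2 * w.1 2 +
      2 * Real.sin (S.k₂ * x.1 2) * Real.cos (S.k₂ * x.1 2) * w.2 2 :=
  fderiv_sin_mul_cos_mul_momentum S.k₂ 2 x w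

section Derivatives

variable {x : PhaseSpace 3} (hx : x ∈ S.phase) (w : PhaseSpace 3)
include hx

theorem fderiv_zX₁_re : fderiv ℝ S.zX₁.re x w =
    -fderiv ℝ S.L₂ x w * (Real.cos (S.k₁ * x.1 1) ^ 2 - Real.sin (S.k₁ * x.1 1) ^ 2) +
      4 * S.k₁ * S.L₂ x * Real.sin (S.k₁ * x.1 1) * Real.cos (S.k₁ * x.1 1) * w.1 1 -
      fderiv ℝ S.L₃ x w := by
  refine fderiv_eq_of_hasDerivAt (isAnalytic_zX₁.1 x hx).differentiableAt ?_
  have h := hasDerivAt_fderiv (analyticAt_cos_sq_sub_sin_sq S.k₁ 1 x).differentiableAt w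
  rw [fderiv_cos_sq_sub_sin_sq] at h
  refine ((((hasDerivAt_fderiv (differentiableAt_L₂ hx) w).fun_neg.fun_mul h).add_const
    S.δ).fun_sub (hasDerivAt_fderiv (differentiableAt_L₃ hx) w)).congr_deriv ?_
  simp only [zero_smul, add_zero]
  ring

theorem fderiv_zY₁_re : fderiv ℝ S.zY₁.re x w =
    2 * fderiv ℝ S.L₂ x w / x.1 0 - 2 * S.L₂ x / x.1 0 ^ 2 * w.1 0 := by
  have h0 := r_ne hx
  refine fderiv_eq_of_hasDerivAt (isAnalytic_zY₁.1 x hx).differentiableAt ?_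
  refine ((((hasDerivAt_fderiv (differentiableAt_L₂ hx) w).const_mul 2).fun_div
    (hasDerivAt_position x w 0) (by simpa using h0)).const_add S.α).congr_deriv ?_
  simp only [zero_smul, add_zero]
  field_simp

theorem fderiv_zY₁_im : fderiv ℝ S.zY₁.im x w = 2 * w.2 0 :=
  fderiv_eq_of_hasDerivAt (isAnalytic_zY₁.2 x hx).differentiableAt
    ((hasDerivAt_momentum x w 0).const_mul 2)

theorem fderiv_zX₂_re : fderiv ℝ S.zX₂.re x w =
    fderiv ℝ S.L₃ x w * (Real.cos (S.k₂ * x.1 2) ^ 2 - Real.sin (S.k₂ * x.1 2) ^ 2) -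
      4 * S.k₂ * S.L₃ x * Real.sin (S.k₂ * x.1 2) * Real.cos (S.k₂ * x.1 2) * w.1 2 := by
  refine fderiv_eq_of_hasDerivAt (isAnalytic_zX₂.1 x hx).differentiableAt ?_
  have h := hasDerivAt_fderiv (analyticAt_cos_sq_sub_sin_sq S.k₂ 2 x).differentiableAt w
  rw [fderiv_cos_sq_sub_sin_sq] at h
  refine ((((hasDerivAt_fderiv (differentiableAt_L₃ hx) w).fun_mul h).add_const
    S.γ).sub_const S.β).congr_deriv ?_
  simp only [zero_smul, add_zero]
  ring

theorem hasDerivAt_cot : HasDerivAt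
    (fun t : ℝ => Real.cos (S.k₁ * (x + t • w).1 1) / Real.sin (S.k₁ * (x + t • w).1 1))
    (-(S.k₁ / Real.sin (S.k₁ * x.1 1) ^ 2) * w.1 1) 0 := by
  have h0 := sin₁_ne hx
  have h := ((hasDerivAt_position x w 1).const_mul S.k₁)
  refine (h.cos.fun_div h.sin (by simpa using h0)).congr_deriv ?_
  simp only [zero_smul, add_zero]
  field_simp
  linear_combination (-(S.k₁ * w.1 1)) * Real.sin_sq_add_cos_sq (S.k₁ * x.1 1)

theorem fderiv_zY₂_re : fderiv ℝ S.zY₂.re x w =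
    -2 * fderiv ℝ S.L₃ x w * (Real.cos (S.k₁ * x.1 1) / Real.sin (S.k₁ * x.1 1)) ^ 2 +
      4 * S.k₁ * S.L₃ x * Real.cos (S.k₁ * x.1 1) / Real.sin (S.k₁ * x.1 1) ^ 3 * w.1 1 +
      fderiv ℝ S.L₂ x w - fderiv ℝ S.L₃ x w := by
  have h0 := sin₁_ne hx
  refine fderiv_eq_of_hasDerivAt (isAnalytic_zY₂.1 x hx).differentiableAt ?_
  have h3 := hasDerivAt_fderiv (differentiableAt_L₃ hx) w
  refine (((h3.const_mul (-2)).fun_mul ((hasDerivAt_cot hx w).fun_pow 2)).fun_add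
    (((hasDerivAt_fderiv (differentiableAt_L₂ hx) w).fun_sub h3).sub_const S.δ)).congr_deriv ?_
  simp only [zero_smul, add_zero]
  push_cast
  field_simp
  ring

theorem fderiv_zY₂_im : fderiv ℝ S.zY₂.im x w =
    -(2 * S.k₁ / Real.sin (S.k₁ * x.1 1) ^ 2) * x.2 1 * w.1 1 +
      2 * (Real.cos (S.k₁ * x.1 1) / Real.sin (S.k₁ * x.1 1)) * w.2 1 := by
  refine fderiv_eq_of_hasDerivAt (isAnalytic_zY₂.2 x hx).differentiableAt ?_
  refine (((hasDerivAt_cot hx w).const_mul 2).fun_mul (hasDerivAt_momentum x w 1)).congr_deriv ?_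
  simp only [zero_smul, add_zero]
  ring

end Derivatives

/-! ### Eigenvalues of the four factors. -/

section Eigenvectors

open QuadraticFunctions

variable {x : PhaseSpace 3} (hx : x ∈ S.phase)
include hx

omit hx in
theorem fderiv_L₂_hamiltonianVector_L₂ : fderiv ℝ S.L₂ x (hamiltonianVector S.L₂ x) = 0 := by
  rw [← poisson_eq_fderiv, poisson_self]

omit hx in
theorem fderiv_L₃_hamiltonianVector_L₃ : fderiv ℝ S.L₃ x (hamiltonianVector S.L₃ x) = 0 := by
  rw [← poisson_eq_fderiv, poisson_self]

theorem fderiv_L₃_hamiltonianVector_L₂ : fderiv ℝ S.L₃ x (hamiltonianVector S.L₂ x) = 0 := by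
  rw [← poisson_eq_fderiv, poisson_L₂_L₃ hx]

theorem fderiv_L₂_hamiltonianVector_L₃ : fderiv ℝ S.L₂ x (hamiltonianVector S.L₃ x) = 0 := by
  rw [← poisson_eq_fderiv, poisson_L₃_L₂ hx]

theorem fderiv_L₂_hamiltonianVector_H : fderiv ℝ S.L₂ x (hamiltonianVector S.H x) = 0 := by
  rw [← poisson_eq_fderiv, poisson_H_L₂ hx]

theorem fderiv_L₃_hamiltonianVector_H : fderiv ℝ S.L₃ x (hamiltonianVector S.H x) = 0 := by
  rw [← poisson_eq_fderiv, poisson_H_L₃ hx]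

/-- Where `L₂ > 0`, `cos (2 k₁ θ₁)` oscillates harmonically about a constant along the flow of `L₂`.
The real component is this shifted oscillation up to scale, and the imaginary one is proportional to
its velocity. -/
theorem isEigen_L₂_zX₁ : S.zX₁.IsEigen x (hamiltonianVector S.L₂ x) (4 * S.k₁) := by
  have h1 := sin₁_ne hx
  have h2 := cos₁_ne hx
  have h5 := Real.sin_sq_add_cos_sq (S.k₁ * x.1 1)
  -- The second component contains both the squared momentum and `L₂`; this relation trades one for
  -- the other.
  have h6 : S.L₂ x = x.2 1 ^ 2 + S.L₃ x / Real.sin (S.k₁ * x.1 1) ^ 2 +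
    S.δ / Real.cos (S.k₁ * x.1 1) ^ 2 := rfl
  refine isEigen_iff.2 ⟨?_, ?_⟩
  · rw [fderiv_zX₁_re hx, fderiv_L₂_hamiltonianVector_L₂, fderiv_L₃_hamiltonianVector_L₂ hx]
    simp [hamiltonianVector_L₂ hx, hamiltonianVector_L₃ hx, zX₁]
    field_simp
  · rw [fderiv_zX₁_im]
    simp [hamiltonianVector_L₂ hx, hamiltonianVector_L₃ hx, zX₁]
    field_simp
    grind

theorem isEigen_L₂_zY₁ : S.zY₁.IsEigen x (hamiltonianVector S.L₂ x) (0) := by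
  refine isEigen_iff.2 ⟨?_, ?_⟩
  · rw [fderiv_zY₁_re hx, fderiv_L₂_hamiltonianVector_L₂]
    simp [hamiltonianVector_L₂ hx, hamiltonianVector_L₃ hx, zY₁]
  · rw [fderiv_zY₁_im hx]
    simp [hamiltonianVector_L₂ hx, hamiltonianVector_L₃ hx, zY₁]

theorem isEigen_H_zX₁ : S.zX₁.IsEigen x (hamiltonianVector S.H x) (4 * S.k₁ / x.1 0 ^ 2) := by
  have h0 := r_ne hx
  have h1 := sin₁_ne hx
  have h2 := cos₁_ne hx
  have h5 := Real.sin_sq_add_cos_sq (S.k₁ * x.1 1)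
  have h6 : S.L₂ x = x.2 1 ^ 2 + S.L₃ x / Real.sin (S.k₁ * x.1 1) ^ 2 +
    S.δ / Real.cos (S.k₁ * x.1 1) ^ 2 := rfl
  refine isEigen_iff.2 ⟨?_, ?_⟩
  · rw [fderiv_zX₁_re hx, fderiv_L₂_hamiltonianVector_H hx, fderiv_L₃_hamiltonianVector_H hx]
    simp [hamiltonianVector_H hx, hamiltonianVector_L₂ hx,
      hamiltonianVector_L₃ hx, zX₁]
    field_simp
  · rw [fderiv_zX₁_im]
    simp [hamiltonianVector_H hx, hamiltonianVector_L₂ hx,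
      hamiltonianVector_L₃ hx, zX₁]
    field_simp
    grind

theorem isEigen_H_zY₁ : S.zY₁.IsEigen x (hamiltonianVector S.H x) (-2 / x.1 0 ^ 2) := by
  have h0 := r_ne hx
  have h1 := sin₁_ne hx
  have h2 := cos₁_ne hx
  have h5 := Real.sin_sq_add_cos_sq (S.k₁ * x.1 1)
  have h6 : S.L₂ x = x.2 1 ^ 2 + S.L₃ x / Real.sin (S.k₁ * x.1 1) ^ 2 +
    S.δ / Real.cos (S.k₁ * x.1 1) ^ 2 := rfl
  refine isEigen_iff.2 ⟨?_, ?_⟩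
  · rw [fderiv_zY₁_re hx, fderiv_L₂_hamiltonianVector_H hx]
    simp [hamiltonianVector_H hx, hamiltonianVector_L₂ hx,
      hamiltonianVector_L₃ hx, zY₁]
    field_simp
  · rw [fderiv_zY₁_im hx]
    simp [hamiltonianVector_H hx, hamiltonianVector_L₂ hx,
      hamiltonianVector_L₃ hx, zY₁]
    field_simp
    grind

theorem isEigen_L₃_zX₁ : S.zX₁.IsEigen x (hamiltonianVector S.L₃ x) (0) := by
  refine isEigen_iff.2 ⟨?_, ?_⟩
  · rw [fderiv_zX₁_re hx, fderiv_L₂_hamiltonianVector_L₃ hx, fderiv_L₃_hamiltonianVector_L₃]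
    simp [hamiltonianVector_L₃ hx, zX₁]
  · rw [fderiv_zX₁_im]
    simp [hamiltonianVector_L₃ hx, zX₁]

theorem isEigen_L₃_zY₁ : S.zY₁.IsEigen x (hamiltonianVector S.L₃ x) (0) := by
  refine isEigen_iff.2 ⟨?_, ?_⟩
  · rw [fderiv_zY₁_re hx, fderiv_L₂_hamiltonianVector_L₃ hx]
    simp [hamiltonianVector_L₃ hx, zY₁]
  · rw [fderiv_zY₁_im hx]
    simp [hamiltonianVector_L₃ hx, zY₁]

theorem isEigen_L₃_zX₂ : S.zX₂.IsEigen x (hamiltonianVector S.L₃ x) (-(4 * S.k₂)) := by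
  have h3 := sin₂_ne hx
  have h4 := cos₂_ne hx
  have h5 := Real.sin_sq_add_cos_sq (S.k₂ * x.1 2)
  have h6 : S.L₃ x = x.2 2 ^ 2 + S.β / Real.cos (S.k₂ * x.1 2) ^ 2 +
    S.γ / Real.sin (S.k₂ * x.1 2) ^ 2 := rfl
  refine isEigen_iff.2 ⟨?_, ?_⟩
  · rw [fderiv_zX₂_re hx, fderiv_L₃_hamiltonianVector_L₃]
    simp [hamiltonianVector_L₃ hx, zX₂]
    field_simp
  · rw [fderiv_zX₂_im]
    simp [hamiltonianVector_L₃ hx, zX₂]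
    field_simp
    grind

theorem isEigen_L₃_zY₂ : S.zY₂.IsEigen x (hamiltonianVector S.L₃ x) (0) := by
  refine isEigen_iff.2 ⟨?_, ?_⟩
  · rw [fderiv_zY₂_re hx, fderiv_L₂_hamiltonianVector_L₃ hx, fderiv_L₃_hamiltonianVector_L₃]
    simp [hamiltonianVector_L₃ hx, zY₂]
  · rw [fderiv_zY₂_im hx]
    simp [hamiltonianVector_L₃ hx, zY₂]

theorem isEigen_L₂_zX₂ : S.zX₂.IsEigen x (hamiltonianVector S.L₂ x) (-(4 * S.k₂) / Real.sin (S.k₁ * x.1 1) ^ 2) := by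
  have h1 := sin₁_ne hx
  have h2 := cos₁_ne hx
  have h3 := sin₂_ne hx
  have h4 := cos₂_ne hx
  have h5 := Real.sin_sq_add_cos_sq (S.k₂ * x.1 2)
  have h6 : S.L₃ x = x.2 2 ^ 2 + S.β / Real.cos (S.k₂ * x.1 2) ^ 2 +
    S.γ / Real.sin (S.k₂ * x.1 2) ^ 2 := rfl
  refine isEigen_iff.2 ⟨?_, ?_⟩
  · rw [fderiv_zX₂_re hx, fderiv_L₃_hamiltonianVector_L₂ hx]
    simp [hamiltonianVector_L₂ hx, hamiltonianVector_L₃ hx, zX₂]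
    field_simp
  · rw [fderiv_zX₂_im]
    simp [hamiltonianVector_L₂ hx, hamiltonianVector_L₃ hx, zX₂]
    field_simp
    grind

theorem isEigen_L₂_zY₂ : S.zY₂.IsEigen x (hamiltonianVector S.L₂ x) (4 * S.k₁ / Real.sin (S.k₁ * x.1 1) ^ 2) := by
  have h1 := sin₁_ne hx
  have h2 := cos₁_ne hx
  have h5 := Real.sin_sq_add_cos_sq (S.k₁ * x.1 1)
  have h6 : S.L₂ x = x.2 1 ^ 2 + S.L₃ x / Real.sin (S.k₁ * x.1 1) ^ 2 +
    S.δ / Real.cos (S.k₁ * x.1 1) ^ 2 := rfl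
  refine isEigen_iff.2 ⟨?_, ?_⟩
  · rw [fderiv_zY₂_re hx, fderiv_L₂_hamiltonianVector_L₂, fderiv_L₃_hamiltonianVector_L₂ hx]
    simp [hamiltonianVector_L₂ hx, hamiltonianVector_L₃ hx, zY₂]
    field_simp
  · rw [fderiv_zY₂_im hx]
    simp [hamiltonianVector_L₂ hx, hamiltonianVector_L₃ hx, zY₂]
    field_simp
    grind

theorem isEigen_H_zX₂ : S.zX₂.IsEigen x (hamiltonianVector S.H x) (-(4 * S.k₂) / Real.sin (S.k₁ * x.1 1) ^ 2 / x.1 0 ^ 2) := by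
  have h0 := r_ne hx
  have h1 := sin₁_ne hx
  have h2 := cos₁_ne hx
  have h3 := sin₂_ne hx
  have h4 := cos₂_ne hx
  have h5 := Real.sin_sq_add_cos_sq (S.k₂ * x.1 2)
  have h6 : S.L₃ x = x.2 2 ^ 2 + S.β / Real.cos (S.k₂ * x.1 2) ^ 2 +
    S.γ / Real.sin (S.k₂ * x.1 2) ^ 2 := rfl
  refine isEigen_iff.2 ⟨?_, ?_⟩
  · rw [fderiv_zX₂_re hx, fderiv_L₃_hamiltonianVector_H hx]
    simp [hamiltonianVector_H hx, hamiltonianVector_L₂ hx,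
      hamiltonianVector_L₃ hx, zX₂]
    field_simp
  · rw [fderiv_zX₂_im]
    simp [hamiltonianVector_H hx, hamiltonianVector_L₂ hx,
      hamiltonianVector_L₃ hx, zX₂]
    field_simp
    grind

theorem isEigen_H_zY₂ : S.zY₂.IsEigen x (hamiltonianVector S.H x) (4 * S.k₁ / Real.sin (S.k₁ * x.1 1) ^ 2 / x.1 0 ^ 2) := by
  have h0 := r_ne hx
  have h1 := sin₁_ne hx
  have h2 := cos₁_ne hx
  have h5 := Real.sin_sq_add_cos_sq (S.k₁ * x.1 1)
  have h6 : S.L₂ x = x.2 1 ^ 2 + S.L₃ x / Real.sin (S.k₁ * x.1 1) ^ 2 +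
    S.δ / Real.cos (S.k₁ * x.1 1) ^ 2 := rfl
  refine isEigen_iff.2 ⟨?_, ?_⟩
  · rw [fderiv_zY₂_re hx, fderiv_L₂_hamiltonianVector_H hx, fderiv_L₃_hamiltonianVector_H hx]
    simp [hamiltonianVector_H hx, hamiltonianVector_L₂ hx,
      hamiltonianVector_L₃ hx, zY₂]
    field_simp
  · rw [fderiv_zY₂_im hx]
    simp [hamiltonianVector_H hx, hamiltonianVector_L₂ hx,
      hamiltonianVector_L₃ hx, zY₂]
    field_simp
    grind

end Eigenvectors

end KeplerCoulomb

/-! ### The one-degree-of-freedom identity behind the mixed brackets. -/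

section TrigonometricIdentities

variable {s c p l₂ l₃ d : ℝ} (hs : s ≠ 0) (hc : c ≠ 0) (h : s ^ 2 + c ^ 2 = 1)
  (hl : l₂ = p ^ 2 + l₃ / s ^ 2 + d / c ^ 2)
include hs hc h hl

/-! The four components, with respect to `1`, `v`, `u`, `u v`, of the identity that expresses the
bracket of the raising functions `J` and `K`. -/

theorem bracket_identity_one :
    ((l₃ - l₂ - d) ^ 2 - 4 * d * l₂) * (8 * l₂ * s * c * p - 4 * l₃ * (2 * (c / s) * p)) =
      4 * (l₂ * (l₂ - l₃ - d) * (2 * s * c * p) * (-2 * l₃ * (c / s) ^ 2 + (l₂ - l₃ - d)) -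
        l₃ * (l₂ - l₃ + d) * (-l₂ * (c ^ 2 - s ^ 2) + d - l₃) * (2 * (c / s) * p)) := by
  subst hl
  field_simp
  grind

theorem bracket_identity_v :
    ((l₃ - l₂ - d) ^ 2 - 4 * d * l₂) *
        (8 * l₂ * s * c * (c / s) + 4 * (-2 * l₃ * (c / s) ^ 2 + (l₂ - l₃ - d))) =
      4 * (l₂ * (l₂ - l₃ - d) * (2 * s * c * p) * (2 * (c / s) * p) +
        (l₂ - l₃ + d) * (-l₂ * (c ^ 2 - s ^ 2) + d - l₃) *
          (-2 * l₃ * (c / s) ^ 2 + (l₂ - l₃ - d))) := by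
  subst hl
  field_simp
  grind

theorem bracket_identity_u :
    ((l₃ - l₂ - d) ^ 2 - 4 * d * l₂) *
        (4 * (c ^ 2 - s ^ 2) * p ^ 2 -
          2 * s * c * (2 * l₃ * c / s ^ 3 + 2 * d * s / c ^ 3)) =
      4 * (-(l₂ - l₃ - d) * (-l₂ * (c ^ 2 - s ^ 2) + d - l₃) *
          (-2 * l₃ * (c / s) ^ 2 + (l₂ - l₃ - d)) -
        l₃ * (l₂ - l₃ + d) * (2 * s * c * p) * (2 * (c / s) * p)) := by
  subst hl
  field_simp
  grind

theorem bracket_identity_u_v :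
    ((l₃ - l₂ - d) ^ 2 - 4 * d * l₂) *
        (4 * (c ^ 2 - s ^ 2) * p * (c / s) + 2 * s * c * (2 * p / s ^ 2)) =
      4 * (-(l₂ - l₃ - d) * (-l₂ * (c ^ 2 - s ^ 2) + d - l₃) * (2 * (c / s) * p) +
        (l₂ - l₃ + d) * (2 * s * c * p) * (-2 * l₃ * (c / s) ^ 2 + (l₂ - l₃ - d))) := by
  subst hl
  field_simp
  grind

end TrigonometricIdentities

/-! ### Eigenvalues and mutual brackets of `zJ` and `zK`. -/

namespace KeplerCoulomb

open QuadraticFunctions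

variable {S : KeplerCoulomb} {x : PhaseSpace 3}

theorem val_Q (x : PhaseSpace 3) :
    S.val S.Q x = (S.L₃ x - S.L₂ x - S.δ) ^ 2 - 4 * S.δ * S.L₂ x := by
  simp [val, Q]

section Eigenvectors

variable (hx : x ∈ S.phase)
include hx

theorem isEigen_zJ {w : PhaseSpace 3} (hw : fderiv ℝ S.L₂ x w = 0) {l m : ℝ}
    (h : S.zX₁.IsEigen x w l) (h' : S.zY₁.IsEigen x w m) :
    S.zJ.IsEigen x w (S.q₁ * l + (2 * S.p₁ : ℕ) * m) :=
  (h.pow hx analytic_L₂ hw isAnalytic_zX₁ _).mul hx analytic_L₂ hw (isAnalytic_zX₁.pow analytic_L₂ _)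
    (isAnalytic_zY₁.pow analytic_L₂ _) (h'.pow hx analytic_L₂ hw isAnalytic_zY₁ _)

theorem isEigen_zK {w : PhaseSpace 3} (hw : fderiv ℝ S.L₃ x w = 0) {l m : ℝ}
    (h : S.zX₂.IsEigen x w l) (h' : S.zY₂.IsEigen x w m) :
    S.zK.IsEigen x w ((S.p₁ * S.q₂ : ℕ) * l + (S.p₂ * S.q₁ : ℕ) * m) :=
  (h.pow hx analytic_L₃ hw isAnalytic_zX₂ _).mul hx analytic_L₃ hw (isAnalytic_zX₂.pow analytic_L₃ _)
    (isAnalytic_zY₂.pow analytic_L₃ _) (h'.pow hx analytic_L₃ hw isAnalytic_zY₂ _)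

theorem isEigen_L₂_zJ (hq₁ : S.q₁ ≠ 0) :
    S.zJ.IsEigen x (hamiltonianVector S.L₂ x) (4 * S.p₁) := by
  convert isEigen_zJ hx fderiv_L₂_hamiltonianVector_L₂ (isEigen_L₂_zX₁ hx) (isEigen_L₂_zY₁ hx)
    using 1
  have : (S.q₁ : ℝ) ≠ 0 := by exact_mod_cast hq₁
  rw [k₁]
  field_simp
  ring

/-- The exponents are made for this cancellation: `q₁` times `4 k₁ / r²` is `4 p₁ / r²`, and `2 p₁`
times `-2 / r²` is its negative. -/
theorem isEigen_H_zJ (hq₁ : S.q₁ ≠ 0) : S.zJ.IsEigen x (hamiltonianVector S.H x) 0 := by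
  convert isEigen_zJ hx (fderiv_L₂_hamiltonianVector_H hx) (isEigen_H_zX₁ hx) (isEigen_H_zY₁ hx)
    using 1
  have : (S.q₁ : ℝ) ≠ 0 := by exact_mod_cast hq₁
  have := r_ne hx
  rw [k₁]
  push_cast
  field_simp
  ring

theorem isEigen_L₃_zJ : S.zJ.IsEigen x (hamiltonianVector S.L₃ x) 0 := by
  convert isEigen_zJ hx (fderiv_L₂_hamiltonianVector_L₃ hx) (isEigen_L₃_zX₁ hx)
    (isEigen_L₃_zY₁ hx) using 1
  ring

theorem isEigen_L₃_zK (hq₂ : S.q₂ ≠ 0) :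
    S.zK.IsEigen x (hamiltonianVector S.L₃ x) (-(4 * S.p₁ * S.p₂)) := by
  convert isEigen_zK hx fderiv_L₃_hamiltonianVector_L₃ (isEigen_L₃_zX₂ hx) (isEigen_L₃_zY₂ hx)
    using 1
  have : (S.q₂ : ℝ) ≠ 0 := by exact_mod_cast hq₂
  rw [k₂]
  push_cast
  field_simp
  ring

/-- The contributions of `X₂` and `Y₂` are `∓ 4 p₁ p₂ / sin² (k₁ θ₁)`, because `p₁ q₂ k₂ = p₂ q₁ k₁
= p₁ p₂`. -/
theorem isEigen_L₂_zK (hq₁ : S.q₁ ≠ 0) (hq₂ : S.q₂ ≠ 0) :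
    S.zK.IsEigen x (hamiltonianVector S.L₂ x) 0 := by
  convert isEigen_zK hx (fderiv_L₃_hamiltonianVector_L₂ hx) (isEigen_L₂_zX₂ hx)
    (isEigen_L₂_zY₂ hx) using 1
  have : (S.q₁ : ℝ) ≠ 0 := by exact_mod_cast hq₁
  have : (S.q₂ : ℝ) ≠ 0 := by exact_mod_cast hq₂
  have := sin₁_ne hx
  rw [k₁, k₂]
  push_cast
  field_simp
  ring

theorem isEigen_H_zK (hq₁ : S.q₁ ≠ 0) (hq₂ : S.q₂ ≠ 0) :
    S.zK.IsEigen x (hamiltonianVector S.H x) 0 := by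
  convert isEigen_zK hx (fderiv_L₃_hamiltonianVector_H hx) (isEigen_H_zX₂ hx)
    (isEigen_H_zY₂ hx) using 1
  have : (S.q₁ : ℝ) ≠ 0 := by exact_mod_cast hq₁
  have : (S.q₂ : ℝ) ≠ 0 := by exact_mod_cast hq₂
  have := sin₁_ne hx
  have := r_ne hx
  rw [k₁, k₂]
  push_cast
  field_simp
  ring

end Eigenvectors

section Bracket

variable (hx : x ∈ S.phase)
include hx

/-- `K` does not depend on `r` and its momentum. -/
theorem isEigen_zK_radial {w : PhaseSpace 3} (h1 : w.1 1 = 0) (h2 : w.1 2 = 0) (h3 : w.2 1 = 0)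
    (h4 : w.2 2 = 0) : S.zK.IsEigen x w 0 := by
  have e3 : fderiv ℝ S.L₃ x w = 0 := by simp [fderiv_L₃ hx, h2, h4]
  have e2 : fderiv ℝ S.L₂ x w = 0 := by simp [fderiv_L₂ hx, e3, h1, h3]
  convert isEigen_zK hx e3 (l := 0) (m := 0) ?_ ?_ using 1
  · ring
  · refine isEigen_iff.2 ⟨?_, ?_⟩
    · simp [fderiv_zX₂_re hx, e3, h2]
    · simp [fderiv_zX₂_im, h2, h4]
  · refine isEigen_iff.2 ⟨?_, ?_⟩
    · simp [fderiv_zY₂_re hx, e3, e2, h1]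
    · simp [fderiv_zY₂_im hx, h1, h3]

/-- The derivative of `K` in the direction of `θ₁` or its momentum. -/
theorem derivative_zK_polar {w : PhaseSpace 3} (h2 : w.1 2 = 0) (h4 : w.2 2 = 0) :
    derivative x w S.zK = (S.p₂ * S.q₁ : ℕ) *
      value x (S.zX₂ ^ (S.p₁ * S.q₂) * S.zY₂ ^ (S.p₂ * S.q₁ - 1)) * derivative x w S.zY₂ := by
  have e3 : fderiv ℝ S.L₃ x w = 0 := by simp [fderiv_L₃ hx, h2, h4]
  have h0 : derivative x w S.zX₂ = 0 := by
    ext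
    · simp [derivative, fderiv_zX₂_re hx, e3, h2]
    · simp [derivative, fderiv_zX₂_im, h2, h4]
  rw [zK, derivative_mul hx analytic_L₃ e3 (isAnalytic_zX₂.pow analytic_L₃ _)
    (isAnalytic_zY₂.pow analytic_L₃ _), derivative_pow hx analytic_L₃ e3 isAnalytic_zX₂,
    derivative_pow hx analytic_L₃ e3 isAnalytic_zY₂, h0]
  simp only [map_mul, map_pow]
  ring

/-- The brackets of `J` with a function that commutes with `L₂` and does not depend on `r` and its
momentum. -/
theorem poisson_zJ {g : PhaseSpace 3 → ℝ} (hg : poisson S.L₂ g x = 0)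
    (hr : fderiv ℝ g x (Pi.single 0 1, 0) = 0) (hpr : fderiv ℝ g x (0, Pi.single 0 1) = 0) :
    (⟨poisson S.zJ.re g x, poisson S.zJ.im g x⟩ : QuadraticAlgebra ℝ (-S.L₂ x) 0) =
      S.q₁ * value x (S.zX₁ ^ (S.q₁ - 1) * S.zY₁ ^ (2 * S.p₁)) *
        ⟨4 * S.k₁ * S.L₂ x * Real.sin (S.k₁ * x.1 1) * Real.cos (S.k₁ * x.1 1) *
            fderiv ℝ g x (0, Pi.single 1 1) - poisson S.L₃ g x,
          2 * S.k₁ * (Real.cos (S.k₁ * x.1 1) ^ 2 - Real.sin (S.k₁ * x.1 1) ^ 2) * x.2 1 *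
            fderiv ℝ g x (0, Pi.single 1 1) -
          2 * Real.sin (S.k₁ * x.1 1) * Real.cos (S.k₁ * x.1 1) *
            fderiv ℝ g x (Pi.single 1 1, 0)⟩ := by
  have e2 : fderiv ℝ S.L₂ x (hamiltonianVector g x) = 0 := by
    rw [← poisson_eq_fderiv, poisson_antisymm, hg, neg_zero]
  have e3 : fderiv ℝ S.L₃ x (hamiltonianVector g x) = -poisson S.L₃ g x := by
    rw [← poisson_eq_fderiv, poisson_antisymm]
  -- The field of `g` fixes `L₂`, `r` and the radial momentum, and `zY₁` is a function of these
  -- three; hence only `zX₁` is differentiated.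
  have h0 : derivative x (hamiltonianVector g x) S.zY₁ = 0 := by
    ext
    · simp only [derivative, fderiv_zY₁_re hx, e2]
      simp [hamiltonianVector, hpr]
    · simp only [derivative, fderiv_zY₁_im hx]
      simp [hamiltonianVector, hr]
  have h1 : (⟨poisson S.zJ.re g x, poisson S.zJ.im g x⟩ : QuadraticAlgebra ℝ (-S.L₂ x) 0) =
      -derivative x (hamiltonianVector g x) S.zJ := by
    ext <;> simp [derivative, poisson_eq_neg_fderiv]
  have h2 : derivative x (hamiltonianVector g x) S.zJ = S.q₁ *
      value x (S.zX₁ ^ (S.q₁ - 1) * S.zY₁ ^ (2 * S.p₁)) *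
        derivative x (hamiltonianVector g x) S.zX₁ := by
    rw [zJ, derivative_mul hx analytic_L₂ e2 (isAnalytic_zX₁.pow analytic_L₂ _)
      (isAnalytic_zY₁.pow analytic_L₂ _), derivative_pow hx analytic_L₂ e2 isAnalytic_zX₁,
      derivative_pow hx analytic_L₂ e2 isAnalytic_zY₁, h0]
    simp only [map_mul, map_pow]
    ring
  rw [h1, h2, ← mul_neg]
  congr 1
  ext
  · simp only [derivative, fderiv_zX₁_re hx, e2, e3, QuadraticAlgebra.re_neg]
    simp only [hamiltonianVector]
    ring
  · simp only [derivative, fderiv_zX₁_im, QuadraticAlgebra.im_neg]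
    simp only [hamiltonianVector]
    ring

/-- These are the components, with respect to `1`, `v`, `u`, `u v`, of a single formula for the
bracket of `zJ` and `zK`. The bracket lowers the exponents of `zX₁` and `zY₂` by one; multiplication
by their common norm `Q` restores both factors, so the right side is expressed through `zJ` and `zK`
again. -/
theorem poisson_zJ_zK (hq₁ : S.q₁ ≠ 0) (hp₂ : S.p₂ ≠ 0) (hq₂ : S.q₂ ≠ 0) :
    S.val S.Q x * poisson S.zJ.re S.zK.re x = 4 * S.q₁ * S.p₁ * S.p₂ *
        (S.L₂ x * (S.L₂ x - S.L₃ x - S.δ) * S.zJ.im x * S.zK.re x -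
          S.L₃ x * (S.L₂ x - S.L₃ x + S.δ) * S.zJ.re x * S.zK.im x) ∧
    S.val S.Q x * poisson S.zJ.re S.zK.im x = 4 * S.q₁ * S.p₁ * S.p₂ *
        (S.L₂ x * (S.L₂ x - S.L₃ x - S.δ) * S.zJ.im x * S.zK.im x +
          (S.L₂ x - S.L₃ x + S.δ) * S.zJ.re x * S.zK.re x) ∧
    S.val S.Q x * poisson S.zJ.im S.zK.re x = 4 * S.q₁ * S.p₁ * S.p₂ *
        (-(S.L₂ x - S.L₃ x - S.δ) * S.zJ.re x * S.zK.re x -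
          S.L₃ x * (S.L₂ x - S.L₃ x + S.δ) * S.zJ.im x * S.zK.im x) ∧
    S.val S.Q x * poisson S.zJ.im S.zK.im x = 4 * S.q₁ * S.p₁ * S.p₂ *
        (-(S.L₂ x - S.L₃ x - S.δ) * S.zJ.re x * S.zK.im x +
          (S.L₂ x - S.L₃ x + S.δ) * S.zJ.im x * S.zK.re x) := by
  have hs := sin₁_ne hx
  have hc := cos₁_ne hx
  have hL₂ := isEigen_iff.1 (isEigen_L₂_zK hx hq₁ hq₂)
  have hL₃ := isEigen_iff.1 (isEigen_L₃_zK hx hq₂)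
  simp only [← poisson_eq_fderiv, zero_mul, mul_zero, neg_zero] at hL₂ hL₃
  have hr := isEigen_iff.1 (isEigen_zK_radial hx (w := (Pi.single 0 1, 0)) (by simp) (by simp)
    (by simp) (by simp))
  have hpr := isEigen_iff.1 (isEigen_zK_radial hx (w := (0, Pi.single 0 1)) (by simp) (by simp)
    (by simp) (by simp))
  simp only [zero_mul, mul_zero, neg_zero] at hr hpr
  have hJ := poisson_zJ hx hL₂.1 hr.1 hpr.1
  have hJ' := poisson_zJ hx hL₂.2 hr.2 hpr.2
  have hp := derivative_zK_polar hx (w := (0, Pi.single 1 1)) (by simp) (by simp)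
  have hθ := derivative_zK_polar hx (w := (Pi.single 1 1, 0)) (by simp) (by simp)
  have hzJ : value x S.zJ =
      value x (S.zX₁ ^ (S.q₁ - 1) * S.zY₁ ^ (2 * S.p₁)) * value x S.zX₁ := by
    rw [zJ, ← map_mul]
    congr 1
    rw [mul_right_comm, ← pow_succ, Nat.sub_add_cancel (Nat.pos_of_ne_zero hq₁)]
  have hzK : value x S.zK = value x (S.zX₂ ^ (S.p₁ * S.q₂) * S.zY₂ ^ (S.p₂ * S.q₁ - 1)) *
      value x S.zY₂ := by
    rw [zK, ← map_mul]
    congr 1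
    rw [mul_assoc, ← pow_succ, Nat.sub_add_cancel (Nat.mul_pos (Nat.pos_of_ne_zero hp₂)
      (Nat.pos_of_ne_zero hq₁))]
  -- Both sides are bilinear in the cofactors `U` of `zX₁` in `zJ` and `N` of `zY₂` in `zK`, so
  -- nothing about these needs to be known.
  generalize value x (S.zX₁ ^ (S.q₁ - 1) * S.zY₁ ^ (2 * S.p₁)) = U at *
  generalize value x (S.zX₂ ^ (S.p₁ * S.q₂) * S.zY₂ ^ (S.p₂ * S.q₁ - 1)) = N at *
  have i1 := bracket_identity_one hs hc (Real.sin_sq_add_cos_sq _) (rfl : S.L₂ x = _)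
  have i2 := bracket_identity_v hs hc (Real.sin_sq_add_cos_sq _) (rfl : S.L₂ x = _)
  have i3 := bracket_identity_u hs hc (Real.sin_sq_add_cos_sq _) (rfl : S.L₂ x = _)
  have i4 := bracket_identity_u_v hs hc (Real.sin_sq_add_cos_sq _) (rfl : S.L₂ x = _)
  have hk : (S.k₁ : ℝ) * S.q₁ = S.p₁ := by
    rw [k₁]
    exact div_mul_cancel₀ _ (by exact_mod_cast hq₁)
  have hM : ((S.p₂ * S.q₁ : ℕ) : QuadraticAlgebra ℝ (-S.L₃ x) 0) = ⟨S.p₂ * S.q₁, 0⟩ := by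
    ext <;> simp
  have hq : (S.q₁ : QuadraticAlgebra ℝ (-S.L₂ x) 0) = ⟨S.q₁, 0⟩ := by
    ext <;> simp
  rw [hM] at hp hθ
  rw [hq] at hJ hJ'
  simp only [QuadraticAlgebra.ext_iff, QuadraticAlgebra.re_mul, QuadraticAlgebra.im_mul,
    derivative, fderiv_zY₂_re hx, fderiv_zY₂_im hx, fderiv_L₂ hx, fderiv_L₃ hx, value_re,
    value_im] at hJ hJ' hp hθ hzJ hzK
  simp only [zX₁, zY₂, Pi.single_eq_same, Pi.zero_apply, ne_eq, Fin.isValue, Fin.reduceEq,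
    not_false_eq_true, Pi.single_eq_of_ne, mul_zero, zero_mul, add_zero, zero_div, sub_zero,
    mul_one, zero_add] at hp hθ hzJ hzK
  rw [hJ.1, hJ.2, hJ'.1, hJ'.2, hp.1, hp.2, hθ.1, hθ.2, hL₃.1, hL₃.2, hzJ.1, hzJ.2, hzK.1, hzK.2,
    val_Q, ← hk]
  -- The coefficients below are those of `U N (i1 + v i2 + u i3 + u v i4)`, multiplied out with `u²
  -- = -L₂` and `v² = -L₃`.
  refine ⟨?_, ?_, ?_, ?_⟩
  · linear_combination S.q₁ * (S.k₁ * S.q₁) * S.p₂ * (U.re * N.re * i1 -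
      S.L₃ x * U.re * N.im * i2 - S.L₂ x * U.im * N.re * i3 +
      S.L₂ x * S.L₃ x * U.im * N.im * i4)
  · linear_combination S.q₁ * (S.k₁ * S.q₁) * S.p₂ * (U.re * N.im * i1 +
      U.re * N.re * i2 - S.L₂ x * U.im * N.im * i3 - S.L₂ x * U.im * N.re * i4)
  · linear_combination S.q₁ * (S.k₁ * S.q₁) * S.p₂ * (U.im * N.re * i1 -
      S.L₃ x * U.im * N.im * i2 + U.re * N.re * i3 - S.L₃ x * U.re * N.im * i4)
  · linear_combination S.q₁ * (S.k₁ * S.q₁) * S.p₂ * (U.im * N.im * i1 +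
      U.im * N.re * i2 + U.re * N.im * i3 + U.re * N.re * i4)

end Bracket

end KeplerCoulomb

/-- Coefficients analytic in the position alone, with a uniform degree bound, give joint analyticity
in positions and momenta. -/
theorem MomentumOrderLE.analyticOnNhd {n : ℕ} {D : Set (Fin n → ℝ)} {f : PhaseSpace n → ℝ} {d : ℕ}
    (hD : IsOpen D) (h : MomentumOrderLE D f d) : AnalyticOnNhd ℝ f {x | x.1 ∈ D} := by
  obtain ⟨P, h1, h2, h3⟩ := h
  -- The support of `P q` varies with `q`; the set of all multi-indices of degree at most `d` does
  -- not.
  let T : Finset (Fin n →₀ ℕ) := (Finset.range (d + 1)).biUnion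
    fun k => Finset.univ.finsuppAntidiag k
  have hsum : ∀ x ∈ {x : PhaseSpace n | x.1 ∈ D},
      f x = ∑ m ∈ T, (P x.1).coeff m * ∏ i, x.2 i ^ m i := by
    rintro ⟨q, p⟩ hq
    rw [h3 q hq, MvPolynomial.eval_eq']
    refine Finset.sum_subset (fun m hm => ?_) fun m _ hm => ?_
    · have := (MvPolynomial.le_totalDegree hm).trans (h2 q hq)
      simp only [T, Finset.mem_biUnion, Finset.mem_range, Finset.mem_finsuppAntidiag]
      refine ⟨m.degree, by rw [Finsupp.degree_apply]; exact Nat.lt_succ_of_le this, ?_, by simp⟩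
      rw [Finsupp.degree_eq_sum]
    · rw [MvPolynomial.notMem_support_iff.1 hm, zero_mul]
  have hopen : IsOpen {x : PhaseSpace n | x.1 ∈ D} := hD.preimage continuous_fst
  have hana : AnalyticOnNhd ℝ (fun x : PhaseSpace n =>
      ∑ m ∈ T, (P x.1).coeff m * ∏ i, x.2 i ^ m i) {x | x.1 ∈ D} := by
    intro x hx
    refine Finset.analyticAt_fun_sum _ fun m _ => AnalyticAt.fun_mul ?_ ?_
    · exact AnalyticAt.fun_comp (g := fun q => (P q).coeff m) (h1 m _ hx) analyticAt_fst
    · refine Finset.analyticAt_fun_prod _ fun i _ => AnalyticAt.fun_pow ?_ _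
      exact ((ContinuousLinearMap.proj (R := ℝ) (φ := fun _ : Fin n => ℝ) i).comp
        (ContinuousLinearMap.snd ℝ _ _)).analyticAt x
  exact fun x hx => (hana x hx).congr (Filter.mem_of_superset (hopen.mem_nhds hx)
    fun y hy => (hsum y hy).symm)

/-! ### The real functions `J₁`, `J₂`, `K₁`, `K₂`. -/

namespace KeplerCoulomb

open QuadraticFunctions

variable (S : KeplerCoulomb)

noncomputable def J₁ (x : PhaseSpace 3) : ℝ := -2 * (-1) ^ ((S.q₁ - 1) / 2) * S.zJ.im x

noncomputable def J₂ (x : PhaseSpace 3) : ℝ := 2 * (-1) ^ ((S.q₁ - 1) / 2) * S.zJ.re x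

noncomputable def K₁ (x : PhaseSpace 3) : ℝ := 2 * (-1) ^ ((S.p₁ * S.q₂ + 1) / 2) * S.zK.im x

noncomputable def K₂ (x : PhaseSpace 3) : ℝ := 2 * (-1) ^ ((S.p₁ * S.q₂ + 1) / 2) * S.zK.re x

/-- All the integers that define `k₁` and `k₂` are odd. -/
structure HasOddParameters : Prop where
  p₁ : Odd S.p₁
  q₁ : Odd S.q₁
  p₂ : Odd S.p₂
  q₂ : Odd S.q₂

variable {S}

theorem analytic_J₁ : AnalyticOnNhd ℝ S.J₁ S.phase := fun x hx =>
  analyticAt_const.fun_mul (isAnalytic_zJ.2 x hx)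
theorem analytic_J₂ : AnalyticOnNhd ℝ S.J₂ S.phase := fun x hx =>
  analyticAt_const.fun_mul (isAnalytic_zJ.1 x hx)
theorem analytic_K₁ : AnalyticOnNhd ℝ S.K₁ S.phase := fun x hx =>
  analyticAt_const.fun_mul (isAnalytic_zK.2 x hx)
theorem analytic_K₂ : AnalyticOnNhd ℝ S.K₂ S.phase := fun x hx =>
  analyticAt_const.fun_mul (isAnalytic_zK.1 x hx)

/-! ### The squares of `J₂` and `K₂` -/

section Squares

variable {x : PhaseSpace 3} (hx : x ∈ S.phase)
include hx

/-- The same value as for `zY₂`, although the two elements lie in different extensions. This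
coincidence is what makes `Q` the denominator of the mixed brackets. -/
theorem norm_zX₁ : (value x S.zX₁).norm = S.val S.Q x := by
  have hs := sin₁_ne hx
  have hc := cos₁_ne hx
  have h := Real.sin_sq_add_cos_sq (S.k₁ * x.1 1)
  have hL : S.L₂ x = x.2 1 ^ 2 + S.L₃ x / Real.sin (S.k₁ * x.1 1) ^ 2 +
    S.δ / Real.cos (S.k₁ * x.1 1) ^ 2 := rfl
  rw [val_Q, QuadraticAlgebra.norm_def]
  simp only [value_re, value_im, zX₁, hL]
  field_simp
  grind

theorem norm_zY₂ : (value x S.zY₂).norm = S.val S.Q x := by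
  have hs := sin₁_ne hx
  have hc := cos₁_ne hx
  have h := Real.sin_sq_add_cos_sq (S.k₁ * x.1 1)
  have hL : S.L₂ x = x.2 1 ^ 2 + S.L₃ x / Real.sin (S.k₁ * x.1 1) ^ 2 +
    S.δ / Real.cos (S.k₁ * x.1 1) ^ 2 := rfl
  rw [val_Q, QuadraticAlgebra.norm_def]
  simp only [value_re, value_im, zY₂, hL]
  field_simp
  grind

theorem norm_zX₂ : (value x S.zX₂).norm = (S.β - S.γ - S.L₃ x) ^ 2 - 4 * S.γ * S.L₃ x := by
  have hs := sin₂_ne hx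
  have hc := cos₂_ne hx
  have h := Real.sin_sq_add_cos_sq (S.k₂ * x.1 2)
  have hL : S.L₃ x = x.2 2 ^ 2 + S.β / Real.cos (S.k₂ * x.1 2) ^ 2 +
    S.γ / Real.sin (S.k₂ * x.1 2) ^ 2 := rfl
  rw [QuadraticAlgebra.norm_def]
  simp only [value_re, value_im, zX₂, hL]
  field_simp
  grind

theorem norm_zY₁ : (value x S.zY₁).norm = S.α ^ 2 + 4 * S.H x * S.L₂ x := by
  have hr := r_ne hx
  have hH : S.H x = x.2 0 ^ 2 + S.α / x.1 0 + S.L₂ x / x.1 0 ^ 2 := rfl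
  rw [QuadraticAlgebra.norm_def]
  simp only [value_re, value_im, zY₁, hH]
  field_simp
  ring

theorem norm_zJ : (value x S.zJ).norm = S.val S.P₁ x := by
  rw [zJ, map_mul, map_pow, map_pow, map_mul, map_pow, map_pow, norm_zX₁ hx, norm_zY₁ hx, val_Q]
  simp only [val, P₁, map_mul, map_add, map_sub, map_pow, MvPolynomial.eval_X,
    MvPolynomial.eval_C, map_ofNat, Matrix.cons_val]
  congr 2
  ring

theorem norm_zK : (value x S.zK).norm = S.val S.P₂ x := by
  rw [zK, map_mul, map_pow, map_pow, map_mul, map_pow, map_pow, norm_zX₂ hx, norm_zY₂ hx, val_Q]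
  simp only [val, P₂, map_mul, map_add, map_sub, map_pow, MvPolynomial.eval_X,
    MvPolynomial.eval_C, map_ofNat, Matrix.cons_val]
  congr 2
  ring

theorem J₂_sq : S.J₂ x ^ 2 = -S.L₂ x * S.J₁ x ^ 2 + 4 * S.val S.P₁ x := by
  rw [← norm_zJ hx, QuadraticAlgebra.norm_def, J₁, J₂]
  simp only [value_re, value_im]
  linear_combination (4 * (S.zJ.re x ^ 2 + S.L₂ x * S.zJ.im x ^ 2)) *
    (Even.neg_one_pow (even_two_mul _) : (-1 : ℝ) ^ (2 * ((S.q₁ - 1) / 2)) = 1)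

theorem K₂_sq : S.K₂ x ^ 2 = -S.L₃ x * S.K₁ x ^ 2 + 4 * S.val S.P₂ x := by
  rw [← norm_zK hx, QuadraticAlgebra.norm_def, K₁, K₂]
  simp only [value_re, value_im]
  linear_combination (4 * (S.zK.re x ^ 2 + S.L₃ x * S.zK.im x ^ 2)) *
    (Even.neg_one_pow (even_two_mul _) : (-1 : ℝ) ^ (2 * ((S.p₁ * S.q₂ + 1) / 2)) = 1)

end Squares

/-! ### Brackets -/

section Brackets

variable (hS : S.HasOddParameters) {x : PhaseSpace 3} (hx : x ∈ S.phase)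

theorem poisson_J₁_right (hx : x ∈ S.phase) (f : PhaseSpace 3 → ℝ) : poisson f S.J₁ x =
    -2 * (-1) ^ ((S.q₁ - 1) / 2) * poisson f S.zJ.im x :=
  poisson_const_mul_right f _ (isAnalytic_zJ.2 x hx).differentiableAt
theorem poisson_J₂_right (hx : x ∈ S.phase) (f : PhaseSpace 3 → ℝ) : poisson f S.J₂ x =
    2 * (-1) ^ ((S.q₁ - 1) / 2) * poisson f S.zJ.re x :=
  poisson_const_mul_right f _ (isAnalytic_zJ.1 x hx).differentiableAt
theorem poisson_K₁_right (hx : x ∈ S.phase) (f : PhaseSpace 3 → ℝ) : poisson f S.K₁ x =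
    2 * (-1) ^ ((S.p₁ * S.q₂ + 1) / 2) * poisson f S.zK.im x :=
  poisson_const_mul_right f _ (isAnalytic_zK.2 x hx).differentiableAt
theorem poisson_K₂_right (hx : x ∈ S.phase) (f : PhaseSpace 3 → ℝ) : poisson f S.K₂ x =
    2 * (-1) ^ ((S.p₁ * S.q₂ + 1) / 2) * poisson f S.zK.re x :=
  poisson_const_mul_right f _ (isAnalytic_zK.1 x hx).differentiableAt

include hx

theorem poisson_L₃_J₁ : poisson S.L₃ S.J₁ x = 0 := by
  simp [poisson_J₁_right hx, poisson_eq_fderiv, (isEigen_iff.1 (isEigen_L₃_zJ hx)).2]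
theorem poisson_L₃_J₂ : poisson S.L₃ S.J₂ x = 0 := by
  simp [poisson_J₂_right hx, poisson_eq_fderiv, (isEigen_iff.1 (isEigen_L₃_zJ hx)).1]

include hS

theorem poisson_L₂_J₁ : poisson S.L₂ S.J₁ x = -4 * S.p₁ * S.J₂ x := by
  rw [poisson_J₁_right hx, poisson_eq_fderiv, (isEigen_iff.1 (isEigen_L₂_zJ hx hS.q₁.pos.ne')).2, J₂]
  ring
theorem poisson_L₂_J₂ : poisson S.L₂ S.J₂ x = 4 * S.p₁ * S.L₂ x * S.J₁ x := by
  rw [poisson_J₂_right hx, poisson_eq_fderiv, (isEigen_iff.1 (isEigen_L₂_zJ hx hS.q₁.pos.ne')).1, J₁]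
  ring
theorem poisson_H_J₁ : poisson S.H S.J₁ x = 0 := by
  simp [poisson_J₁_right hx, poisson_eq_fderiv,
    (isEigen_iff.1 (isEigen_H_zJ hx hS.q₁.pos.ne')).2]
theorem poisson_H_J₂ : poisson S.H S.J₂ x = 0 := by
  simp [poisson_J₂_right hx, poisson_eq_fderiv,
    (isEigen_iff.1 (isEigen_H_zJ hx hS.q₁.pos.ne')).1]
theorem poisson_L₃_K₁ : poisson S.L₃ S.K₁ x = -4 * S.p₁ * S.p₂ * S.K₂ x := by
  rw [poisson_K₁_right hx, poisson_eq_fderiv, (isEigen_iff.1 (isEigen_L₃_zK hx hS.q₂.pos.ne')).2, K₂]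
  ring
theorem poisson_L₃_K₂ : poisson S.L₃ S.K₂ x = 4 * S.p₁ * S.p₂ * S.L₃ x * S.K₁ x := by
  rw [poisson_K₂_right hx, poisson_eq_fderiv, (isEigen_iff.1 (isEigen_L₃_zK hx hS.q₂.pos.ne')).1, K₁]
  ring
theorem poisson_L₂_K₁ : poisson S.L₂ S.K₁ x = 0 := by
  simp [poisson_K₁_right hx, poisson_eq_fderiv,
    (isEigen_iff.1 (isEigen_L₂_zK hx hS.q₁.pos.ne' hS.q₂.pos.ne')).2]
theorem poisson_L₂_K₂ : poisson S.L₂ S.K₂ x = 0 := by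
  simp [poisson_K₂_right hx, poisson_eq_fderiv,
    (isEigen_iff.1 (isEigen_L₂_zK hx hS.q₁.pos.ne' hS.q₂.pos.ne')).1]
theorem poisson_H_K₁ : poisson S.H S.K₁ x = 0 := by
  simp [poisson_K₁_right hx, poisson_eq_fderiv,
    (isEigen_iff.1 (isEigen_H_zK hx hS.q₁.pos.ne' hS.q₂.pos.ne')).2]
theorem poisson_H_K₂ : poisson S.H S.K₂ x = 0 := by
  simp [poisson_K₂_right hx, poisson_eq_fderiv,
    (isEigen_iff.1 (isEigen_H_zK hx hS.q₁.pos.ne' hS.q₂.pos.ne')).1]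

theorem poisson_J_K (j k : Fin 2) :
    S.val S.Q x * poisson (![S.J₁, S.J₂] j) (![S.K₁, S.K₂] k) x =
      4 * S.q₁ * S.p₁ * S.p₂ *
        (![S.J₁, S.J₂] j.rev x * ![S.K₁, S.K₂] k x * (-S.L₂ x) ^ (j : ℕ) *
            (S.L₂ x - S.L₃ x - S.δ) +
          ![S.J₁, S.J₂] j x * ![S.K₁, S.K₂] k.rev x * (-S.L₃ x) ^ (k : ℕ) *
            (S.L₂ x - S.L₃ x + S.δ)) := by
  obtain ⟨h1, h2, h3, h4⟩ := poisson_zJ_zK hx hS.q₁.pos.ne' hS.p₂.pos.ne' hS.q₂.pos.ne'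
  have hleft : ∀ g, poisson S.J₁ g x = -2 * (-1) ^ ((S.q₁ - 1) / 2) * poisson S.zJ.im g x ∧
      poisson S.J₂ g x = 2 * (-1) ^ ((S.q₁ - 1) / 2) * poisson S.zJ.re g x := fun g =>
    ⟨poisson_const_mul_left _ g (isAnalytic_zJ.2 x hx).differentiableAt,
      poisson_const_mul_left _ g (isAnalytic_zJ.1 x hx).differentiableAt⟩
  generalize hσ : ((-1 : ℝ) ^ ((S.q₁ - 1) / 2)) = σ at hleft
  generalize hτ : ((-1 : ℝ) ^ ((S.p₁ * S.q₂ + 1) / 2)) = τ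
  have hJ₁ : S.J₁ x = -2 * σ * S.zJ.im x := by rw [J₁, hσ]
  have hJ₂ : S.J₂ x = 2 * σ * S.zJ.re x := by rw [J₂, hσ]
  have hK₁ : S.K₁ x = 2 * τ * S.zK.im x := by rw [K₁, hτ]
  have hK₂ : S.K₂ x = 2 * τ * S.zK.re x := by rw [K₂, hτ]
  fin_cases j <;> fin_cases k
  · simp [(hleft _).1, poisson_K₁_right hx, hτ, hJ₁, hJ₂, hK₁, hK₂, Fin.rev]
    linear_combination (-4 * σ * τ) * h4
  · simp [(hleft _).1, poisson_K₂_right hx, hτ, hJ₁, hJ₂, hK₁, hK₂, Fin.rev]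
    linear_combination (-4 * σ * τ) * h3
  · simp [(hleft _).2, poisson_K₁_right hx, hτ, hJ₁, hJ₂, hK₁, hK₂, Fin.rev]
    linear_combination (4 * σ * τ) * h2
  · simp [(hleft _).2, poisson_K₂_right hx, hτ, hJ₁, hJ₂, hK₁, hK₂, Fin.rev]
    linear_combination (4 * σ * τ) * h1

end Brackets

/-! ### Raising and lowering functions -/

section Ladder

variable (x : PhaseSpace 3) (s t : ℂ)

theorem sin_two_mul_mul (k θ : ℝ) :
    Real.sin (2 * k * θ) = 2 * Real.sin (k * θ) * Real.cos (k * θ) := by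
  rw [mul_assoc, Real.sin_two_mul]

theorem cos_two_mul_mul (k θ : ℝ) :
    Real.cos (2 * k * θ) = Real.cos (k * θ) ^ 2 - Real.sin (k * θ) ^ 2 := by
  rw [mul_assoc, Real.cos_two_mul']

variable {x s t}

/-- Keeping `i` an arbitrary root of `-1` lets one computation serve both the raising function (`i =
I`) and the lowering one (`i = -I`). -/
theorem X₁_eq {i : ℂ} (hi : i ^ 2 = -1) (hu : (-(i * s)) ^ 2 = -(S.L₂ x : ℂ)) :
    S.X₁ i s x = i * complexValue x (-(i * s)) hu S.zX₁ := by
  simp only [X₁, complexValue_apply, zX₁, sin_two_mul_mul, cos_two_mul_mul]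
  push_cast
  linear_combination (s * (2 * Complex.sin (S.k₁ * x.1 1) * Complex.cos (S.k₁ * x.1 1) *
    x.2 1)) * hi

theorem Y₁_eq {i : ℂ} (hi : i ^ 2 = -1) (hu : (-(i * s)) ^ 2 = -(S.L₂ x : ℂ)) :
    S.Y₁ (-i) s x = i * complexValue x (-(i * s)) hu S.zY₁ := by
  simp only [Y₁, complexValue_apply, zY₁]
  push_cast
  linear_combination (s * (2 * x.2 0)) * hi

theorem X₂_eq {i : ℂ} (hi : i ^ 2 = -1) (hu : (i * t) ^ 2 = -(S.L₃ x : ℂ)) :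
    S.X₂ i t x = i * complexValue x (i * t) hu S.zX₂ := by
  simp only [X₂, complexValue_apply, zX₂, sin_two_mul_mul, cos_two_mul_mul]
  push_cast
  linear_combination (-t * (2 * Complex.sin (S.k₂ * x.1 2) * Complex.cos (S.k₂ * x.1 2) *
    x.2 2)) * hi

theorem Y₂_eq {i : ℂ} (hu : (i * t) ^ 2 = -(S.L₃ x : ℂ)) :
    S.Y₂ (-i) t x = complexValue x (i * t) hu S.zY₂ := by
  simp only [Y₂, complexValue_apply, zY₂, Real.cot_eq_cos_div_sin]
  push_cast
  ring

theorem X₁_pow_mul_Y₁_pow {i : ℂ} (hi : i ^ 2 = -1) (hs : s ^ 2 = (S.L₂ x : ℂ)) :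
    S.X₁ i s x ^ S.q₁ * S.Y₁ (-i) s x ^ (2 * S.p₁) =
      i ^ (S.q₁ + 2 * S.p₁) * (S.zJ.re x - i * s * S.zJ.im x) := by
  have hu : (-(i * s)) ^ 2 = -(S.L₂ x : ℂ) := by rw [neg_sq, mul_pow, hi, hs, neg_one_mul]
  have h := complexValue_apply x _ hu S.zJ
  rw [X₁_eq hi hu, Y₁_eq hi hu, mul_pow, mul_pow, mul_mul_mul_comm, ← map_pow, ← map_pow,
    ← map_mul, ← pow_add, ← zJ, h]
  ring

theorem X₂_pow_mul_Y₂_pow {i : ℂ} (hi : i ^ 2 = -1) (ht : t ^ 2 = (S.L₃ x : ℂ)) :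
    S.X₂ i t x ^ (S.p₁ * S.q₂) * S.Y₂ (-i) t x ^ (S.p₂ * S.q₁) =
      i ^ (S.p₁ * S.q₂) * (S.zK.re x + i * t * S.zK.im x) := by
  have hu : (i * t) ^ 2 = -(S.L₃ x : ℂ) := by rw [mul_pow, hi, ht, neg_one_mul]
  have h := complexValue_apply x _ hu S.zK
  rw [X₂_eq hi hu, Y₂_eq hu, mul_pow, mul_assoc, ← map_pow, ← map_pow, ← map_mul, ← zK, h]

theorem pow_eq_of_sq_eq_neg_one {i : ℂ} (hi : i ^ 2 = -1) {m : ℕ} (hm : Odd m) :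
    i ^ m = (-1) ^ ((m - 1) / 2) * i := by
  obtain ⟨h, rfl⟩ := hm
  rw [pow_succ, pow_mul, hi]
  congr 2
  omega

variable (hS : S.HasOddParameters)
include hS

/-- For odd `p₁` the factor `I ^ (2 p₁)` is `-1`, and for odd `q₁` exactly one factor `I` survives.
Hence the difference of lowering and raising function isolates the real component and their sum the
imaginary one. -/
theorem Jplus_eq (hs : s ^ 2 = (S.L₂ x : ℂ)) : S.Jplus s x =
    -(-1) ^ ((S.q₁ - 1) / 2) * Complex.I * (S.zJ.re x - Complex.I * s * S.zJ.im x) := by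
  rw [Jplus, X₁_pow_mul_Y₁_pow Complex.I_sq hs, pow_add, pow_mul, Complex.I_sq, hS.p₁.neg_one_pow,
    pow_eq_of_sq_eq_neg_one Complex.I_sq hS.q₁]
  ring

theorem Jminus_eq (hs : s ^ 2 = (S.L₂ x : ℂ)) : S.Jminus s x =
    (-1) ^ ((S.q₁ - 1) / 2) * Complex.I * (S.zJ.re x + Complex.I * s * S.zJ.im x) := by
  have hi : (-Complex.I) ^ 2 = -1 := by rw [neg_sq, Complex.I_sq]
  have h := X₁_pow_mul_Y₁_pow hi hs
  rw [neg_neg] at h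
  rw [Jminus, h, pow_add, pow_mul, hi, hS.p₁.neg_one_pow, pow_eq_of_sq_eq_neg_one hi hS.q₁]
  ring

/-- An odd power of `I` produces the exponent `(p₁ q₂ - 1) / 2`, while `D₂` is normalised with `(p₁
q₂ + 1) / 2`. -/
theorem neg_one_pow_half : (-1 : ℂ) ^ ((S.p₁ * S.q₂ - 1) / 2) =
    -(-1) ^ ((S.p₁ * S.q₂ + 1) / 2) := by
  obtain ⟨h, hh⟩ := hS.p₁.mul hS.q₂
  rw [hh, show (2 * h + 1 - 1) / 2 = h by omega, show (2 * h + 1 + 1) / 2 = h + 1 by omega, pow_succ]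
  ring

theorem Kplus_eq (ht : t ^ 2 = (S.L₃ x : ℂ)) : S.Kplus t x =
    -(-1) ^ ((S.p₁ * S.q₂ + 1) / 2) * Complex.I * (S.zK.re x + Complex.I * t * S.zK.im x) := by
  rw [Kplus, X₂_pow_mul_Y₂_pow Complex.I_sq ht,
    pow_eq_of_sq_eq_neg_one Complex.I_sq (hS.p₁.mul hS.q₂), neg_one_pow_half hS]

theorem Kminus_eq (ht : t ^ 2 = (S.L₃ x : ℂ)) : S.Kminus t x =
    (-1) ^ ((S.p₁ * S.q₂ + 1) / 2) * Complex.I * (S.zK.re x - Complex.I * t * S.zK.im x) := by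
  have hi : (-Complex.I) ^ 2 = -1 := by rw [neg_sq, Complex.I_sq]
  have h := X₂_pow_mul_Y₂_pow hi ht
  rw [neg_neg] at h
  rw [Kminus, h, pow_eq_of_sq_eq_neg_one hi (hS.p₁.mul hS.q₂), neg_one_pow_half hS]
  ring

theorem ladder_relations (hx : x ∈ S.phase) (hs : s ^ 2 = (S.L₂ x : ℂ))
    (ht : t ^ 2 = (S.L₃ x : ℂ)) :
    s * S.J₁ x = S.Jminus s x + S.Jplus s x ∧
      Complex.I * S.J₂ x = S.Jminus s x - S.Jplus s x ∧
      t * S.K₁ x = S.Kminus t x + S.Kplus t x ∧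
      Complex.I * S.K₂ x = S.Kminus t x - S.Kplus t x ∧
      S.Jplus s x * S.Jminus s x = (S.val S.P₁ x : ℂ) ∧
      S.Kplus t x * S.Kminus t x = (S.val S.P₂ x : ℂ) := by
  have hsign : ∀ m : ℕ, ((-1 : ℂ) ^ m) ^ 2 = 1 := fun m => by
    rw [← pow_mul, mul_comm, pow_mul, neg_one_sq, one_pow]
  rw [Jplus_eq hS hs, Jminus_eq hS hs, Kplus_eq hS ht, Kminus_eq hS ht, ← norm_zJ hx,
    ← norm_zK hx, QuadraticAlgebra.norm_def, QuadraticAlgebra.norm_def]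
  simp only [J₁, J₂, K₁, K₂, value_re, value_im]
  push_cast
  have h1 := hsign ((S.q₁ - 1) / 2)
  have h2 := hsign ((S.p₁ * S.q₂ + 1) / 2)
  have hI := Complex.I_sq
  -- Of the signs only `σ² = τ² = 1` matters, and of the imaginary unit only `i² = -1`; the six
  -- claims become polynomial identities.
  generalize (-1 : ℂ) ^ ((S.q₁ - 1) / 2) = σ at *
  generalize (-1 : ℂ) ^ ((S.p₁ * S.q₂ + 1) / 2) = τ at *
  rw [← hs, ← ht]
  generalize Complex.I = i at *
  refine ⟨?_, ?_, ?_, ?_, ?_, ?_⟩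
  all_goals grind

end Ladder

end KeplerCoulomb

namespace KeplerCoulomb

open QuadraticFunctions

variable {S : KeplerCoulomb}

theorem val_eq_eval (F : MvPolynomial (Fin 3) ℝ) : S.val F =
    fun x => MvPolynomial.eval (fun i => (![S.H, S.L₂, S.L₃] : Fin 3 → PhaseSpace 3 → ℝ) i x) F := by
  funext x
  rw [val]
  congr 2
  ext i
  fin_cases i <;> rfl

theorem analytic_val (F : MvPolynomial (Fin 3) ℝ) : AnalyticOnNhd ℝ (S.val F) S.phase := by
  rw [val_eq_eval]
  refine AnalyticOnNhd.eval (fun i => ?_) F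
  fin_cases i
  exacts [analytic_H, analytic_L₂, analytic_L₃]

theorem poisson_val_right {x : PhaseSpace 3} (hx : x ∈ S.phase) (f : PhaseSpace 3 → ℝ)
    (F : MvPolynomial (Fin 3) ℝ) : poisson f (S.val F) x =
      S.val (MvPolynomial.pderiv 0 F) x * poisson f S.H x +
        S.val (MvPolynomial.pderiv 1 F) x * poisson f S.L₂ x +
        S.val (MvPolynomial.pderiv 2 F) x * poisson f S.L₃ x := by
  simp only [val_eq_eval]
  rw [poisson_eval_right]
  · simp [Fin.sum_univ_three]
  · intro i
    fin_cases i
    exacts [differentiableAt_H hx, differentiableAt_L₂ hx, differentiableAt_L₃ hx]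

/-! ### Generic nonvanishing -/

theorem val_P₁ (x : PhaseSpace 3) : S.val S.P₁ x =
    S.val S.Q x ^ S.q₁ * (S.α ^ 2 + 4 * S.H x * S.L₂ x) ^ (2 * S.p₁) := by
  rw [val_Q]
  simp only [val, P₁, map_mul, map_add, map_sub, map_pow, MvPolynomial.eval_X,
    MvPolynomial.eval_C, map_ofNat, Matrix.cons_val]
  congr 2
  ring

theorem val_P₂ (x : PhaseSpace 3) : S.val S.P₂ x =
    ((S.β - S.γ - S.L₃ x) ^ 2 - 4 * S.γ * S.L₃ x) ^ (S.p₁ * S.q₂) *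
      S.val S.Q x ^ (S.p₂ * S.q₁) := by
  rw [val_Q]
  simp only [val, P₂, map_mul, map_add, map_sub, map_pow, MvPolynomial.eval_X,
    MvPolynomial.eval_C, map_ofNat, Matrix.cons_val]
  congr 2
  ring

theorem exists_sq_add_gt (c B : ℝ) : ∃ p : ℝ, B < p ^ 2 + c := by
  refine ⟨|B| + |c| + 1, ?_⟩
  nlinarith [le_abs_self B, neg_abs_le c, abs_nonneg B, abs_nonneg c,
    mul_nonneg (abs_nonneg B) (abs_nonneg c)]

/-- The expression equals `(a - b)² + m (m - 2 (a + b))`. It covers `Q` (with `m = L₂`) and the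
first factor of `P₂` (with `m = L₃`). -/
theorem sq_sub_mul_pos {a b m : ℝ} (h0 : 0 < m) (h : 2 * (a + b) < m) :
    0 < (a - b - m) ^ 2 - 4 * b * m := by
  nlinarith [mul_pos h0 (sub_pos.2 h), sq_nonneg (a - b)]

/-- Each of `L₃`, `L₂`, `H` is the square of its own momentum plus a term in the momenta already
chosen, so the three can be made large one after another. -/
theorem exists_momentum_pos (S : KeplerCoulomb) (q : Fin 3 → ℝ) : ∃ p : Fin 3 → ℝ,
    0 < S.L₂ (q, p) ∧ 0 < S.L₃ (q, p) ∧ 0 < S.val S.P₁ (q, p) ∧ 0 < S.val S.P₂ (q, p) := by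
  obtain ⟨c, hc⟩ := exists_sq_add_gt (S.L₃ (q, 0)) (max 0 (2 * (S.β + S.γ)))
  obtain ⟨b, hb⟩ := exists_sq_add_gt (S.L₂ (q, ![0, 0, c]))
    (max 0 (2 * (S.L₃ (q, ![0, 0, c]) + S.δ)))
  obtain ⟨a, ha⟩ := exists_sq_add_gt (S.H (q, ![0, b, c])) 0
  have h3 : S.L₃ (q, ![a, b, c]) = c ^ 2 + S.L₃ (q, 0) := by
    simp [L₃]
    ring
  have h3' : S.L₃ (q, ![0, 0, c]) = S.L₃ (q, ![a, b, c]) := by simp [L₃]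
  have h2 : S.L₂ (q, ![a, b, c]) = b ^ 2 + S.L₂ (q, ![0, 0, c]) := by
    simp [L₂, L₃]
    ring
  have h1 : S.H (q, ![a, b, c]) = a ^ 2 + S.H (q, ![0, b, c]) := by
    simp [H, L₂, L₃]
    ring
  rw [← h3, max_lt_iff] at hc
  rw [← h2, h3', max_lt_iff] at hb
  rw [← h1] at ha
  have hQ : 0 < S.val S.Q (q, ![a, b, c]) := by
    rw [val_Q, show S.L₃ (q, ![a, b, c]) - S.L₂ (q, ![a, b, c]) - S.δ =
      S.L₃ (q, ![a, b, c]) - S.δ - S.L₂ (q, ![a, b, c]) by ring]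
    exact sq_sub_mul_pos hb.1 hb.2
  refine ⟨![a, b, c], hb.1, hc.1, ?_, ?_⟩
  · rw [val_P₁]
    have := mul_pos ha hb.1
    have : 0 < S.α ^ 2 + 4 * S.H (q, ![a, b, c]) * S.L₂ (q, ![a, b, c]) := by nlinarith
    positivity
  · rw [val_P₂]
    have := sq_sub_mul_pos hc.1 hc.2
    positivity

theorem generic_L₂ : GenericallyNonzero S.phase S.L₂ :=
  genericallyNonzero_of_fibre analytic_L₂ fun q _ =>
    let ⟨p, h, _⟩ := exists_momentum_pos S q
    ⟨p, h.ne'⟩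

theorem generic_L₃ : GenericallyNonzero S.phase S.L₃ :=
  genericallyNonzero_of_fibre analytic_L₃ fun q _ =>
    let ⟨p, _, h, _⟩ := exists_momentum_pos S q
    ⟨p, h.ne'⟩

theorem generic_P₁ : GenericallyNonzero S.phase (S.val S.P₁) :=
  genericallyNonzero_of_fibre (analytic_val _) fun q _ =>
    let ⟨p, _, _, h, _⟩ := exists_momentum_pos S q
    ⟨p, h.ne'⟩

theorem generic_P₂ : GenericallyNonzero S.phase (S.val S.P₂) :=
  genericallyNonzero_of_fibre (analytic_val _) fun q _ =>
    let ⟨p, _, _, _, h⟩ := exists_momentum_pos S q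
    ⟨p, h.ne'⟩

/-! ### Brackets of `J₁`, `J₂` and of `K₁`, `K₂` -/

/-- Let E be the difference of the two sides. Bracketing `J₂² + L₂ J₁² = 4 P₁` with `J₁` gives `J₂ E
= 0`, and with `J₂` gives `L₂ J₁ E = 0`. Hence `(J₂² + L₂ J₁²) E = 4 P₁ E` vanishes, and E vanishes
where `P₁` does not. -/
theorem poisson_J₁_J₂ (hS : S.HasOddParameters) : ∀ x ∈ S.phase, poisson S.J₁ S.J₂ x =
    -2 * S.p₁ * S.J₁ x ^ 2 + 8 * S.p₁ * S.val (MvPolynomial.pderiv 1 S.P₁) x := by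
  refine generic_P₁.eq_of_eq S.isOpen_phase (analytic_J₁.poisson analytic_J₂).continuousOn
    (fun x hx => ?_) fun x hx hP => ?_
  · have h1 := (analytic_J₁ x hx).continuousAt
    have h2 := (analytic_val (S := S) (MvPolynomial.pderiv 1 S.P₁) x hx).continuousAt
    exact ((continuousAt_const.mul (h1.pow 2)).add
      (continuousAt_const.mul h2)).continuousWithinAt
  have hd1 := (analytic_J₁ x hx).differentiableAt
  have hd2 := (analytic_J₂ x hx).differentiableAt
  have hdL := differentiableAt_L₂ hx
  have hdP := (analytic_val (S := S) S.P₁ x hx).differentiableAt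
  have key : ∀ f : PhaseSpace 3 → ℝ, 2 * S.J₂ x * poisson f S.J₂ x +
      (S.L₂ x * (2 * S.J₁ x * poisson f S.J₁ x) + S.J₁ x ^ 2 * poisson f S.L₂ x) =
      4 * poisson f (S.val S.P₁) x := by
    intro f
    have hev : (fun y => S.J₂ y * S.J₂ y + S.L₂ y * (S.J₁ y * S.J₁ y)) =ᶠ[𝓝 x]
        fun y => 4 * S.val S.P₁ y := by
      filter_upwards [S.isOpen_phase.mem_nhds hx] with y hy
      linear_combination J₂_sq hy
    have h := poisson_congr (EventuallyEq.refl _ f) hev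
    rw [poisson_const_mul_right f 4 hdP,
      poisson_add_right f (hd2.fun_mul hd2) (hdL.fun_mul (hd1.fun_mul hd1)),
      poisson_mul_right f hd2 hd2, poisson_mul_right f hdL (hd1.fun_mul hd1),
      poisson_mul_right f hd1 hd1] at h
    linear_combination h
  have k1 := key S.J₁
  have k2 := key S.J₂
  rw [poisson_val_right hx, poisson_antisymm _ S.H, poisson_antisymm _ S.L₃,
    poisson_antisymm _ S.L₂, poisson_self] at k1 k2
  rw [poisson_H_J₁ hS hx, poisson_L₃_J₁ hx, poisson_L₂_J₁ hS hx] at k1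
  rw [poisson_H_J₂ hS hx, poisson_L₃_J₂ hx, poisson_L₂_J₂ hS hx, poisson_antisymm _ S.J₁] at k2
  have hsq := J₂_sq hx
  refine sub_eq_zero.1 ((mul_eq_zero.1 ?_).resolve_left hP)
  linear_combination (1 / 8) * S.J₂ x * k1 - (1 / 8) * S.J₁ x * k2 -
    (1 / 4) * (poisson S.J₁ S.J₂ x - (-2 * S.p₁ * S.J₁ x ^ 2 +
      8 * S.p₁ * S.val (MvPolynomial.pderiv 1 S.P₁) x)) * hsq

theorem poisson_K₁_K₂ (hS : S.HasOddParameters) : ∀ x ∈ S.phase, poisson S.K₁ S.K₂ x =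
    -2 * S.p₁ * S.p₂ * S.K₁ x ^ 2 +
      8 * S.p₁ * S.p₂ * S.val (MvPolynomial.pderiv 2 S.P₂) x := by
  refine generic_P₂.eq_of_eq S.isOpen_phase (analytic_K₁.poisson analytic_K₂).continuousOn
    (fun x hx => ?_) fun x hx hP => ?_
  · have h1 := (analytic_K₁ x hx).continuousAt
    have h2 := (analytic_val (S := S) (MvPolynomial.pderiv 2 S.P₂) x hx).continuousAt
    exact ((continuousAt_const.mul (h1.pow 2)).add
      (continuousAt_const.mul h2)).continuousWithinAt
  have hd1 := (analytic_K₁ x hx).differentiableAt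
  have hd2 := (analytic_K₂ x hx).differentiableAt
  have hdL := differentiableAt_L₃ hx
  have hdP := (analytic_val (S := S) S.P₂ x hx).differentiableAt
  have key : ∀ f : PhaseSpace 3 → ℝ, 2 * S.K₂ x * poisson f S.K₂ x +
      (S.L₃ x * (2 * S.K₁ x * poisson f S.K₁ x) + S.K₁ x ^ 2 * poisson f S.L₃ x) =
      4 * poisson f (S.val S.P₂) x := by
    intro f
    have hev : (fun y => S.K₂ y * S.K₂ y + S.L₃ y * (S.K₁ y * S.K₁ y)) =ᶠ[𝓝 x]
        fun y => 4 * S.val S.P₂ y := by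
      filter_upwards [S.isOpen_phase.mem_nhds hx] with y hy
      linear_combination K₂_sq hy
    have h := poisson_congr (EventuallyEq.refl _ f) hev
    rw [poisson_const_mul_right f 4 hdP,
      poisson_add_right f (hd2.fun_mul hd2) (hdL.fun_mul (hd1.fun_mul hd1)),
      poisson_mul_right f hd2 hd2, poisson_mul_right f hdL (hd1.fun_mul hd1),
      poisson_mul_right f hd1 hd1] at h
    linear_combination h
  have k1 := key S.K₁
  have k2 := key S.K₂
  rw [poisson_val_right hx, poisson_antisymm _ S.H, poisson_antisymm _ S.L₃,
    poisson_antisymm _ S.L₂, poisson_self] at k1 k2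
  rw [poisson_H_K₁ hS hx, poisson_L₃_K₁ hS hx, poisson_L₂_K₁ hS hx] at k1
  rw [poisson_H_K₂ hS hx, poisson_L₃_K₂ hS hx, poisson_L₂_K₂ hS hx,
    poisson_antisymm _ S.K₁] at k2
  have hsq := K₂_sq hx
  refine sub_eq_zero.1 ((mul_eq_zero.1 ?_).resolve_left hP)
  linear_combination (1 / 8) * S.K₂ x * k1 - (1 / 8) * S.K₁ x * k2 -
    (1 / 4) * (poisson S.K₁ S.K₂ x - (-2 * S.p₁ * S.p₂ * S.K₁ x ^ 2 +
      8 * S.p₁ * S.p₂ * S.val (MvPolynomial.pderiv 2 S.P₂) x)) * hsq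

end KeplerCoulomb

namespace KeplerCoulomb

open QuadraticFunctions

variable {S : KeplerCoulomb}

/-! ### The constants `J₀` and `K₀` -/

/-- `J₀` and `K₀` are analytic quotients of `J₂ - D₁` by `L₂` and of `K₂ - D₂` by `L₃`. -/
structure IsQuotient (S : KeplerCoulomb) (J₀ K₀ : PhaseSpace 3 → ℝ) : Prop where
  analytic_J₀ : AnalyticOnNhd ℝ J₀ S.phase
  analytic_K₀ : AnalyticOnNhd ℝ K₀ S.phase
  J₂_eq : ∀ x ∈ S.phase, S.J₂ x = S.L₂ x * J₀ x + S.val S.D₁ x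
  K₂_eq : ∀ x ∈ S.phase, S.K₂ x = S.L₃ x * K₀ x + S.val S.D₂ x

theorem pderiv_two (i : Fin 3) : MvPolynomial.pderiv i (2 : MvPolynomial (Fin 3) ℝ) = 0 := by
  exact_mod_cast (MvPolynomial.pderiv i).map_natCast 2

theorem poisson_val_D₁ {x : PhaseSpace 3} (hx : x ∈ S.phase) (f : PhaseSpace 3 → ℝ) :
    poisson f (S.val S.D₁) x = S.val (MvPolynomial.pderiv 2 S.D₁) x * poisson f S.L₃ x := by
  have h0 : MvPolynomial.pderiv 0 S.D₁ = 0 := by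
    simp [D₁, MvPolynomial.pderiv_X, pderiv_two]
  have h1 : MvPolynomial.pderiv 1 S.D₁ = 0 := by
    simp [D₁, MvPolynomial.pderiv_X, pderiv_two]
  rw [poisson_val_right hx, h0, h1]
  simp [val]

theorem poisson_val_D₂ {x : PhaseSpace 3} (hx : x ∈ S.phase) (f : PhaseSpace 3 → ℝ) :
    poisson f (S.val S.D₂) x = S.val (MvPolynomial.pderiv 1 S.D₂) x * poisson f S.L₂ x := by
  have h0 : MvPolynomial.pderiv 0 S.D₂ = 0 := by
    simp [D₂, MvPolynomial.pderiv_X, pderiv_two]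
  have h1 : MvPolynomial.pderiv 2 S.D₂ = 0 := by
    simp [D₂, MvPolynomial.pderiv_X, pderiv_two]
  rw [poisson_val_right hx, h0, h1]
  simp [val]

/-- Modulo `L₂` the factors of `P₁` are the squares of `δ - L₃` and `α`; modulo `L₃` those of `P₂`
are the squares of `γ - β` and `L₂ - δ`. So `4 P₁ - D₁²` and `4 P₂ - D₂²` have the required
divisibility. -/
theorem pow_even_add_dvd {R : Type*} [CommRing R] {X A B C F : R} (hA : X ∣ A - B ^ 2)
    (hC : X ∣ C - F ^ 2) (m n : ℕ) : X ∣ A ^ m * C ^ n - (B ^ m * F ^ n) ^ 2 := by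
  obtain ⟨u, hu⟩ := hA.trans (sub_dvd_pow_sub_pow A (B ^ 2) m)
  obtain ⟨v, hv⟩ := hC.trans (sub_dvd_pow_sub_pow C (F ^ 2) n)
  refine ⟨u * C ^ n + (B ^ 2) ^ m * v, ?_⟩
  linear_combination C ^ n * hu + (B ^ 2) ^ m * hv

theorem exists_E₁ (S : KeplerCoulomb) : ∃ E₁ : MvPolynomial (Fin 3) ℝ,
    MvPolynomial.X 1 * E₁ = 4 * S.P₁ - S.D₁ ^ 2 := by
  have h := pow_even_add_dvd (R := MvPolynomial (Fin 3) ℝ) (X := MvPolynomial.X 1)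
    (A := MvPolynomial.X 2 ^ 2 - 2 * MvPolynomial.X 2 * (MvPolynomial.X 1 + MvPolynomial.C S.δ) +
      (MvPolynomial.X 1 - MvPolynomial.C S.δ) ^ 2) (B := MvPolynomial.C S.δ - MvPolynomial.X 2)
    (C := MvPolynomial.C S.α ^ 2 + 4 * MvPolynomial.X 0 * MvPolynomial.X 1)
    (F := MvPolynomial.C S.α) ⟨MvPolynomial.X 1 - 2 * MvPolynomial.X 2 - 2 * MvPolynomial.C S.δ,
      by ring⟩ ⟨4 * MvPolynomial.X 0, by ring⟩ S.q₁ (2 * S.p₁)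
  obtain ⟨E, hE⟩ := h
  refine ⟨4 * E, ?_⟩
  rw [P₁, D₁]
  linear_combination (-4) * hE + 4 * ((MvPolynomial.C S.δ - MvPolynomial.X 2) ^ S.q₁ *
    MvPolynomial.C S.α ^ (2 * S.p₁)) ^ 2 * (Even.neg_one_pow (even_two_mul ((S.q₁ - 1) / 2)) :
      (-1 : MvPolynomial (Fin 3) ℝ) ^ (2 * ((S.q₁ - 1) / 2)) = 1)

theorem exists_E₂ (S : KeplerCoulomb) : ∃ E₂ : MvPolynomial (Fin 3) ℝ,
    MvPolynomial.X 2 * E₂ = 4 * S.P₂ - S.D₂ ^ 2 := by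
  have h := pow_even_add_dvd (R := MvPolynomial (Fin 3) ℝ) (X := MvPolynomial.X 2)
    (A := (MvPolynomial.C S.β - MvPolynomial.C S.γ - MvPolynomial.X 2) ^ 2 -
      4 * MvPolynomial.C S.γ * MvPolynomial.X 2)
    (B := MvPolynomial.C S.γ - MvPolynomial.C S.β)
    (C := MvPolynomial.X 2 ^ 2 - 2 * MvPolynomial.X 2 * (MvPolynomial.X 1 + MvPolynomial.C S.δ) +
      (MvPolynomial.X 1 - MvPolynomial.C S.δ) ^ 2)
    (F := MvPolynomial.X 1 - MvPolynomial.C S.δ)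
    ⟨MvPolynomial.X 2 - 2 * MvPolynomial.C S.β - 2 * MvPolynomial.C S.γ, by ring⟩
    ⟨MvPolynomial.X 2 - 2 * (MvPolynomial.X 1 + MvPolynomial.C S.δ), by ring⟩
    (S.p₁ * S.q₂) (S.p₂ * S.q₁)
  obtain ⟨E, hE⟩ := h
  refine ⟨4 * E, ?_⟩
  rw [P₂, D₂]
  linear_combination (-4) * hE + 4 * ((MvPolynomial.C S.γ - MvPolynomial.C S.β) ^ (S.p₁ * S.q₂) *
    (MvPolynomial.X 1 - MvPolynomial.C S.δ) ^ (S.p₂ * S.q₁)) ^ 2 *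
    (Even.neg_one_pow (even_two_mul ((S.p₁ * S.q₂ + 1) / 2)) :
      (-1 : MvPolynomial (Fin 3) ℝ) ^ (2 * ((S.p₁ * S.q₂ + 1) / 2)) = 1)

namespace IsQuotient

variable {J₀ K₀ : PhaseSpace 3 → ℝ} (hQ : S.IsQuotient J₀ K₀)
include hQ

theorem poisson_J₂ {x : PhaseSpace 3} (hx : x ∈ S.phase) (f : PhaseSpace 3 → ℝ) :
    poisson f S.J₂ x = S.L₂ x * poisson f J₀ x + J₀ x * poisson f S.L₂ x +
      S.val (MvPolynomial.pderiv 2 S.D₁) x * poisson f S.L₃ x := by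
  have hd := (hQ.analytic_J₀ x hx).differentiableAt
  have hev : S.J₂ =ᶠ[𝓝 x] fun y => S.L₂ y * J₀ y + S.val S.D₁ y := by
    filter_upwards [S.isOpen_phase.mem_nhds hx] with y hy using hQ.J₂_eq y hy
  rw [poisson_congr (EventuallyEq.refl _ f) hev,
    poisson_add_right f ((differentiableAt_L₂ hx).fun_mul hd)
      (analytic_val S.D₁ x hx).differentiableAt,
    poisson_mul_right f (differentiableAt_L₂ hx) hd, poisson_val_D₁ hx]

theorem poisson_K₂ {x : PhaseSpace 3} (hx : x ∈ S.phase) (f : PhaseSpace 3 → ℝ) :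
    poisson f S.K₂ x = S.L₃ x * poisson f K₀ x + K₀ x * poisson f S.L₃ x +
      S.val (MvPolynomial.pderiv 1 S.D₂) x * poisson f S.L₂ x := by
  have hd := (hQ.analytic_K₀ x hx).differentiableAt
  have hev : S.K₂ =ᶠ[𝓝 x] fun y => S.L₃ y * K₀ y + S.val S.D₂ y := by
    filter_upwards [S.isOpen_phase.mem_nhds hx] with y hy using hQ.K₂_eq y hy
  rw [poisson_congr (EventuallyEq.refl _ f) hev,
    poisson_add_right f ((differentiableAt_L₃ hx).fun_mul hd)
      (analytic_val S.D₂ x hx).differentiableAt,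
    poisson_mul_right f (differentiableAt_L₃ hx) hd, poisson_val_D₂ hx]

/-- Expanding `J₂ = L₂ J₀ + D₁` determines the bracket with `J₀` where `L₂ ≠ 0`; continuity does the
rest. -/
theorem poisson_J₀_eq {f g : PhaseSpace 3 → ℝ} (hf : AnalyticOnNhd ℝ f S.phase)
    (hg : AnalyticOnNhd ℝ g S.phase)
    (h : ∀ x ∈ S.phase, poisson f S.J₂ x = S.L₂ x * g x + J₀ x * poisson f S.L₂ x +
      S.val (MvPolynomial.pderiv 2 S.D₁) x * poisson f S.L₃ x) :
    ∀ x ∈ S.phase, poisson f J₀ x = g x :=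
  generic_L₂.eq_of_eq S.isOpen_phase (hf.poisson hQ.analytic_J₀).continuousOn hg.continuousOn
    fun x hx hL => mul_left_cancel₀ hL (by linear_combination h x hx - hQ.poisson_J₂ hx f)

theorem poisson_K₀_eq {f g : PhaseSpace 3 → ℝ} (hf : AnalyticOnNhd ℝ f S.phase)
    (hg : AnalyticOnNhd ℝ g S.phase)
    (h : ∀ x ∈ S.phase, poisson f S.K₂ x = S.L₃ x * g x + K₀ x * poisson f S.L₃ x +
      S.val (MvPolynomial.pderiv 1 S.D₂) x * poisson f S.L₂ x) :
    ∀ x ∈ S.phase, poisson f K₀ x = g x :=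
  generic_L₃.eq_of_eq S.isOpen_phase (hf.poisson hQ.analytic_K₀).continuousOn hg.continuousOn
    fun x hx hL => mul_left_cancel₀ hL (by linear_combination h x hx - hQ.poisson_K₂ hx f)

theorem poisson_L₃_J₀ : ∀ x ∈ S.phase, poisson S.L₃ J₀ x = 0 :=
  hQ.poisson_J₀_eq (g := fun _ => 0) analytic_L₃ analyticOnNhd_const fun x hx => by
    rw [poisson_L₃_J₂ hx, poisson_L₃_L₂ hx, poisson_self]
    ring

variable (hS : S.HasOddParameters)
include hS

theorem poisson_L₂_J₀ : ∀ x ∈ S.phase, poisson S.L₂ J₀ x = 4 * S.p₁ * S.J₁ x :=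
  hQ.poisson_J₀_eq analytic_L₂ (fun x hx => analyticAt_const.fun_mul (analytic_J₁ x hx))
    fun x hx => by
      rw [poisson_L₂_J₂ hS hx, poisson_L₂_L₃ hx, poisson_self]
      ring

theorem poisson_H_J₀ : ∀ x ∈ S.phase, poisson S.H J₀ x = 0 :=
  hQ.poisson_J₀_eq (g := fun _ => 0) analytic_H analyticOnNhd_const fun x hx => by
    rw [poisson_H_J₂ hS hx, poisson_H_L₂ hx, poisson_H_L₃ hx]
    ring

theorem poisson_L₃_K₀ : ∀ x ∈ S.phase, poisson S.L₃ K₀ x = 4 * S.p₁ * S.p₂ * S.K₁ x :=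
  hQ.poisson_K₀_eq analytic_L₃ (fun x hx => analyticAt_const.fun_mul (analytic_K₁ x hx))
    fun x hx => by
      rw [poisson_L₃_K₂ hS hx, poisson_L₃_L₂ hx, poisson_self]
      ring

theorem poisson_L₂_K₀ : ∀ x ∈ S.phase, poisson S.L₂ K₀ x = 0 :=
  hQ.poisson_K₀_eq (g := fun _ => 0) analytic_L₂ analyticOnNhd_const fun x hx => by
    rw [poisson_L₂_K₂ hS hx, poisson_L₂_L₃ hx, poisson_self]
    ring

theorem poisson_H_K₀ : ∀ x ∈ S.phase, poisson S.H K₀ x = 0 :=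
  hQ.poisson_K₀_eq (g := fun _ => 0) analytic_H analyticOnNhd_const fun x hx => by
    rw [poisson_H_K₂ hS hx, poisson_H_L₂ hx, poisson_H_L₃ hx]
    ring

-- Inserting `J₂ = L₂ J₀ + D₁` into `J₂² + L₂ J₁² = 4 P₁` leaves only multiples of `L₂`, since `4 P₁
-- - D₁² = L₂ E₁`.
omit hS in
theorem J₁_sq {E₁ : MvPolynomial (Fin 3) ℝ} (hE : MvPolynomial.X 1 * E₁ = 4 * S.P₁ - S.D₁ ^ 2) :
    ∀ x ∈ S.phase, S.J₁ x ^ 2 =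
      -S.L₂ x * J₀ x ^ 2 - 2 * S.val S.D₁ x * J₀ x + S.val E₁ x := by
  refine generic_L₂.eq_of_eq S.isOpen_phase (analytic_J₁.continuousOn.pow 2)
    (((analytic_L₂.continuousOn.neg.mul (hQ.analytic_J₀.continuousOn.pow 2)).sub
      ((continuousOn_const.mul (analytic_val _).continuousOn).mul
        hQ.analytic_J₀.continuousOn)).add (analytic_val _).continuousOn)
    fun x hx hL => mul_left_cancel₀ hL ?_
  have h1 := congrArg (fun F => S.val F x) hE
  simp only [val, map_mul, map_sub, map_pow, MvPolynomial.eval_X, map_ofNat,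
    Matrix.cons_val] at h1
  have h2 := J₂_sq hx
  rw [hQ.J₂_eq x hx] at h2
  simp only [val] at h1 h2 ⊢
  linear_combination h2 - h1

omit hS in
theorem K₁_sq {E₂ : MvPolynomial (Fin 3) ℝ} (hE : MvPolynomial.X 2 * E₂ = 4 * S.P₂ - S.D₂ ^ 2) :
    ∀ x ∈ S.phase, S.K₁ x ^ 2 =
      -S.L₃ x * K₀ x ^ 2 - 2 * S.val S.D₂ x * K₀ x + S.val E₂ x := by
  refine generic_L₃.eq_of_eq S.isOpen_phase (analytic_K₁.continuousOn.pow 2)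
    (((analytic_L₃.continuousOn.neg.mul (hQ.analytic_K₀.continuousOn.pow 2)).sub
      ((continuousOn_const.mul (analytic_val _).continuousOn).mul
        hQ.analytic_K₀.continuousOn)).add (analytic_val _).continuousOn)
    fun x hx hL => mul_left_cancel₀ hL ?_
  have h1 := congrArg (fun F => S.val F x) hE
  simp only [val, map_mul, map_sub, map_pow, MvPolynomial.eval_X, map_ofNat,
    Matrix.cons_val] at h1
  have h2 := K₂_sq hx
  rw [hQ.K₂_eq x hx] at h2
  simp only [val] at h1 h2 ⊢
  linear_combination h2 - h1

/-- The four brackets of `J₀, J₁` with `K₀, K₁`, multiplied by denominators. -/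
theorem poisson_J₀_K₀ {x : PhaseSpace 3} (hx : x ∈ S.phase) :
    S.L₂ x * S.L₃ x * S.val S.Q x * poisson J₀ K₀ x =
      S.L₂ x * (S.val S.Q x * S.val (MvPolynomial.pderiv 1 S.D₂) x -
          S.q₁ * S.p₂ * (S.L₃ x * K₀ x + S.val S.D₂ x) * (S.L₂ x - S.L₃ x - S.δ)) *
        (4 * S.p₁ * S.J₁ x) -
      S.L₃ x * (S.val S.Q x * S.val (MvPolynomial.pderiv 2 S.D₁) x +
          S.q₁ * (S.L₂ x * J₀ x + S.val S.D₁ x) * (S.L₂ x - S.L₃ x + S.δ)) *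
        (4 * S.p₁ * S.p₂ * S.K₁ x) := by
  have h := poisson_J_K hS hx 1 1
  simp [Fin.rev] at h
  have h1 := hQ.poisson_K₂ hx S.J₂
  have h2 := hQ.poisson_J₂ hx K₀
  rw [poisson_antisymm S.J₂ S.L₃, poisson_antisymm S.J₂ S.L₂, poisson_L₃_J₂ hx,
    poisson_L₂_J₂ hS hx, poisson_antisymm S.J₂ K₀] at h1
  rw [poisson_antisymm K₀ S.L₃, poisson_antisymm K₀ S.L₂, hQ.poisson_L₃_K₀ hS x hx,
    hQ.poisson_L₂_K₀ hS x hx, poisson_antisymm K₀ J₀] at h2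
  rw [← hQ.J₂_eq x hx, ← hQ.K₂_eq x hx]
  linear_combination h - S.val S.Q x * h1 + S.val S.Q x * S.L₃ x * h2

/-- The known bracket of `J₁` with `K₂ = L₃ K₀ + D₂` is solved for its `K₀` term; the last summand
comes from `D₂`, which depends on `L₂`. -/
theorem poisson_J₁_K₀ {x : PhaseSpace 3} (hx : x ∈ S.phase) :
    S.L₃ x * S.val S.Q x * poisson S.J₁ K₀ x =
      4 * S.q₁ * S.p₁ * S.p₂ * (S.J₂ x * S.K₂ x * (S.L₂ x - S.L₃ x - S.δ) -
        S.L₃ x * S.J₁ x * S.K₁ x * (S.L₂ x - S.L₃ x + S.δ)) -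
      4 * S.p₁ * S.val S.Q x * S.val (MvPolynomial.pderiv 1 S.D₂) x * S.J₂ x := by
  have h := poisson_J_K hS hx 0 1
  simp [Fin.rev] at h
  have h1 := hQ.poisson_K₂ hx S.J₁
  rw [poisson_antisymm S.J₁ S.L₃, poisson_antisymm S.J₁ S.L₂, poisson_L₃_J₁ hx,
    poisson_L₂_J₁ hS hx] at h1
  linear_combination h - S.val S.Q x * h1

theorem poisson_J₀_K₁ {x : PhaseSpace 3} (hx : x ∈ S.phase) :
    S.L₂ x * S.val S.Q x * poisson J₀ S.K₁ x =
      4 * S.q₁ * S.p₁ * S.p₂ * (-S.L₂ x * S.J₁ x * S.K₁ x * (S.L₂ x - S.L₃ x - S.δ) +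
        S.J₂ x * S.K₂ x * (S.L₂ x - S.L₃ x + S.δ)) +
      4 * S.p₁ * S.p₂ * S.val S.Q x * S.val (MvPolynomial.pderiv 2 S.D₁) x * S.K₂ x := by
  have h := poisson_J_K hS hx 1 0
  simp [Fin.rev] at h
  have h1 := hQ.poisson_J₂ hx S.K₁
  rw [poisson_antisymm S.K₁ S.L₃, poisson_antisymm S.K₁ S.L₂, poisson_L₃_K₁ hS hx,
    poisson_L₂_K₁ hS hx, poisson_antisymm S.K₁ J₀, poisson_antisymm S.K₁ S.J₂] at h1
  linear_combination h + S.val S.Q x * h1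

theorem poisson_J₀_J₁ {x : PhaseSpace 3} (hx : x ∈ S.phase) :
    S.L₂ x * poisson J₀ S.J₁ x = 2 * S.p₁ * S.J₁ x ^ 2 -
      8 * S.p₁ * S.val (MvPolynomial.pderiv 1 S.P₁) x + 4 * S.p₁ * J₀ x * S.J₂ x := by
  have h := poisson_J₁_J₂ hS x hx
  rw [hQ.poisson_J₂ hx, poisson_antisymm _ S.L₃, poisson_antisymm _ S.L₂, poisson_L₃_J₁ hx,
    poisson_L₂_J₁ hS hx, poisson_antisymm _ J₀] at h
  linear_combination -h

theorem poisson_K₀_K₁ {x : PhaseSpace 3} (hx : x ∈ S.phase) :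
    S.L₃ x * poisson K₀ S.K₁ x = 2 * S.p₁ * S.p₂ * S.K₁ x ^ 2 -
      8 * S.p₁ * S.p₂ * S.val (MvPolynomial.pderiv 2 S.P₂) x +
      4 * S.p₁ * S.p₂ * K₀ x * S.K₂ x := by
  have h := poisson_K₁_K₂ hS x hx
  rw [hQ.poisson_K₂ hx, poisson_antisymm _ S.L₃, poisson_antisymm _ S.L₂, poisson_L₃_K₁ hS hx,
    poisson_L₂_K₁ hS hx, poisson_antisymm _ K₀] at h
  linear_combination -h

end IsQuotient

end KeplerCoulomb

/-! ### Upper bounds for the orders. -/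

theorem MomentumOrderLE.congr {n : ℕ} {D : Set (Fin n → ℝ)} {f g : PhaseSpace n → ℝ} {d : ℕ}
    (h : MomentumOrderLE D f d) (hfg : ∀ x, g x = f x) : MomentumOrderLE D g d := by
  rwa [show g = f from funext hfg]

theorem MomentumOrderLE.pow {n : ℕ} {D : Set (Fin n → ℝ)} {f : PhaseSpace n → ℝ} {d : ℕ}
    (h : MomentumOrderLE D f d) (k : ℕ) : MomentumOrderLE D (fun x => f x ^ k) (k * d) := by
  induction k with
  | zero => simpa using MomentumOrderLE.const (D := D) 1 0
  | succ k ih =>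
    rw [Nat.succ_mul]
    exact (ih.mul h).congr fun x => pow_succ _ _

theorem QuadraticAlgebra.mk_pow_zero {l a : ℝ} (m : ℕ) :
    (⟨a, 0⟩ : QuadraticAlgebra ℝ (-l) 0) ^ m = ⟨a ^ m, 0⟩ :=
  (QuadraticAlgebra.C_pow m a).symm

/-- The square of a purely imaginary element is the scalar `-l a²`, so odd powers stay purely
imaginary. -/
theorem QuadraticAlgebra.mk_zero_pow {l a : ℝ} {m : ℕ} (hm : Odd m) :
    ∃ c : ℝ, (l ≠ 0 → a ≠ 0 → c ≠ 0) ∧ (⟨0, a⟩ : QuadraticAlgebra ℝ (-l) 0) ^ m = ⟨0, c⟩ := by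
  obtain ⟨h, rfl⟩ := hm
  refine ⟨(-l * a ^ 2) ^ h * a, fun hl ha =>
    mul_ne_zero (pow_ne_zero _ (mul_ne_zero (neg_ne_zero.2 hl) (pow_ne_zero _ ha))) ha, ?_⟩
  have hsq : (⟨0, a⟩ : QuadraticAlgebra ℝ (-l) 0) ^ 2 = ⟨-l * a ^ 2, 0⟩ := by
    rw [pow_two]
    ext
    · simp only [QuadraticAlgebra.re_mul]
      ring
    · simp only [QuadraticAlgebra.im_mul]
      ring
  rw [pow_succ, pow_mul, hsq, mk_pow_zero]
  ext
  · simp only [QuadraticAlgebra.re_mul]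
    ring
  · simp only [QuadraticAlgebra.im_mul]
    ring

theorem tendsto_div_pow_of_eq {f : ℝ → ℝ} {a b : ℝ} {k : ℕ} (hk : k ≠ 0)
    (h : ∀ t, f t = a * t ^ k + b) : Tendsto (fun t => f t / t ^ k) atTop (𝓝 a) := by
  have hb : Tendsto (fun t : ℝ => a + b / t ^ k) atTop (𝓝 (a + 0)) :=
    tendsto_const_nhds.add (tendsto_const_nhds.div_atTop (tendsto_pow_atTop hk))
  rw [add_zero] at hb
  refine hb.congr' ?_
  filter_upwards [eventually_ne_atTop 0] with t ht
  rw [h]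
  field_simp

namespace KeplerCoulomb

open QuadraticFunctions

variable {S : KeplerCoulomb}

section Orders

theorem analytic_sin (k : ℝ) (i : Fin 3) (q : Fin 3 → ℝ) :
    AnalyticAt ℝ (fun q : Fin 3 → ℝ => Real.sin (k * q i)) q :=
  Real.analyticAt_sin.fun_comp (analyticAt_const.fun_mul
    ((ContinuousLinearMap.proj (R := ℝ) (φ := fun _ : Fin 3 => ℝ) i).analyticAt q))

theorem analytic_cos (k : ℝ) (i : Fin 3) (q : Fin 3 → ℝ) :
    AnalyticAt ℝ (fun q : Fin 3 → ℝ => Real.cos (k * q i)) q :=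
  Real.analyticAt_cos.fun_comp (analyticAt_const.fun_mul
    ((ContinuousLinearMap.proj (R := ℝ) (φ := fun _ : Fin 3 => ℝ) i).analyticAt q))

theorem order_inv_sin₁ (d : ℕ) :
    MomentumOrderLE S.region (fun x => (Real.sin (S.k₁ * x.1 1))⁻¹) d :=
  .position (c := fun q => (Real.sin (S.k₁ * q 1))⁻¹)
    (fun q hq => (analytic_sin S.k₁ 1 q).fun_inv hq.2.1) d

theorem order_inv_cos₁ (d : ℕ) :
    MomentumOrderLE S.region (fun x => (Real.cos (S.k₁ * x.1 1))⁻¹) d :=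
  .position (c := fun q => (Real.cos (S.k₁ * q 1))⁻¹)
    (fun q hq => (analytic_cos S.k₁ 1 q).fun_inv hq.2.2.1) d

theorem order_inv_sin₂ (d : ℕ) :
    MomentumOrderLE S.region (fun x => (Real.sin (S.k₂ * x.1 2))⁻¹) d :=
  .position (c := fun q => (Real.sin (S.k₂ * q 2))⁻¹)
    (fun q hq => (analytic_sin S.k₂ 2 q).fun_inv hq.2.2.2.1) d

theorem order_inv_cos₂ (d : ℕ) :
    MomentumOrderLE S.region (fun x => (Real.cos (S.k₂ * x.1 2))⁻¹) d :=
  .position (c := fun q => (Real.cos (S.k₂ * q 2))⁻¹)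
    (fun q hq => (analytic_cos S.k₂ 2 q).fun_inv hq.2.2.2.2) d

theorem order_inv_r (d : ℕ) : MomentumOrderLE S.region (fun x => (x.1 0)⁻¹) d :=
  .position (c := fun q => (q 0)⁻¹) (fun q hq =>
    ((ContinuousLinearMap.proj (R := ℝ) (φ := fun _ : Fin 3 => ℝ) 0).analyticAt q).fun_inv
      hq.1.ne') d

theorem order_sin (k : ℝ) (i : Fin 3) (d : ℕ) :
    MomentumOrderLE S.region (fun x => Real.sin (k * x.1 i)) d :=
  .position (c := fun q => Real.sin (k * q i)) (fun q _ => analytic_sin k i q) d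

theorem order_cos (k : ℝ) (i : Fin 3) (d : ℕ) :
    MomentumOrderLE S.region (fun x => Real.cos (k * x.1 i)) d :=
  .position (c := fun q => Real.cos (k * q i)) (fun q _ => analytic_cos k i q) d

theorem order_L₃ : MomentumOrderLE S.region S.L₃ 2 :=
  (((MomentumOrderLE.momentum 2).pow 2).add ((((order_inv_cos₂ 1).pow 2).const_mul S.β).add
    (((order_inv_sin₂ 1).pow 2).const_mul S.γ))).congr fun x => by
      rw [L₃]
      simp only [inv_pow]
      ring

theorem order_L₂ : MomentumOrderLE S.region S.L₂ 2 :=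
  (((MomentumOrderLE.momentum 1).pow 2).add ((order_L₃.mul ((order_inv_sin₁ 0).pow 2)).add
    (((order_inv_cos₁ 1).pow 2).const_mul S.δ))).congr fun x => by
      rw [L₂]
      simp only [inv_pow]
      ring

theorem order_H : MomentumOrderLE S.region S.H 2 :=
  (((MomentumOrderLE.momentum 0).pow 2).add (((order_inv_r 2).const_mul S.α).add
    (order_L₂.mul ((order_inv_r 0).pow 2)))).congr fun x => by
      rw [H]
      simp only [inv_pow]
      ring

theorem order_cos_sq_sub_sin_sq (k : ℝ) (i : Fin 3) : MomentumOrderLE S.region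
    (fun x => Real.cos (k * x.1 i) ^ 2 - Real.sin (k * x.1 i) ^ 2) 0 :=
  ((order_cos k i 0).pow 2).sub ((order_sin k i 0).pow 2)

theorem order_sin_mul_cos_mul_momentum (k : ℝ) (i : Fin 3) : MomentumOrderLE S.region
    (fun x => 2 * Real.sin (k * x.1 i) * Real.cos (k * x.1 i) * x.2 i) 1 :=
  (((order_sin k i 0).const_mul 2).mul (order_cos k i 0)).mul (.momentum i)

theorem HasOrder.of_quotient {n : ℕ} {D : Set (Fin n → ℝ)} {L : PhaseSpace n → ℝ}
    (hL : MomentumOrderLE D L 2) {z : QuadraticFunctions L} {e c : PhaseSpace n → ℝ}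
    (h1 : MomentumOrderLE D z.im 1) (h2 : MomentumOrderLE D e 2) (h3 : MomentumOrderLE D c 0)
    (h : ∀ x, z.re x = L x * c x + e x) : z.HasOrder D e 0 :=
  ⟨((hL.mul h3).add h2).congr h, h1, h2, c, h3, h⟩

theorem hasOrder_zX₁ : S.zX₁.HasOrder S.region (fun x => S.δ - S.L₃ x) 0 :=
  HasOrder.of_quotient order_L₂ (order_sin_mul_cos_mul_momentum S.k₁ 1)
    ((MomentumOrderLE.const S.δ 2).sub order_L₃)
    ((order_cos_sq_sub_sin_sq S.k₁ 1).const_mul (-1)) fun x => by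
      simp only [zX₁]
      ring

theorem hasOrder_zY₁ : S.zY₁.HasOrder S.region (fun _ => S.α) 0 :=
  HasOrder.of_quotient order_L₂ ((MomentumOrderLE.momentum 0).const_mul 2)
    (MomentumOrderLE.const S.α 2) ((order_inv_r 0).const_mul 2) fun x => by
      simp only [zY₁]
      ring

theorem hasOrder_zX₂ : S.zX₂.HasOrder S.region (fun _ => S.γ - S.β) 0 :=
  HasOrder.of_quotient order_L₃ (order_sin_mul_cos_mul_momentum S.k₂ 2)
    (MomentumOrderLE.const _ 2) (order_cos_sq_sub_sin_sq S.k₂ 2) fun x => by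
      simp only [zX₂]
      ring

theorem order_cot : MomentumOrderLE S.region
    (fun x => Real.cos (S.k₁ * x.1 1) / Real.sin (S.k₁ * x.1 1)) 0 :=
  ((order_cos S.k₁ 1 0).mul (order_inv_sin₁ 0)).congr fun _ => div_eq_mul_inv _ _

theorem hasOrder_zY₂ : S.zY₂.HasOrder S.region (fun x => S.L₂ x - S.δ) 0 :=
  HasOrder.of_quotient order_L₃ ((order_cot.const_mul 2).mul (.momentum 1))
    (order_L₂.sub (.const S.δ 2)) (((order_cot.pow 2).const_mul (-2)).sub (.const 1 0)) fun x => by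
      simp only [zY₂]
      ring

/-- A single factor has index 0 and each multiplication raises the index by one, so `m + m'` factors
have index `m + m' - 1`. Positivity of both exponents keeps the natural subtraction honest. -/
theorem hasOrder_pow_mul_pow {L : PhaseSpace 3 → ℝ} (hL : MomentumOrderLE S.region L 2)
    {z z' : QuadraticFunctions L} {e e' : PhaseSpace 3 → ℝ} (h : z.HasOrder S.region e 0)
    (h' : z'.HasOrder S.region e' 0) {m m' : ℕ} (hm : 0 < m) (hm' : 0 < m') :
    (z ^ m * z' ^ m').HasOrder S.region (fun x => e x ^ m * e' x ^ m') (m + m' - 1) := by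
  obtain ⟨m, rfl⟩ := Nat.exists_eq_succ_of_ne_zero hm.ne'
  obtain ⟨m', rfl⟩ := Nat.exists_eq_succ_of_ne_zero hm'.ne'
  rw [show m.succ + m'.succ - 1 = m + m' + 1 by omega]
  exact (h.pow hL m).mul hL (h'.pow hL m')

variable (hS : S.HasOddParameters)
include hS

theorem hasOrder_zJ : S.zJ.HasOrder S.region
    (fun x => (S.δ - S.L₃ x) ^ S.q₁ * S.α ^ (2 * S.p₁)) (S.q₁ + 2 * S.p₁ - 1) :=
  hasOrder_pow_mul_pow order_L₂ hasOrder_zX₁ hasOrder_zY₁ hS.q₁.pos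
    (Nat.mul_pos two_pos hS.p₁.pos)

theorem hasOrder_zK : S.zK.HasOrder S.region
    (fun x => (S.γ - S.β) ^ (S.p₁ * S.q₂) * (S.L₂ x - S.δ) ^ (S.p₂ * S.q₁))
    (S.p₁ * S.q₂ + S.p₂ * S.q₁ - 1) :=
  hasOrder_pow_mul_pow order_L₃ hasOrder_zX₂ hasOrder_zY₂ (Nat.mul_pos hS.p₁.pos hS.q₂.pos)
    (Nat.mul_pos hS.p₂.pos hS.q₁.pos)

theorem order_J₂ : MomentumOrderLE S.region S.J₂ (2 * S.q₁ + 4 * S.p₁) :=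
  ((hasOrder_zJ hS).1.mono (by have := hS.q₁.pos; omega)).const_mul _

theorem order_J₁ : MomentumOrderLE S.region S.J₁ (2 * S.q₁ + 4 * S.p₁ - 1) :=
  ((hasOrder_zJ hS).2.1.mono (by have := hS.q₁.pos; omega)).const_mul _

theorem order_K₂ : MomentumOrderLE S.region S.K₂ (2 * S.p₁ * S.q₂ + 2 * S.p₂ * S.q₁) :=
  ((hasOrder_zK hS).1.mono (by
    have := Nat.mul_pos hS.p₁.pos hS.q₂.pos
    rw [mul_assoc, mul_assoc]
    omega)).const_mul _

theorem order_K₁ : MomentumOrderLE S.region S.K₁ (2 * S.p₁ * S.q₂ + 2 * S.p₂ * S.q₁ - 1) :=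
  ((hasOrder_zK hS).2.1.mono (by
    have := Nat.mul_pos hS.p₁.pos hS.q₂.pos
    rw [mul_assoc, mul_assoc]
    omega)).const_mul _

/-- The quotients recorded in `HasOrder` for `zJ` and `zK`, times the normalising constants, are the
required functions. Their order is two less because `L₂` and `L₃` have order two. -/
theorem exists_isQuotient : ∃ J₀ K₀ : PhaseSpace 3 → ℝ, S.IsQuotient J₀ K₀ ∧
    MomentumOrderLE S.region J₀ (2 * S.q₁ + 4 * S.p₁ - 2) ∧
    MomentumOrderLE S.region K₀ (2 * S.p₁ * S.q₂ + 2 * S.p₂ * S.q₁ - 2) := by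
  obtain ⟨-, -, -, c, hc, hcJ⟩ := hasOrder_zJ hS
  obtain ⟨-, -, -, d, hd, hdK⟩ := hasOrder_zK hS
  have hJ := hc.const_mul (2 * (-1) ^ ((S.q₁ - 1) / 2))
  have hK := hd.const_mul (2 * (-1) ^ ((S.p₁ * S.q₂ + 1) / 2))
  refine ⟨_, _, ⟨hJ.analyticOnNhd S.isOpen_region, hK.analyticOnNhd S.isOpen_region,
    fun x _ => ?_, fun x _ => ?_⟩, hJ.mono ?_, hK.mono ?_⟩
  · simp [J₂, hcJ x, val, D₁]
    ring
  · simp [K₂, hdK x, val, D₂]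
    ring
  · omega
  · rw [mul_assoc, mul_assoc]
    omega

end Orders

/-! ### Symbols at a point where both angles are `π / 4` -/

section Symbols

/-- A point of the region with `sin² = cos² = 1 / 2` for both angles. -/
theorem exists_mem_region (hS : S.HasOddParameters) : ∃ q ∈ S.region, q 0 = 1 ∧
    Real.sin (S.k₁ * q 1) ^ 2 = 1 / 2 ∧ Real.cos (S.k₁ * q 1) = Real.sin (S.k₁ * q 1) ∧
    Real.sin (S.k₂ * q 2) ^ 2 = 1 / 2 ∧ Real.cos (S.k₂ * q 2) = Real.sin (S.k₂ * q 2) := by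
  have h1 : S.k₁ ≠ 0 := div_ne_zero (by exact_mod_cast hS.p₁.pos.ne')
    (by exact_mod_cast hS.q₁.pos.ne')
  have h2 : S.k₂ ≠ 0 := div_ne_zero (by exact_mod_cast hS.p₂.pos.ne')
    (by exact_mod_cast hS.q₂.pos.ne')
  have e1 : S.k₁ * (Real.pi / 4 / S.k₁) = Real.pi / 4 := mul_div_cancel₀ _ h1
  have e2 : S.k₂ * (Real.pi / 4 / S.k₂) = Real.pi / 4 := mul_div_cancel₀ _ h2
  refine ⟨![1, Real.pi / 4 / S.k₁, Real.pi / 4 / S.k₂], ?_, ?_⟩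
  · simp [region, e1, e2]
  · simp [e1, e2, div_pow]
    norm_num

variable {q : Fin 3 → ℝ} (hr : q 0 = 1) (hs₁ : Real.sin (S.k₁ * q 1) ^ 2 = 1 / 2)
  (hc₁ : Real.cos (S.k₁ * q 1) = Real.sin (S.k₁ * q 1))
  (hs₂ : Real.sin (S.k₂ * q 2) ^ 2 = 1 / 2)
  (hc₂ : Real.cos (S.k₂ * q 2) = Real.sin (S.k₂ * q 2)) (a b c : ℝ)

theorem symbol_L₃ :
    Tendsto (fun t : ℝ => S.L₃ (q, t • ![a, b, c]) / t ^ 2) atTop (𝓝 (c ^ 2)) :=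
  tendsto_div_pow_of_eq (b := S.L₃ (q, 0)) two_ne_zero fun t => by
    simp [L₃]
    ring

include hs₁

theorem symbol_L₂ :
    Tendsto (fun t : ℝ => S.L₂ (q, t • ![a, b, c]) / t ^ 2) atTop (𝓝 (b ^ 2 + 2 * c ^ 2)) :=
  tendsto_div_pow_of_eq (b := S.L₂ (q, 0)) two_ne_zero fun t => by
    simp [L₂, L₃, hs₁]
    ring

include hr

theorem symbol_H : Tendsto (fun t : ℝ => S.H (q, t • ![a, b, c]) / t ^ 2) atTop
    (𝓝 (a ^ 2 + b ^ 2 + 2 * c ^ 2)) :=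
  tendsto_div_pow_of_eq (b := S.H (q, 0)) two_ne_zero fun t => by
    simp [H, L₂, L₃, hs₁, hr]
    ring

omit hr
include hc₁

theorem symbol_zX₁ : S.zX₁.HasSymbol q ![a, b, c]
    (⟨-c ^ 2, b⟩ : QuadraticAlgebra ℝ (-(b ^ 2 + 2 * c ^ 2)) 0) 0 := by
  refine ⟨tendsto_div_pow_of_eq (b := S.δ - S.L₃ (q, 0)) two_ne_zero fun t => ?_,
    tendsto_div_pow_of_eq (b := 0) one_ne_zero fun t => ?_⟩
  · simp [zX₁, hc₁, L₃]
    ring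
  · simp [zX₁, hc₁]
    linear_combination 2 * t * b * hs₁

theorem symbol_zY₂ : S.zY₂.HasSymbol q ![a, b, c]
    (⟨b ^ 2 - c ^ 2, 2 * b⟩ : QuadraticAlgebra ℝ (-c ^ 2) 0) 0 := by
  have h0 : Real.sin (S.k₁ * q 1) ≠ 0 := fun h => by norm_num [h] at hs₁
  refine ⟨tendsto_div_pow_of_eq (b := S.zY₂.re (q, 0)) two_ne_zero fun t => ?_,
    tendsto_div_pow_of_eq (b := 0) one_ne_zero fun t => ?_⟩
  · simp [zY₂, hc₁, L₂, L₃, hs₁, h0]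
    ring
  · simp [zY₂, hc₁, h0]
    ring

omit hc₁
include hr

theorem symbol_zY₁ : S.zY₁.HasSymbol q ![a, b, c]
    (⟨2 * (b ^ 2 + 2 * c ^ 2), 2 * a⟩ : QuadraticAlgebra ℝ (-(b ^ 2 + 2 * c ^ 2)) 0) 0 := by
  refine ⟨tendsto_div_pow_of_eq (b := S.zY₁.re (q, 0)) two_ne_zero fun t => ?_,
    tendsto_div_pow_of_eq (b := 0) one_ne_zero fun t => ?_⟩
  · simp [zY₁, L₂, L₃, hs₁, hr]
    ring
  · simp [zY₁]
    ring

omit hs₁ hr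
include hs₂ hc₂

theorem symbol_zX₂ : S.zX₂.HasSymbol q ![a, b, c]
    (⟨0, c⟩ : QuadraticAlgebra ℝ (-c ^ 2) 0) 0 := by
  refine ⟨tendsto_div_pow_of_eq (b := S.γ - S.β) two_ne_zero fun t => ?_,
    tendsto_div_pow_of_eq (b := 0) one_ne_zero fun t => ?_⟩
  · simp [zX₂, hc₂]
  · simp [zX₂, hc₂]
    linear_combination 2 * t * c * hs₂

end Symbols

end KeplerCoulomb

/-! ### Exact orders. -/

/-- The leading behaviour of a quotient with remainder. -/
theorem tendsto_quotient_div_pow {f L g d : ℝ → ℝ} {N : ℕ} (hN : 2 ≤ N) {a l : ℝ} (hl : l ≠ 0)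
    (hf : Tendsto (fun t => f t / t ^ N) atTop (𝓝 a))
    (hL : Tendsto (fun t => L t / t ^ 2) atTop (𝓝 l))
    (hd : Tendsto (fun t => d t / t ^ N) atTop (𝓝 0)) (h : ∀ t, f t = L t * g t + d t) :
    Tendsto (fun t => g t / t ^ (N - 2)) atTop (𝓝 (a / l)) := by
  have h1 := (hf.sub hd).div hL hl
  rw [sub_zero] at h1
  refine h1.congr' ?_
  filter_upwards [hL.eventually_ne hl, eventually_ne_atTop 0] with t ht ht0
  have hL0 : L t ≠ 0 := fun h0 => ht (by rw [h0, zero_div])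
  obtain ⟨N, rfl⟩ := Nat.exists_eq_add_of_le' hN
  simp only [Pi.div_apply, h, Nat.add_sub_cancel]
  field_simp
  ring

/-- Used for `D₁` and `D₂`: each has a constant factor (`α` or `γ - β`) in a place where order two
would be allowed, so the remainder does not affect the leading term. -/
theorem tendsto_mul_pow_mul_pow_div_pow {f g : ℝ → ℝ} {a c : ℝ} {m k N : ℕ} (hm : m ≠ 0)
    (hN : N = 2 * m + 2 * k) (hf : Tendsto (fun t => f t / t ^ 2) atTop (𝓝 0))
    (hg : Tendsto (fun t => g t / t ^ 2) atTop (𝓝 a)) :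
    Tendsto (fun t => c * f t ^ m * g t ^ k / t ^ N) atTop (𝓝 0) := by
  have h := ((hf.pow m).mul (hg.pow k)).const_mul c
  rw [zero_pow hm, zero_mul, mul_zero] at h
  refine h.congr fun t => ?_
  rw [hN, pow_add, pow_mul, pow_mul, div_pow, div_pow, div_mul_div_comm, mul_div_assoc', mul_assoc]

theorem tendsto_const_div_sq (c : ℝ) : Tendsto (fun t : ℝ => c / t ^ 2) atTop (𝓝 0) :=
  tendsto_const_nhds.div_atTop (tendsto_pow_atTop two_ne_zero)

namespace KeplerCoulomb

open QuadraticFunctions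

variable {S : KeplerCoulomb}

theorem hasSymbol_pow_mul_pow {L : PhaseSpace 3 → ℝ} {q p : Fin 3 → ℝ} {l : ℝ}
    (hL : Tendsto (fun t : ℝ => L (q, t • p) / t ^ 2) atTop (𝓝 l))
    {z z' : QuadraticFunctions L} {ζ ζ' : QuadraticAlgebra ℝ (-l) 0} (h : z.HasSymbol q p ζ 0)
    (h' : z'.HasSymbol q p ζ' 0) {m m' : ℕ} (hm : 0 < m) (hm' : 0 < m') :
    (z ^ m * z' ^ m').HasSymbol q p (ζ ^ m * ζ' ^ m') (m + m' - 1) := by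
  obtain ⟨m, rfl⟩ := Nat.exists_eq_succ_of_ne_zero hm.ne'
  obtain ⟨m', rfl⟩ := Nat.exists_eq_succ_of_ne_zero hm'.ne'
  rw [show m.succ + m'.succ - 1 = m + m' + 1 by omega]
  exact HasSymbol.mul hL (h.pow hL m) (h'.pow hL m')

section

variable (hS : S.HasOddParameters) {q : Fin 3 → ℝ} (hr : q 0 = 1)
  (hs₁ : Real.sin (S.k₁ * q 1) ^ 2 = 1 / 2)
  (hc₁ : Real.cos (S.k₁ * q 1) = Real.sin (S.k₁ * q 1))
  (hs₂ : Real.sin (S.k₂ * q 2) ^ 2 = 1 / 2)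
  (hc₂ : Real.cos (S.k₂ * q 2) = Real.sin (S.k₂ * q 2)) (a b c : ℝ)
include hS hs₁ hc₁

section
include hr

theorem symbol_zJ : S.zJ.HasSymbol q ![a, b, c]
    ((⟨-c ^ 2, b⟩ : QuadraticAlgebra ℝ (-(b ^ 2 + 2 * c ^ 2)) 0) ^ S.q₁ *
      ⟨2 * (b ^ 2 + 2 * c ^ 2), 2 * a⟩ ^ (2 * S.p₁)) (S.q₁ + 2 * S.p₁ - 1) :=
  hasSymbol_pow_mul_pow (symbol_L₂ hs₁ a b c) (symbol_zX₁ hs₁ hc₁ a b c)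
    (symbol_zY₁ hr hs₁ a b c) hS.q₁.pos (Nat.mul_pos two_pos hS.p₁.pos)

/-- With only the momentum of `θ₂` present, the symbols of `zX₁` and `zY₁` are both real and
nonzero. -/
theorem symbol_J₂ : ∃ l ≠ 0, Tendsto
    (fun t : ℝ => S.J₂ (q, t • ![0, 0, 1]) / t ^ (2 * S.q₁ + 4 * S.p₁)) atTop (𝓝 l) := by
  have h := (symbol_zJ hS hr hs₁ hc₁ 0 0 1).1.const_mul (2 * (-1) ^ ((S.q₁ - 1) / 2))
  rw [show 2 * (S.q₁ + 2 * S.p₁ - 1) + 2 = 2 * S.q₁ + 4 * S.p₁ by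
    have := hS.q₁.pos; omega] at h
  refine ⟨_, ?_, h.congr fun t => by rw [J₂, mul_div_assoc]⟩
  rw [mul_zero, QuadraticAlgebra.mk_pow_zero, QuadraticAlgebra.mk_pow_zero]
  simp

/-- In this direction the symbol of `zX₁` is purely imaginary and enters with the odd exponent `q₁`,
while that of `zY₁` is real. -/
theorem symbol_J₁ : ∃ l ≠ 0, Tendsto
    (fun t : ℝ => S.J₁ (q, t • ![0, 1, 0]) / t ^ (2 * S.q₁ + 4 * S.p₁ - 1)) atTop (𝓝 l) := by
  have h := (symbol_zJ hS hr hs₁ hc₁ 0 1 0).2.const_mul (-2 * (-1) ^ ((S.q₁ - 1) / 2))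
  rw [show 2 * (S.q₁ + 2 * S.p₁ - 1) + 1 = 2 * S.q₁ + 4 * S.p₁ - 1 by
    have := hS.q₁.pos; omega] at h
  refine ⟨_, ?_, h.congr fun t => by rw [J₁, mul_div_assoc]⟩
  obtain ⟨e, he, heq⟩ := QuadraticAlgebra.mk_zero_pow (l := 1 ^ 2 + 2 * 0 ^ 2) (a := 1) hS.q₁
  have he := he (by norm_num) one_ne_zero
  rw [show -(0 : ℝ) ^ 2 = 0 by norm_num, heq, mul_zero, QuadraticAlgebra.mk_pow_zero]
  simp [he]

end

section
include hs₂ hc₂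

theorem symbol_zK : S.zK.HasSymbol q ![a, b, c]
    ((⟨0, c⟩ : QuadraticAlgebra ℝ (-c ^ 2) 0) ^ (S.p₁ * S.q₂) *
      ⟨b ^ 2 - c ^ 2, 2 * b⟩ ^ (S.p₂ * S.q₁)) (S.p₁ * S.q₂ + S.p₂ * S.q₁ - 1) :=
  hasSymbol_pow_mul_pow (symbol_L₃ a b c) (symbol_zX₂ hs₂ hc₂ a b c)
    (symbol_zY₂ hs₁ hc₁ a b c) (Nat.mul_pos hS.p₁.pos hS.q₂.pos)
    (Nat.mul_pos hS.p₂.pos hS.q₁.pos)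

/-- Equal angular momenta make `b² - c²` vanish, so both symbols are purely imaginary. Two odd
powers of them multiply to something real and nonzero. -/
theorem symbol_K₂ : ∃ l ≠ 0, Tendsto (fun t : ℝ => S.K₂ (q, t • ![0, 1, 1]) /
    t ^ (2 * S.p₁ * S.q₂ + 2 * S.p₂ * S.q₁)) atTop (𝓝 l) := by
  have h := (symbol_zK hS hs₁ hc₁ hs₂ hc₂ 0 1 1).1.const_mul
    (2 * (-1) ^ ((S.p₁ * S.q₂ + 1) / 2))
  rw [show 2 * (S.p₁ * S.q₂ + S.p₂ * S.q₁ - 1) + 2 = 2 * S.p₁ * S.q₂ + 2 * S.p₂ * S.q₁ by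
    have := Nat.mul_pos hS.p₁.pos hS.q₂.pos
    rw [mul_assoc, mul_assoc]
    omega] at h
  refine ⟨_, ?_, h.congr fun t => by rw [K₂, mul_div_assoc]⟩
  obtain ⟨e, he, heq⟩ := QuadraticAlgebra.mk_zero_pow (l := 1 ^ 2) (a := 1) (hS.p₁.mul hS.q₂)
  obtain ⟨e', he', heq'⟩ := QuadraticAlgebra.mk_zero_pow (l := 1 ^ 2) (a := 2 * 1)
    (hS.p₂.mul hS.q₁)
  have he := he (by norm_num) one_ne_zero
  have he' := he' (by norm_num) (by norm_num)
  rw [heq, sub_self, heq']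
  simp [he, he']

/-- Here the symbol of `zX₂` is purely imaginary, with an odd exponent, and that of `zY₂` is real.
-/
theorem symbol_K₁ : ∃ l ≠ 0, Tendsto (fun t : ℝ => S.K₁ (q, t • ![0, 0, 1]) /
    t ^ (2 * S.p₁ * S.q₂ + 2 * S.p₂ * S.q₁ - 1)) atTop (𝓝 l) := by
  have h := (symbol_zK hS hs₁ hc₁ hs₂ hc₂ 0 0 1).2.const_mul
    (2 * (-1) ^ ((S.p₁ * S.q₂ + 1) / 2))
  rw [show 2 * (S.p₁ * S.q₂ + S.p₂ * S.q₁ - 1) + 1 = 2 * S.p₁ * S.q₂ + 2 * S.p₂ * S.q₁ - 1 by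
    have := Nat.mul_pos hS.p₁.pos hS.q₂.pos
    rw [mul_assoc, mul_assoc]
    omega] at h
  refine ⟨_, ?_, h.congr fun t => by rw [K₁, mul_div_assoc]⟩
  obtain ⟨e, he, heq⟩ := QuadraticAlgebra.mk_zero_pow (l := 1 ^ 2) (a := 1) (hS.p₁.mul hS.q₂)
  have he := he (by norm_num) one_ne_zero
  rw [heq, mul_zero, QuadraticAlgebra.mk_pow_zero]
  simp [he]

end

end

theorem hasMomentumOrder_HL (hS : S.HasOddParameters) : HasMomentumOrder S.region S.H 2 ∧
    HasMomentumOrder S.region S.L₂ 2 ∧ HasMomentumOrder S.region S.L₃ 2 := by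
  obtain ⟨q, hq, hr, hs₁, hc₁, hs₂, hc₂⟩ := exists_mem_region hS
  exact ⟨.of_le order_H hq (by norm_num) (symbol_H hr hs₁ 1 0 0),
    .of_le order_L₂ hq (by norm_num) (symbol_L₂ hs₁ 0 1 0),
    .of_le order_L₃ hq (by norm_num) (symbol_L₃ 0 0 1)⟩

theorem hasMomentumOrder_J (hS : S.HasOddParameters) {J₀ K₀ : PhaseSpace 3 → ℝ}
    (hQ : S.IsQuotient J₀ K₀) (hJ : MomentumOrderLE S.region J₀ (2 * S.q₁ + 4 * S.p₁ - 2)) :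
    HasMomentumOrder S.region S.J₂ (2 * S.q₁ + 4 * S.p₁) ∧
    HasMomentumOrder S.region S.J₁ (2 * S.q₁ + 4 * S.p₁ - 1) ∧
    HasMomentumOrder S.region J₀ (2 * S.q₁ + 4 * S.p₁ - 2) := by
  obtain ⟨q, hq, hr, hs₁, hc₁, hs₂, hc₂⟩ := exists_mem_region hS
  obtain ⟨l, hl, h⟩ := symbol_J₂ hS hr hs₁ hc₁
  obtain ⟨l', hl', h'⟩ := symbol_J₁ hS hr hs₁ hc₁
  have hL := symbol_L₂ hs₁ 0 0 1
  refine ⟨.of_le (order_J₂ hS) hq hl h, .of_le (order_J₁ hS) hq hl' h',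
    .of_le hJ hq (div_ne_zero hl (by norm_num : (0 : ℝ) ^ 2 + 2 * 1 ^ 2 ≠ 0))
      (tendsto_quotient_div_pow (by have := hS.q₁.pos; omega) (by norm_num) h hL
        ?_ fun t => hQ.J₂_eq _ hq)⟩
  have hδ : Tendsto (fun t : ℝ => (S.δ - S.L₃ (q, t • ![0, 0, 1])) / t ^ 2) atTop
      (𝓝 (0 - 1 ^ 2)) :=
    ((tendsto_const_div_sq S.δ).sub (symbol_L₃ 0 0 1)).congr fun t => (sub_div _ _ _).symm
  refine (tendsto_mul_pow_mul_pow_div_pow (c := 2 * (-1) ^ ((S.q₁ - 1) / 2)) (m := 2 * S.p₁)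
    (k := S.q₁) (N := 2 * S.q₁ + 4 * S.p₁) (by have := hS.p₁.pos; omega) (by omega) (tendsto_const_div_sq S.α) hδ).congr
    fun t => ?_
  simp [val, D₁]
  ring

theorem hasMomentumOrder_K (hS : S.HasOddParameters) {J₀ K₀ : PhaseSpace 3 → ℝ}
    (hQ : S.IsQuotient J₀ K₀)
    (hK : MomentumOrderLE S.region K₀ (2 * S.p₁ * S.q₂ + 2 * S.p₂ * S.q₁ - 2)) :
    HasMomentumOrder S.region S.K₂ (2 * S.p₁ * S.q₂ + 2 * S.p₂ * S.q₁) ∧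
    HasMomentumOrder S.region S.K₁ (2 * S.p₁ * S.q₂ + 2 * S.p₂ * S.q₁ - 1) ∧
    HasMomentumOrder S.region K₀ (2 * S.p₁ * S.q₂ + 2 * S.p₂ * S.q₁ - 2) := by
  obtain ⟨q, hq, hr, hs₁, hc₁, hs₂, hc₂⟩ := exists_mem_region hS
  obtain ⟨l, hl, h⟩ := symbol_K₂ hS hs₁ hc₁ hs₂ hc₂
  obtain ⟨l', hl', h'⟩ := symbol_K₁ hS hs₁ hc₁ hs₂ hc₂
  have hpos := Nat.mul_pos hS.p₁.pos hS.q₂.pos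
  have hL := symbol_L₃ (S := S) (q := q) 0 1 1
  refine ⟨.of_le (order_K₂ hS) hq hl h, .of_le (order_K₁ hS) hq hl' h',
    .of_le hK hq (div_ne_zero hl (by norm_num : (1 : ℝ) ^ 2 ≠ 0))
      (tendsto_quotient_div_pow (by rw [mul_assoc, mul_assoc]; omega) (by norm_num) h hL
        ?_ fun t => hQ.K₂_eq _ hq)⟩
  have hδ : Tendsto (fun t : ℝ => (S.L₂ (q, t • ![0, 1, 1]) - S.δ) / t ^ 2) atTop
      (𝓝 (1 ^ 2 + 2 * 1 ^ 2 - 0)) :=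
    ((symbol_L₂ hs₁ 0 1 1).sub (tendsto_const_div_sq S.δ)).congr fun t => (sub_div _ _ _).symm
  refine (tendsto_mul_pow_mul_pow_div_pow (c := 2 * (-1) ^ ((S.p₁ * S.q₂ + 1) / 2))
    (m := S.p₁ * S.q₂) (k := S.p₂ * S.q₁) (N := 2 * S.p₁ * S.q₂ + 2 * S.p₂ * S.q₁) hpos.ne'
    (by rw [mul_assoc, mul_assoc])
    (tendsto_const_div_sq (S.γ - S.β)) hδ).congr fun t => ?_
  simp [val, D₂]

end KeplerCoulomb

/-! ### Functional and algebraic independence. -/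

/-- Functionally independent functions are algebraically independent. -/
theorem eq_zero_of_eval_eq_zero {n m : ℕ} {U : Set (PhaseSpace n)} (hU : IsOpen U)
    (hne : U.Nonempty) {G : Fin m → PhaseSpace n → ℝ}
    (hG : ∀ x ∈ U, ∀ i, DifferentiableAt ℝ (G i) x)
    (hind : ∀ x ∈ U, LinearIndependent ℝ (fun i => fderiv ℝ (G i) x))
    {F : MvPolynomial (Fin m) ℝ}
    (hF : ∀ x ∈ U, MvPolynomial.eval (fun i => G i x) F = 0) : F = 0 := by
  suffices h : ∀ (d : ℕ) (F : MvPolynomial (Fin m) ℝ),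
      (∀ e : Fin m →₀ ℕ, d ≤ e.degree → F.coeff e = 0) →
      (∀ x ∈ U, MvPolynomial.eval (fun i => G i x) F = 0) → F = 0 from
    h (F.totalDegree + 1) F (fun e he => MvPolynomial.coeff_eq_zero_of_totalDegree_lt
      (by rw [← Finsupp.degree_apply]; exact he)) hF
  intro d
  induction d with
  | zero => exact fun F h _ => MvPolynomial.ext _ _ fun e => by simpa using h e (Nat.zero_le _)
  | succ d ih =>
    intro F hd hF
    -- Differentiating the relation gives a linear relation among the differentials whose
    -- coefficients are the values of the partial derivatives of `F`. These therefore vanish on `U`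
    -- and, having lower degree, are zero by induction.
    have hp : ∀ i, MvPolynomial.pderiv i F = 0 := by
      intro i
      refine ih _ (fun e he => ?_) fun x hx => ?_
      · rw [MvPolynomial.coeff_pderiv, hd, zero_mul]
        rw [map_add, Finsupp.degree_single]
        omega
      · refine Fintype.linearIndependent_iff.1 (hind x hx) (fun i =>
          MvPolynomial.eval (fun i => G i x) (MvPolynomial.pderiv i F)) ?_ i
        refine ContinuousLinearMap.ext fun w => ?_
        have h0 : (fun y => MvPolynomial.eval (fun i => G i y) F) =ᶠ[𝓝 x] fun _ => 0 := by
          filter_upwards [hU.mem_nhds hx] with y hy using hF y hy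
        have h1 := fderiv_eval (hG x hx) F w
        rw [h0.fderiv_eq] at h1
        simpa [sum_apply] using h1.symm
    have hc : ∀ e : Fin m →₀ ℕ, e ≠ 0 → F.coeff e = 0 := by
      intro e he
      obtain ⟨i, hi⟩ := Finsupp.ne_iff.1 he
      have h1 := MvPolynomial.coeff_pderiv (i := i) F (e - Finsupp.single i 1)
      rw [hp i, tsub_add_cancel_of_le (Finsupp.single_le_iff.2 (Nat.one_le_iff_ne_zero.2 hi)),
        MvPolynomial.coeff_zero] at h1
      exact (mul_eq_zero.1 h1.symm).resolve_right (by positivity)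
    have hC : F = MvPolynomial.C (F.coeff 0) := by
      ext e
      rw [MvPolynomial.coeff_C]
      split_ifs with h
      · rw [h]
      · exact hc e (Ne.symm h)
    obtain ⟨x, hx⟩ := hne
    have h2 := hF x hx
    rw [hC, MvPolynomial.eval_C] at h2
    rw [hC, h2, map_zero]

namespace KeplerCoulomb

variable {S : KeplerCoulomb}

/-- If `J₁` vanished on an open set, so would `J₂`, a multiple of `{L₂, J₁}`, and then `P₁` by the
formula for `J₂²`. -/
theorem generic_J₁ (hS : S.HasOddParameters) : GenericallyNonzero S.phase S.J₁ := by
  intro x hx h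
  have h0 : ∀ᶠ y in 𝓝 x, S.J₁ y = 0 := h.mono fun y hy => not_not.1 hy
  refine generic_P₁ x hx ?_
  filter_upwards [h0.eventually_nhds, S.isOpen_phase.mem_nhds hx] with y hy hys
  have h1 := poisson_L₂_J₁ hS hys
  rw [poisson_congr (EventuallyEq.refl _ _) (g' := fun _ => 0) hy] at h1
  have h2 : S.J₂ y = 0 := by
    have := hS.p₁.pos.ne'
    simpa [poisson_eq_fderiv, this] using h1.symm
  have h3 := J₂_sq hys
  rw [h2, hy.self_of_nhds] at h3
  rw [not_not]
  linarith

theorem generic_K₁ (hS : S.HasOddParameters) : GenericallyNonzero S.phase S.K₁ := by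
  intro x hx h
  have h0 : ∀ᶠ y in 𝓝 x, S.K₁ y = 0 := h.mono fun y hy => not_not.1 hy
  refine generic_P₂ x hx ?_
  filter_upwards [h0.eventually_nhds, S.isOpen_phase.mem_nhds hx] with y hy hys
  have h1 := poisson_L₃_K₁ hS hys
  rw [poisson_congr (EventuallyEq.refl _ _) (g' := fun _ => 0) hy] at h1
  have h2 : S.K₂ y = 0 := by
    have := hS.p₁.pos.ne'
    have := hS.p₂.pos.ne'
    simpa [poisson_eq_fderiv, *] using h1.symm
  have h3 := K₂_sq hys
  rw [h2, hy.self_of_nhds] at h3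
  rw [not_not]
  linarith

theorem generic_momentum (i : Fin 3) : GenericallyNonzero S.phase fun x => x.2 i :=
  genericallyNonzero_of_fibre (fun x _ => analyticAt_momentum x i)
    fun _ _ => ⟨fun _ => 1, one_ne_zero⟩

namespace IsQuotient

variable {J₀ K₀ : PhaseSpace 3 → ℝ} (hQ : S.IsQuotient J₀ K₀) (hS : S.HasOddParameters)
include hQ hS

/-- Evaluated on the Hamiltonian field of `L₂`, a linear relation retains only the `J₀` term, a
multiple of `J₁`; on that of `L₃` only the `K₀` term, a multiple of `K₁`. The momentum directions
then dispose of `H`, `L₂`, `L₃` in this order. -/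
theorem linearIndependent {x : PhaseSpace 3} (hx : x ∈ S.phase)
    (hne : x.2 0 * (x.2 1 * (x.2 2 * (S.J₁ x * S.K₁ x))) ≠ 0) :
    LinearIndependent ℝ (fun i => fderiv ℝ (![S.H, S.L₂, S.L₃, J₀, K₀] i) x) := by
  simp only [mul_ne_zero_iff] at hne
  obtain ⟨h0, h1, h2, hJ, hK⟩ := hne
  rw [Fintype.linearIndependent_iff]
  intro c hc
  have hw : ∀ w, c 0 * fderiv ℝ S.H x w + c 1 * fderiv ℝ S.L₂ x w + c 2 * fderiv ℝ S.L₃ x w +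
      c 3 * fderiv ℝ J₀ x w + c 4 * fderiv ℝ K₀ x w = 0 := by
    intro w
    have := congrArg (fun l => l w) hc
    simpa [Fin.sum_univ_five] using this
  have hp₁ : (S.p₁ : ℝ) ≠ 0 := by exact_mod_cast hS.p₁.pos.ne'
  have hp₂ : (S.p₂ : ℝ) ≠ 0 := by exact_mod_cast hS.p₂.pos.ne'
  have h3 : c 3 = 0 := by
    have h := hw (hamiltonianVector S.L₂ x)
    simp only [← poisson_eq_fderiv] at h
    rw [poisson_antisymm S.L₂ S.H, poisson_H_L₂ hx, poisson_self, poisson_L₂_L₃ hx,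
      hQ.poisson_L₂_J₀ hS x hx, hQ.poisson_L₂_K₀ hS x hx] at h
    simpa [hp₁, hJ] using h
  have h4 : c 4 = 0 := by
    have h := hw (hamiltonianVector S.L₃ x)
    simp only [← poisson_eq_fderiv] at h
    rw [poisson_antisymm S.L₃ S.H, poisson_H_L₃ hx, poisson_self, poisson_L₃_L₂ hx,
      hQ.poisson_L₃_J₀ x hx, hQ.poisson_L₃_K₀ hS x hx] at h
    simpa [hp₁, hp₂, hK] using h
  simp only [h3, h4, zero_mul, add_zero, fderiv_H hx, fderiv_L₂ hx, fderiv_L₃ hx] at hw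
  have k0 : c 0 = 0 := by simpa [h0] using hw (0, Pi.single 0 1)
  have k1 : c 1 = 0 := by simpa [h1, k0] using hw (0, Pi.single 1 1)
  have k2 : c 2 = 0 := by simpa [h2, k0, k1] using hw (0, Pi.single 2 1)
  intro i
  fin_cases i
  exacts [k0, k1, k2, h3, h4]

theorem exists_independent : ∃ U : Set (PhaseSpace 3), IsOpen U ∧ U ⊆ S.phase ∧
    S.phase ⊆ closure U ∧
    ∀ x ∈ U, LinearIndependent ℝ (fun i => fderiv ℝ (![S.H, S.L₂, S.L₃, J₀, K₀] i) x) := by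
  have hc : ∀ i, ContinuousOn (fun x : PhaseSpace 3 => x.2 i) S.phase := fun i =>
    (AnalyticOnNhd.continuousOn fun x _ => analyticAt_momentum x i)
  have hJ : ContinuousOn S.J₁ S.phase := analytic_J₁.continuousOn
  have hK : ContinuousOn S.K₁ S.phase := analytic_K₁.continuousOn
  refine ⟨_, ContinuousOn.isOpen_inter_preimage ((hc 0).mul ((hc 1).mul ((hc 2).mul
    (hJ.mul hK)))) S.isOpen_phase isOpen_compl_singleton, Set.inter_subset_left, ?_,
    fun x hx => hQ.linearIndependent hS hx.1 hx.2⟩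
  exact GenericallyNonzero.subset_closure S.isOpen_phase
    ((generic_momentum 0).mul S.isOpen_phase (hc 0) ((generic_momentum 1).mul S.isOpen_phase (hc 1)
      ((generic_momentum 2).mul S.isOpen_phase (hc 2)
        ((generic_J₁ hS).mul S.isOpen_phase hJ (generic_K₁ hS)))))

omit hS in
theorem differentiableAt {x : PhaseSpace 3} (hx : x ∈ S.phase) (i : Fin 5) :
    DifferentiableAt ℝ (![S.H, S.L₂, S.L₃, J₀, K₀] i) x := by
  fin_cases i
  exacts [differentiableAt_H hx, differentiableAt_L₂ hx, differentiableAt_L₃ hx,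
    (hQ.analytic_J₀ x hx).differentiableAt, (hQ.analytic_K₀ x hx).differentiableAt]

/-- A polynomial relation between the five constants of the motion is trivial. -/
theorem eq_of_eval_eq {F F' : MvPolynomial (Fin 5) ℝ} (h : ∀ x ∈ S.phase,
    MvPolynomial.eval (fun i => ![S.H, S.L₂, S.L₃, J₀, K₀] i x) F =
      MvPolynomial.eval (fun i => ![S.H, S.L₂, S.L₃, J₀, K₀] i x) F') : F = F' := by
  obtain ⟨U, hU, hUs, hcl, hind⟩ := hQ.exists_independent hS
  obtain ⟨q, hq, -⟩ := exists_mem_region hS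
  have hne : U.Nonempty := closure_nonempty_iff.1 ⟨(q, 0), hcl hq⟩
  exact sub_eq_zero.1 (eq_zero_of_eval_eq_zero hU hne
    (fun x hx => hQ.differentiableAt (hUs hx)) hind fun x hx => by
      rw [map_sub, h x (hUs hx), sub_self])

end IsQuotient

end KeplerCoulomb

/-! ### Failure of polynomial closure, and algebraic equations. -/

namespace KeplerCoulomb

open MvPolynomial

variable {S : KeplerCoulomb}

/-- A polynomial in `H, L₂, L₃`, as a polynomial in the five generators `H, L₂, L₃, J₀, K₀`. -/
noncomputable def lift (F : MvPolynomial (Fin 3) ℝ) : MvPolynomial (Fin 5) ℝ :=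
  rename ![0, 1, 2] F

theorem eval_lift (v : Fin 5 → ℝ) (F : MvPolynomial (Fin 3) ℝ) :
    eval v (lift F) = eval ![v 0, v 1, v 2] F := by
  rw [lift, eval_rename]
  congr 2
  ext i
  fin_cases i <;> rfl

theorem eval_lift_generators (J₀ K₀ : PhaseSpace 3 → ℝ) (x : PhaseSpace 3)
    (F : MvPolynomial (Fin 3) ℝ) :
    eval (fun i => ![S.H, S.L₂, S.L₃, J₀, K₀] i x) (lift F) = S.val F x :=
  eval_lift _ F

/-- The expression of `J₁ ^ 2` in terms of the generators. -/
noncomputable def J₁Sq (S : KeplerCoulomb) (E₁ : MvPolynomial (Fin 3) ℝ) : MvPolynomial (Fin 5) ℝ :=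
  -X 1 * X 3 ^ 2 - 2 * lift S.D₁ * X 3 + lift E₁

/-- The expression of `K₁ ^ 2` in terms of the generators. -/
noncomputable def K₁Sq (S : KeplerCoulomb) (E₂ : MvPolynomial (Fin 3) ℝ) : MvPolynomial (Fin 5) ℝ :=
  -X 2 * X 4 ^ 2 - 2 * lift S.D₂ * X 4 + lift E₂

theorem exists_quadratic_neg (b c : ℝ) {a : ℝ} (ha : a < 0) :
    ∃ t : ℝ, a * t ^ 2 + b * t + c < 0 := by
  have h : Tendsto (fun t : ℝ => t * (a * t + b) + c) atTop atBot :=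
    tendsto_atBot_add_const_right _ _ (tendsto_id.atTop_mul_atBot₀
      (tendsto_atBot_add_const_right _ _ (tendsto_id.const_mul_atTop_of_neg ha)))
  obtain ⟨t, ht⟩ := (h.eventually_lt_atBot 0).exists
  exact ⟨t, by linarith⟩

/-- The product of `J₁Sq` and `K₁Sq` takes negative values. -/
theorem exists_eval_neg (S : KeplerCoulomb) (E₁ E₂ : MvPolynomial (Fin 3) ℝ) {l₂ l₃ : ℝ}
    (h₂ : 0 < l₂) (h₃ : l₃ < 0) : ∃ j k : ℝ,
      eval ![0, l₂, l₃, j, k] (S.J₁Sq E₁ * S.K₁Sq E₂) < 0 := by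
  obtain ⟨j, hj⟩ := exists_quadratic_neg (-2 * eval ![0, l₂, l₃] S.D₁) (eval ![0, l₂, l₃] E₁)
    (neg_neg_of_pos h₂)
  obtain ⟨k, hk⟩ := exists_quadratic_neg (2 * eval ![0, l₂, l₃] S.D₂) (-eval ![0, l₂, l₃] E₂) h₃
  refine ⟨j, k, ?_⟩
  rw [map_mul]
  apply mul_neg_of_neg_of_pos
  · simp [J₁Sq, eval_lift]
    linarith
  · simp [K₁Sq, eval_lift]
    linarith

namespace IsQuotient

variable {J₀ K₀ : PhaseSpace 3 → ℝ} (hQ : S.IsQuotient J₀ K₀)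
include hQ

theorem eval_J₁Sq {E₁ : MvPolynomial (Fin 3) ℝ} (hE : X 1 * E₁ = 4 * S.P₁ - S.D₁ ^ 2)
    {x : PhaseSpace 3} (hx : x ∈ S.phase) :
    eval (fun i => ![S.H, S.L₂, S.L₃, J₀, K₀] i x) (S.J₁Sq E₁) = S.J₁ x ^ 2 := by
  simp only [J₁Sq, map_add, map_sub, map_mul, map_neg, map_pow, map_ofNat, eval_X,
    eval_lift_generators, hQ.J₁_sq hE x hx]
  rfl

theorem eval_K₁Sq {E₂ : MvPolynomial (Fin 3) ℝ} (hE : X 2 * E₂ = 4 * S.P₂ - S.D₂ ^ 2)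
    {x : PhaseSpace 3} (hx : x ∈ S.phase) :
    eval (fun i => ![S.H, S.L₂, S.L₃, J₀, K₀] i x) (S.K₁Sq E₂) = S.K₁ x ^ 2 := by
  simp only [K₁Sq, map_add, map_sub, map_mul, map_neg, map_pow, map_ofNat, eval_X,
    eval_lift_generators, hQ.K₁_sq hE x hx]
  rfl

variable (hS : S.HasOddParameters)
include hS

/-- No polynomial multiple of `J₁ K₁` is a polynomial in the generators, if the factor is a
polynomial in `L₂` and `L₃` that does not vanish at some `L₂ > 0 > L₃`. -/
theorem not_isPolynomialIn_mul {B : MvPolynomial (Fin 3) ℝ} {l₂ l₃ : ℝ} (h₂ : 0 < l₂)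
    (h₃ : l₃ < 0) (hB : eval ![0, l₂, l₃] B ≠ 0) :
    ¬ IsPolynomialIn S.region ![S.H, S.L₂, S.L₃, J₀, K₀]
      (fun x => S.val B x * (S.J₁ x * S.K₁ x)) := by
  rintro ⟨A, hA⟩
  obtain ⟨E₁, hE₁⟩ := exists_E₁ S
  obtain ⟨E₂, hE₂⟩ := exists_E₂ S
  obtain ⟨j, k, hneg⟩ := exists_eval_neg S E₁ E₂ h₂ h₃
  -- By algebraic independence this holds between polynomials, so it may be evaluated at real points
  -- that are not values of the generators; there `J₁Sq` may be negative.
  have h : A ^ 2 = lift B ^ 2 * (S.J₁Sq E₁ * S.K₁Sq E₂) := by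
    refine hQ.eq_of_eval_eq hS fun x hx => ?_
    rw [map_pow, ← hA x hx, map_mul, map_pow, map_mul, hQ.eval_J₁Sq hE₁ hx, hQ.eval_K₁Sq hE₂ hx,
      eval_lift_generators]
    ring
  have h' := congrArg (eval ![0, l₂, l₃, j, k]) h
  rw [map_pow, map_mul, map_pow, eval_lift] at h'
  exact (sq_nonneg (eval ![0, l₂, l₃, j, k] A)).not_gt
    (h' ▸ mul_neg_of_pos_of_neg (by positivity) hneg)

theorem not_isPolynomialIn_mul_poisson :
    ¬ IsPolynomialIn S.region ![S.H, S.L₂, S.L₃, J₀, K₀]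
      (fun x => poisson S.L₂ J₀ x * poisson S.L₃ K₀ x) := by
  rintro ⟨A, hA⟩
  have hp₁ : (S.p₁ : ℝ) ≠ 0 := by exact_mod_cast hS.p₁.pos.ne'
  have hp₂ : (S.p₂ : ℝ) ≠ 0 := by exact_mod_cast hS.p₂.pos.ne'
  refine hQ.not_isPolynomialIn_mul hS (B := C (16 * S.p₁ ^ 2 * S.p₂ : ℝ)) one_pos
    neg_one_lt_zero (by rw [eval_C]; positivity) ⟨A, fun x hx => ?_⟩
  refine Eq.trans ?_ (hA x hx)
  beta_reduce
  rw [hQ.poisson_L₂_J₀ hS x hx, hQ.poisson_L₃_K₀ hS x hx]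
  simp only [val, eval_C]
  ring

theorem not_closesPolynomially :
    ¬ ClosesPolynomially S.region ![S.H, S.L₂, S.L₃, J₀, K₀] := by
  intro hcl
  -- The indices select `{K₀, {L₂, J₀}}`.
  obtain ⟨A, hA⟩ := hcl 4 1 3
  have hp₁ : (S.p₁ : ℝ) ≠ 0 := by exact_mod_cast hS.p₁.pos.ne'
  have hp₂ : (S.p₂ : ℝ) ≠ 0 := by exact_mod_cast hS.p₂.pos.ne'
  have hq₁ : (S.q₁ : ℝ) ≠ 0 := by exact_mod_cast hS.q₁.pos.ne'
  -- `B` is the coefficient of `J₁ K₁` in `poisson_J₁_K₀`, up to scale, and the witness below is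
  -- that relation solved for the `J₁ K₁` term. The values `L₂ = |δ| + 1`, `L₃ = -1` keep `L₂ - L₃ +
  -- δ` positive.
  refine hQ.not_isPolynomialIn_mul hS (B := C (16 * S.q₁ * S.p₁ ^ 2 * S.p₂ : ℝ) * X 2 *
    (X 1 - X 2 + C S.δ)) (l₂ := |S.δ| + 1) (by positivity) neg_one_lt_zero ?_
    ⟨lift (X 2 * S.Q) * A + 16 * C ((S.p₁ : ℝ) ^ 2) * (C (S.q₁ * S.p₂ : ℝ) *
      (X 2 * X 4 + lift S.D₂) * (X 1 - X 2 - C S.δ) - lift (S.Q * pderiv 1 S.D₂)) *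
      (X 1 * X 3 + lift S.D₁), fun x hx => ?_⟩
  · have h : |S.δ| + 1 - -1 + S.δ ≠ 0 := by linarith [neg_abs_le S.δ]
    simpa [hp₁, hp₂, hq₁] using h
  · have hev : poisson S.L₂ J₀ =ᶠ[𝓝 x] fun y => 4 * S.p₁ * S.J₁ y := by
      filter_upwards [S.isOpen_phase.mem_nhds hx] with y hy using hQ.poisson_L₂_J₀ hS y hy
    have h1 := hA x hx
    change poisson K₀ (poisson S.L₂ J₀) x = _ at h1
    rw [poisson_congr (EventuallyEq.refl _ _) hev,
      poisson_const_mul_right K₀ _ (analytic_J₁ x hx).differentiableAt, poisson_antisymm] at h1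
    have h2 := hQ.poisson_J₁_K₀ hS hx
    have h3 := hQ.J₂_eq x hx
    have h4 := hQ.K₂_eq x hx
    simp only [map_add, map_sub, map_mul, eval_lift_generators, ← h1, eval_X, eval_C, map_ofNat]
    simp only [val, map_add, map_sub, map_mul, eval_X, eval_C, map_ofNat, Matrix.cons_val] at h2 h3 h4 ⊢
    rw [h3, h4] at h2
    linear_combination (4 * (S.p₁ : ℝ)) * h2

omit hQ hS in
theorem satisfiesPolynomialEquation_of_sq {f : PhaseSpace 3 → ℝ} {F : MvPolynomial (Fin 5) ℝ}
    (h : ∀ x ∈ S.phase, f x ^ 2 = eval (fun i => ![S.H, S.L₂, S.L₃, J₀, K₀] i x) F) :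
    SatisfiesPolynomialEquation S.region ![S.H, S.L₂, S.L₃, J₀, K₀] f := by
  refine ⟨Polynomial.X ^ 2 - Polynomial.C F, ?_, fun x hx => ?_⟩
  · rw [Polynomial.natDegree_X_pow_sub_C]
    exact two_pos
  · rw [Polynomial.eval₂_sub, Polynomial.eval₂_X_pow, Polynomial.eval₂_C, h x hx, sub_self]

omit hQ hS in
/-- A combination of two square roots satisfies a polynomial equation. -/
theorem satisfiesPolynomialEquation_of_linear {f g h : PhaseSpace 3 → ℝ}
    {W A B U V : MvPolynomial (Fin 5) ℝ} (hW : W ≠ 0)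
    (hg : ∀ x ∈ S.phase, g x ^ 2 = eval (fun i => ![S.H, S.L₂, S.L₃, J₀, K₀] i x) U)
    (hh : ∀ x ∈ S.phase, h x ^ 2 = eval (fun i => ![S.H, S.L₂, S.L₃, J₀, K₀] i x) V)
    (hf : ∀ x ∈ S.phase, eval (fun i => ![S.H, S.L₂, S.L₃, J₀, K₀] i x) W * f x =
      eval (fun i => ![S.H, S.L₂, S.L₃, J₀, K₀] i x) A * g x -
        eval (fun i => ![S.H, S.L₂, S.L₃, J₀, K₀] i x) B * h x) :
    SatisfiesPolynomialEquation S.region ![S.H, S.L₂, S.L₃, J₀, K₀] f := by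
  -- In the variable `W f` this is the quartic with roots `± A g ± B h`; it is even in each of `g`
  -- and `h`, so only their squares occur in it.
  refine ⟨Polynomial.C (W ^ 4) * Polynomial.X ^ 4 -
    Polynomial.C (2 * W ^ 2 * (A ^ 2 * U + B ^ 2 * V)) * Polynomial.X ^ 2 +
    Polynomial.C ((A ^ 2 * U - B ^ 2 * V) ^ 2), ?_, fun x hx => ?_⟩
  · refine lt_of_lt_of_le four_pos (Polynomial.le_natDegree_of_ne_zero ?_)
    rw [Polynomial.coeff_add, Polynomial.coeff_sub, Polynomial.coeff_C_mul_X_pow,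
      Polynomial.coeff_C_mul_X_pow, Polynomial.coeff_C]
    simpa using hW
  · simp only [Polynomial.eval₂_add, Polynomial.eval₂_sub, Polynomial.eval₂_mul,
      Polynomial.eval₂_X_pow, Polynomial.eval₂_C]
    simp only [map_mul, map_pow, map_add, map_sub, map_ofNat, ← hg x hx, ← hh x hx]
    have h1 := hf x hx
    generalize eval (fun i => ![S.H, S.L₂, S.L₃, J₀, K₀] i x) W = w at h1 ⊢
    generalize eval (fun i => ![S.H, S.L₂, S.L₃, J₀, K₀] i x) A = a at h1 ⊢
    generalize eval (fun i => ![S.H, S.L₂, S.L₃, J₀, K₀] i x) B = b at h1 ⊢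
    rw [show w ^ 4 * f x ^ 4 - 2 * w ^ 2 * (a ^ 2 * g x ^ 2 + b ^ 2 * h x ^ 2) * f x ^ 2 =
      (w * f x) ^ 4 - 2 * (w * f x) ^ 2 * (a ^ 2 * g x ^ 2 + b ^ 2 * h x ^ 2) by ring, h1]
    ring

theorem satisfiesPolynomialEquation : ∀ f ∈ [poisson S.L₂ J₀, poisson S.L₃ K₀, poisson J₀ K₀],
    SatisfiesPolynomialEquation S.region ![S.H, S.L₂, S.L₃, J₀, K₀] f := by
  obtain ⟨E₁, hE₁⟩ := exists_E₁ S
  obtain ⟨E₂, hE₂⟩ := exists_E₂ S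
  intro f hf
  simp only [List.mem_cons, List.not_mem_nil, or_false] at hf
  obtain rfl | rfl | rfl := hf
  · refine satisfiesPolynomialEquation_of_sq (F := C (16 * S.p₁ ^ 2 : ℝ) * S.J₁Sq E₁)
      fun x hx => ?_
    rw [map_mul, hQ.eval_J₁Sq hE₁ hx, hQ.poisson_L₂_J₀ hS x hx, eval_C]
    ring
  · refine satisfiesPolynomialEquation_of_sq
      (F := C (16 * S.p₁ ^ 2 * S.p₂ ^ 2 : ℝ) * S.K₁Sq E₂) fun x hx => ?_
    rw [map_mul, hQ.eval_K₁Sq hE₂ hx, hQ.poisson_L₃_K₀ hS x hx, eval_C]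
    ring
  · refine satisfiesPolynomialEquation_of_linear (g := S.J₁) (h := S.K₁)
      (W := lift (X 1 * X 2 * S.Q))
      (A := C (4 * S.p₁ : ℝ) * X 1 * (lift (S.Q * pderiv 1 S.D₂) -
        C (S.q₁ * S.p₂ : ℝ) * (X 2 * X 4 + lift S.D₂) * (X 1 - X 2 - C S.δ)))
      (B := C (4 * S.p₁ * S.p₂ : ℝ) * X 2 * (lift (S.Q * pderiv 2 S.D₁) +
        C (S.q₁ : ℝ) * (X 1 * X 3 + lift S.D₁) * (X 1 - X 2 + C S.δ))) ?_
      (fun x hx => (hQ.eval_J₁Sq hE₁ hx).symm) (fun x hx => (hQ.eval_K₁Sq hE₂ hx).symm)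
      fun x hx => ?_
    · intro h
      -- At `L₂ = 1`, `L₃ = -|δ| - 3` the polynomial `Q` is `(|δ| + δ + 4)² - 4 δ`, which is
      -- positive for either sign of `δ`.
      have h1 := congrArg (eval ![0, 1, -|S.δ| - 3, 0, 0]) h
      have h2 := neg_abs_le S.δ
      have h3 := abs_nonneg S.δ
      simp only [eval_lift, Q, map_mul, map_sub, map_pow, eval_X, eval_C, map_ofNat, map_zero,
        Matrix.cons_val, one_mul, mul_one, mul_eq_zero] at h1
      rcases h1 with h1 | h1
      · linarith
      · nlinarith [le_abs_self S.δ]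
    · have h := hQ.poisson_J₀_K₀ hS hx
      simp only [map_mul, map_add, map_sub, eval_lift_generators, eval_C, eval_X]
      simp only [val, map_mul, eval_X, Matrix.cons_val] at h ⊢
      linear_combination h

end IsQuotient

end KeplerCoulomb

/-! ### Rational closure under brackets. -/

section Closure

variable {n m : ℕ} {D : Set (Fin n → ℝ)} {G : Fin m → PhaseSpace n → ℝ} {f g w : PhaseSpace n → ℝ}

namespace IsPolynomialIn

theorem congr (h : IsPolynomialIn D G f) (hfg : ∀ x : PhaseSpace n, x.1 ∈ D → g x = f x) :
    IsPolynomialIn D G g :=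
  h.imp fun _ hF x hx => (hfg x hx).trans (hF x hx)

theorem const (c : ℝ) : IsPolynomialIn D G fun _ => c :=
  ⟨MvPolynomial.C c, fun _ _ => (MvPolynomial.eval_C c).symm⟩

theorem gen (i : Fin m) : IsPolynomialIn D G (G i) :=
  ⟨MvPolynomial.X i, fun _ _ => by rw [MvPolynomial.eval_X]⟩

theorem add (hf : IsPolynomialIn D G f) (hg : IsPolynomialIn D G g) :
    IsPolynomialIn D G fun x => f x + g x := by
  obtain ⟨A, hA⟩ := hf
  obtain ⟨B, hB⟩ := hg
  exact ⟨A + B, fun x hx => by simp only [map_add, hA x hx, hB x hx]⟩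

theorem mul (hf : IsPolynomialIn D G f) (hg : IsPolynomialIn D G g) :
    IsPolynomialIn D G fun x => f x * g x := by
  obtain ⟨A, hA⟩ := hf
  obtain ⟨B, hB⟩ := hg
  exact ⟨A * B, fun x hx => by simp only [map_mul, hA x hx, hB x hx]⟩

theorem pow (hf : IsPolynomialIn D G f) (k : ℕ) : IsPolynomialIn D G fun x => f x ^ k := by
  obtain ⟨A, hA⟩ := hf
  exact ⟨A ^ k, fun x hx => by simp only [map_pow, hA x hx]⟩

theorem const_mul (c : ℝ) (hf : IsPolynomialIn D G f) : IsPolynomialIn D G fun x => c * f x :=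
  (const c).mul hf

theorem sub (hf : IsPolynomialIn D G f) (hg : IsPolynomialIn D G g) :
    IsPolynomialIn D G fun x => f x - g x :=
  (hf.add (hg.const_mul (-1))).congr fun x _ => by ring

theorem sum {ι : Type*} {s : Finset ι} {f : ι → PhaseSpace n → ℝ}
    (h : ∀ i ∈ s, IsPolynomialIn D G (f i)) : IsPolynomialIn D G fun x => ∑ i ∈ s, f i x := by
  choose! A hA using h
  exact ⟨∑ i ∈ s, A i, fun x hx => by
    rw [map_sum]
    exact Finset.sum_congr rfl fun i hi => hA i hi x hx⟩

/-- By the chain rule a bracket of polynomials in the `G i` is linear in the brackets of the `G i`,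
so a single factor `w` suffices. -/
theorem mul_poisson (hD : IsOpen D) (hG : ∀ x : PhaseSpace n, x.1 ∈ D → ∀ i,
      DifferentiableAt ℝ (G i) x)
    (hw : ∀ i j, IsPolynomialIn D G fun x => w x * poisson (G i) (G j) x)
    (hf : IsPolynomialIn D G f) (hg : IsPolynomialIn D G g) :
    IsPolynomialIn D G fun x => w x * poisson f g x := by
  obtain ⟨A, hA⟩ := hf
  obtain ⟨B, hB⟩ := hg
  have h : IsPolynomialIn D G fun x => ∑ i, ∑ j,
      MvPolynomial.eval (fun i => G i x) (MvPolynomial.pderiv i A) *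
        MvPolynomial.eval (fun i => G i x) (MvPolynomial.pderiv j B) *
          (w x * poisson (G i) (G j) x) :=
    sum fun i _ => sum fun j _ => mul (mul ⟨_, fun _ _ => rfl⟩ ⟨_, fun _ _ => rfl⟩) (hw i j)
  refine h.congr fun x hx => ?_
  have hev : ∀ᶠ y : PhaseSpace n in 𝓝 x, y.1 ∈ D :=
    (hD.preimage continuous_fst).mem_nhds hx
  rw [poisson_congr (hev.mono hA) (hev.mono hB), poisson_eval_left (hG x hx), Finset.mul_sum]
  refine Finset.sum_congr rfl fun i _ => ?_
  rw [poisson_eval_right (hG x hx), Finset.mul_sum, Finset.mul_sum]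
  exact Finset.sum_congr rfl fun j _ => by ring

end IsPolynomialIn

/-- Over `D`, some multiple `w ^ k * f` is a polynomial in the `G i`. -/
def IsRationalIn (D : Set (Fin n → ℝ)) (G : Fin m → PhaseSpace n → ℝ) (w f : PhaseSpace n → ℝ) :
    Prop :=
  ∃ k : ℕ, IsPolynomialIn D G fun x => w x ^ k * f x

theorem IsPolynomialIn.isRationalIn (hf : IsPolynomialIn D G f) : IsRationalIn D G w f :=
  ⟨0, hf.congr fun x _ => by ring⟩

namespace IsRationalIn

theorem of_mul (h : IsRationalIn D G w fun x => w x * f x) : IsRationalIn D G w f := by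
  obtain ⟨k, hk⟩ := h
  exact ⟨k + 1, hk.congr fun x _ => by ring⟩

theorem congr (h : IsRationalIn D G w f) (hfg : ∀ x : PhaseSpace n, x.1 ∈ D → g x = f x) :
    IsRationalIn D G w g := by
  obtain ⟨k, hk⟩ := h
  exact ⟨k, hk.congr fun x hx => by rw [hfg x hx]⟩

theorem const_mul (c : ℝ) (hf : IsRationalIn D G w f) : IsRationalIn D G w fun x => c * f x := by
  obtain ⟨k, hk⟩ := hf
  exact ⟨k, (hk.const_mul c).congr fun x _ => by ring⟩

theorem mul (hf : IsRationalIn D G w f) (hg : IsRationalIn D G w g) :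
    IsRationalIn D G w fun x => f x * g x := by
  obtain ⟨k, hk⟩ := hf
  obtain ⟨l, hl⟩ := hg
  exact ⟨k + l, (hk.mul hl).congr fun x _ => by ring⟩

theorem add (hw : IsPolynomialIn D G w) (hf : IsRationalIn D G w f) (hg : IsRationalIn D G w g) :
    IsRationalIn D G w fun x => f x + g x := by
  obtain ⟨k, hk⟩ := hf
  obtain ⟨l, hl⟩ := hg
  exact ⟨k + l, (((hw.pow l).mul hk).add ((hw.pow k).mul hl)).congr fun x _ => by ring⟩

theorem sub (hw : IsPolynomialIn D G w) (hf : IsRationalIn D G w f) (hg : IsRationalIn D G w g) :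
    IsRationalIn D G w fun x => f x - g x :=
  (hf.add hw (hg.const_mul (-1))).congr fun x _ => by ring

/-- If a generating set closes under brackets up to a factor `1 / w`, then the functions that are
polynomials up to powers of `w` are closed under brackets. -/
theorem poisson (hD : IsOpen D) (hG : ∀ x : PhaseSpace n, x.1 ∈ D → ∀ i,
      DifferentiableAt ℝ (G i) x)
    (hwG : ∀ i j, IsPolynomialIn D G fun x => w x * poisson (G i) (G j) x)
    (hw : IsPolynomialIn D G w) (hwd : ∀ x : PhaseSpace n, x.1 ∈ D → DifferentiableAt ℝ w x)
    (hfd : ∀ x : PhaseSpace n, x.1 ∈ D → DifferentiableAt ℝ f x)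
    (hgd : ∀ x : PhaseSpace n, x.1 ∈ D → DifferentiableAt ℝ g x)
    (hf : IsRationalIn D G w f) (hg : IsRationalIn D G w g) :
    IsRationalIn D G w (poisson f g) := by
  -- Induction on the power of `w` needed for the first argument, through `w {f, b} = {w f, b} - f
  -- {w, b}`. The second argument is treated in the same way afterwards.
  have step : ∀ (k : ℕ) {f b : PhaseSpace n → ℝ},
      (∀ x : PhaseSpace n, x.1 ∈ D → DifferentiableAt ℝ f x) → IsPolynomialIn D G b →
      IsPolynomialIn D G (fun x => w x ^ k * f x) → IsRationalIn D G w (_root_.poisson f b) := by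
    intro k
    induction k with
    | zero =>
      intro f b _ hb hf
      exact of_mul (IsPolynomialIn.mul_poisson hD hG hwG
        (hf.congr fun x _ => by ring) hb).isRationalIn
    | succ k ih =>
      intro f b hfd hb hf
      have hb' : IsRationalIn D G w (_root_.poisson w b) :=
        of_mul (IsPolynomialIn.mul_poisson hD hG hwG hw hb).isRationalIn
      have h1 := ih (f := fun x => w x * f x) (fun x hx => (hwd x hx).fun_mul (hfd x hx)) hb
        (hf.congr fun x _ => by ring)
      refine of_mul ((h1.sub hw (mul ⟨k + 1, hf⟩ hb')).congr fun x hx => ?_)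
      rw [poisson_mul_left b (hwd x hx) (hfd x hx)]
      ring
  obtain ⟨l, hl⟩ := hg
  induction l generalizing g with
  | zero =>
    obtain ⟨k, hk⟩ := hf
    exact step k hfd (hl.congr fun x _ => by ring) hk
  | succ l ih =>
    have hw' : IsRationalIn D G w (_root_.poisson f w) := by
      obtain ⟨k, hk⟩ := hf
      exact step k hfd hw hk
    have h1 := ih (g := fun x => w x * g x) (fun x hx => (hwd x hx).fun_mul (hgd x hx))
      (hl.congr fun x _ => by ring)
    refine of_mul ((h1.sub hw (mul ⟨l + 1, hl⟩ hw')).congr fun x hx => ?_)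
    rw [poisson_mul_right f (hwd x hx) (hgd x hx)]
    ring

/-- The symmetry algebra generated by some of the `G i` consists of functions that are polynomials
up to powers of `w`. -/
theorem of_symmetryAlgebra (hD : IsOpen D)
    (hG : ∀ i, AnalyticOnNhd ℝ (G i) {x : PhaseSpace n | x.1 ∈ D})
    (hwG : ∀ i j, IsPolynomialIn D G fun x => w x * _root_.poisson (G i) (G j) x)
    (hw : IsPolynomialIn D G w) (hwd : ∀ x : PhaseSpace n, x.1 ∈ D → DifferentiableAt ℝ w x)
    {l : ℕ} {G' : Fin l → PhaseSpace n → ℝ} (hG' : ∀ i, ∃ j, G' i = G j)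
    (hf : SymmetryAlgebra G' f) :
    AnalyticOnNhd ℝ f {x : PhaseSpace n | x.1 ∈ D} ∧ IsRationalIn D G w f := by
  induction hf with
  | gen i =>
    obtain ⟨j, hj⟩ := hG' i
    rw [hj]
    exact ⟨hG j, (IsPolynomialIn.gen j).isRationalIn⟩
  | smul c _ ih => exact ⟨fun x hx => analyticAt_const.mul (ih.1 x hx), ih.2.const_mul c⟩
  | add _ _ ihf ihg => exact ⟨ihf.1.add ihg.1, ihf.2.add hw ihg.2⟩
  | mul _ _ ihf ihg => exact ⟨ihf.1.mul ihg.1, ihf.2.mul ihg.2⟩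
  | bracket _ _ ihf ihg =>
    exact ⟨ihf.1.poisson ihg.1, poisson hD (fun x hx i => (hG i x hx).differentiableAt) hwG hw hwd
      (fun x hx => (ihf.1 x hx).differentiableAt) (fun x hx => (ihg.1 x hx).differentiableAt)
      ihf.2 ihg.2⟩

end IsRationalIn

end Closure

/-! ### Rational closure of the symmetry algebra. -/

namespace KeplerCoulomb

variable {S : KeplerCoulomb}

/-- The five generators, with the two commutators `{L₂, J₀}` and `{L₃, K₀}` adjoined. -/
noncomputable abbrev extendedGenerators (S : KeplerCoulomb) (J₀ K₀ : PhaseSpace 3 → ℝ) :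
    Fin 7 → PhaseSpace 3 → ℝ :=
  ![S.H, S.L₂, S.L₃, J₀, K₀, poisson S.L₂ J₀, poisson S.L₃ K₀]

theorem isPolynomialIn_val (J₀ K₀ : PhaseSpace 3 → ℝ) (F : MvPolynomial (Fin 3) ℝ) :
    IsPolynomialIn S.region (S.extendedGenerators J₀ K₀) (S.val F) :=
  ⟨MvPolynomial.rename ![0, 1, 2] F, fun x _ => by
    rw [val, MvPolynomial.eval_rename]
    congr 2
    ext i
    fin_cases i <;> rfl⟩

namespace IsQuotient

variable {J₀ K₀ : PhaseSpace 3 → ℝ} (hQ : S.IsQuotient J₀ K₀) (hS : S.HasOddParameters)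
include hQ

theorem isPolynomialIn_J₂ : IsPolynomialIn S.region (S.extendedGenerators J₀ K₀) S.J₂ :=
  (((IsPolynomialIn.gen 1).mul (.gen 3)).add (isPolynomialIn_val J₀ K₀ S.D₁)).congr
    hQ.J₂_eq

theorem isPolynomialIn_K₂ : IsPolynomialIn S.region (S.extendedGenerators J₀ K₀) S.K₂ :=
  (((IsPolynomialIn.gen 2).mul (.gen 4)).add (isPolynomialIn_val J₀ K₀ S.D₂)).congr
    hQ.K₂_eq

include hS

theorem isPolynomialIn_J₁ : IsPolynomialIn S.region (S.extendedGenerators J₀ K₀) S.J₁ :=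
  ((IsPolynomialIn.gen 5).const_mul (4 * S.p₁ : ℝ)⁻¹).congr fun x hx => by
    have hp₁ : (S.p₁ : ℝ) ≠ 0 := by exact_mod_cast hS.p₁.pos.ne'
    change _ = _ * poisson S.L₂ J₀ x
    rw [hQ.poisson_L₂_J₀ hS x hx, inv_mul_cancel_left₀ (by positivity)]

theorem isPolynomialIn_K₁ : IsPolynomialIn S.region (S.extendedGenerators J₀ K₀) S.K₁ :=
  ((IsPolynomialIn.gen 6).const_mul (4 * S.p₁ * S.p₂ : ℝ)⁻¹).congr fun x hx => by
    have hp₁ : (S.p₁ : ℝ) ≠ 0 := by exact_mod_cast hS.p₁.pos.ne'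
    have hp₂ : (S.p₂ : ℝ) ≠ 0 := by exact_mod_cast hS.p₂.pos.ne'
    change _ = _ * poisson S.L₃ K₀ x
    rw [hQ.poisson_L₃_K₀ hS x hx, inv_mul_cancel_left₀ (by positivity)]

theorem poisson_poisson_L₂_J₀ {x : PhaseSpace 3} (hx : x ∈ S.phase) (f : PhaseSpace 3 → ℝ) :
    poisson f (poisson S.L₂ J₀) x = 4 * S.p₁ * poisson f S.J₁ x := by
  have hev : poisson S.L₂ J₀ =ᶠ[𝓝 x] fun y => 4 * S.p₁ * S.J₁ y := by
    filter_upwards [S.isOpen_phase.mem_nhds hx] with y hy using hQ.poisson_L₂_J₀ hS y hy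
  rw [poisson_congr (EventuallyEq.refl _ _) hev,
    poisson_const_mul_right f _ (analytic_J₁ x hx).differentiableAt]

theorem poisson_poisson_L₃_K₀ {x : PhaseSpace 3} (hx : x ∈ S.phase) (f : PhaseSpace 3 → ℝ) :
    poisson f (poisson S.L₃ K₀) x = 4 * S.p₁ * S.p₂ * poisson f S.K₁ x := by
  have hev : poisson S.L₃ K₀ =ᶠ[𝓝 x] fun y => 4 * S.p₁ * S.p₂ * S.K₁ y := by
    filter_upwards [S.isOpen_phase.mem_nhds hx] with y hy using hQ.poisson_L₃_K₀ hS y hy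
  rw [poisson_congr (EventuallyEq.refl _ _) hev,
    poisson_const_mul_right f _ (analytic_K₁ x hx).differentiableAt]

/-- Up to the factor `L₂ L₃ Q`, the extended generators close under brackets. -/
theorem isPolynomialIn_mul_poisson (i j : Fin 7) :
    IsPolynomialIn S.region (S.extendedGenerators J₀ K₀) fun x => S.L₂ x * S.L₃ x * S.val S.Q x *
      poisson (S.extendedGenerators J₀ K₀ i) (S.extendedGenerators J₀ K₀ j) x := by
  have L₂ : IsPolynomialIn S.region (S.extendedGenerators J₀ K₀) S.L₂ := .gen 1
  have L₃ : IsPolynomialIn S.region (S.extendedGenerators J₀ K₀) S.L₃ := .gen 2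
  have hJ₀ : IsPolynomialIn S.region (S.extendedGenerators J₀ K₀) J₀ := .gen 3
  have hK₀ : IsPolynomialIn S.region (S.extendedGenerators J₀ K₀) K₀ := .gen 4
  have J₁ := hQ.isPolynomialIn_J₁ hS
  have K₁ := hQ.isPolynomialIn_K₁ hS
  have J₂ := hQ.isPolynomialIn_J₂
  have K₂ := hQ.isPolynomialIn_K₂
  have V := isPolynomialIn_val (S := S) J₀ K₀
  have hm := (L₂.sub L₃).sub (.const S.δ)
  have hp := (L₂.sub L₃).add (.const S.δ)
  have hw := (L₂.mul L₃).mul (V S.Q)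
  have zero : ∀ f g : PhaseSpace 3 → ℝ, (∀ x ∈ S.phase, poisson f g x = 0) →
      IsPolynomialIn S.region (S.extendedGenerators J₀ K₀)
        fun x => S.L₂ x * S.L₃ x * S.val S.Q x * poisson f g x := fun f g h =>
    (IsPolynomialIn.const 0).congr fun x hx => by rw [h x hx, mul_zero]
  suffices h : ∀ i j : Fin 7, i < j → IsPolynomialIn S.region (S.extendedGenerators J₀ K₀)
      fun x => S.L₂ x * S.L₃ x * S.val S.Q x *
        poisson (S.extendedGenerators J₀ K₀ i) (S.extendedGenerators J₀ K₀ j) x by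
    rcases lt_trichotomy i j with hij | rfl | hij
    · exact h i j hij
    · exact zero _ _ fun x _ => poisson_self _ _
    · exact ((h j i hij).const_mul (-1)).congr fun x _ => by
        rw [poisson_antisymm]
        ring
  intro i j hij
  fin_cases i <;> fin_cases j <;> first | exact absurd hij (by decide) | skip
  · exact zero S.H S.L₂ fun x hx => poisson_H_L₂ hx
  · exact zero S.H S.L₃ fun x hx => poisson_H_L₃ hx
  · exact zero S.H J₀ (hQ.poisson_H_J₀ hS)
  · exact zero S.H K₀ (hQ.poisson_H_K₀ hS)
  · exact zero S.H (poisson S.L₂ J₀) fun x hx => by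
      rw [hQ.poisson_poisson_L₂_J₀ hS hx, poisson_H_J₁ hS hx, mul_zero]
  · exact zero S.H (poisson S.L₃ K₀) fun x hx => by
      rw [hQ.poisson_poisson_L₃_K₀ hS hx, poisson_H_K₁ hS hx, mul_zero]
  · exact zero S.L₂ S.L₃ fun x hx => poisson_L₂_L₃ hx
  · exact hw.mul (.gen 5)
  · exact zero S.L₂ K₀ (hQ.poisson_L₂_K₀ hS)
  · refine (hw.mul (J₂.const_mul (-16 * S.p₁ ^ 2))).congr fun x hx => ?_
    change _ * poisson S.L₂ (poisson S.L₂ J₀) x = _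
    rw [hQ.poisson_poisson_L₂_J₀ hS hx, poisson_L₂_J₁ hS hx]
    ring
  · exact zero S.L₂ (poisson S.L₃ K₀) fun x hx => by
      rw [hQ.poisson_poisson_L₃_K₀ hS hx, poisson_L₂_K₁ hS hx, mul_zero]
  · exact zero S.L₃ J₀ hQ.poisson_L₃_J₀
  · exact hw.mul (.gen 6)
  · exact zero S.L₃ (poisson S.L₂ J₀) fun x hx => by
      rw [hQ.poisson_poisson_L₂_J₀ hS hx, poisson_L₃_J₁ hx, mul_zero]
  · refine (hw.mul (K₂.const_mul (-16 * S.p₁ ^ 2 * S.p₂ ^ 2))).congr fun x hx => ?_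
    change _ * poisson S.L₃ (poisson S.L₃ K₀) x = _
    rw [hQ.poisson_poisson_L₃_K₀ hS hx, poisson_L₃_K₁ hS hx]
    ring
  · refine (((L₂.mul (((V S.Q).mul (V (MvPolynomial.pderiv 1 S.D₂))).sub
      ((K₂.const_mul (S.q₁ * S.p₂)).mul hm))).mul (J₁.const_mul (4 * S.p₁))).sub
      ((L₃.mul (((V S.Q).mul (V (MvPolynomial.pderiv 2 S.D₁))).add
      ((J₂.const_mul S.q₁).mul hp))).mul (K₁.const_mul (4 * S.p₁ * S.p₂)))).congr
      fun x hx => ?_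
    change _ * poisson J₀ K₀ x = _
    rw [hQ.poisson_J₀_K₀ hS hx, hQ.J₂_eq x hx, hQ.K₂_eq x hx]
  -- From here on each relation carries only part of the factor `L₂ L₃ Q`; the missing part is
  -- multiplied in.
  · refine ((L₃.mul (V S.Q)).mul ((((J₁.pow 2).const_mul (8 * S.p₁ ^ 2)).sub
      ((V (MvPolynomial.pderiv 1 S.P₁)).const_mul (32 * S.p₁ ^ 2))).add
      ((hJ₀.mul J₂).const_mul (16 * S.p₁ ^ 2)))).congr fun x hx => ?_
    change _ * poisson J₀ (poisson S.L₂ J₀) x = _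
    rw [hQ.poisson_poisson_L₂_J₀ hS hx]
    linear_combination S.L₃ x * S.val S.Q x * 4 * S.p₁ * hQ.poisson_J₀_J₁ hS hx
  · refine (L₃.mul (((((J₂.mul K₂).mul hp).sub (((L₂.mul J₁).mul K₁).mul hm)).const_mul
      (16 * S.q₁ * S.p₁ ^ 2 * S.p₂ ^ 2)).add ((((V S.Q).mul (V (MvPolynomial.pderiv 2 S.D₁))).mul
      K₂).const_mul (16 * S.p₁ ^ 2 * S.p₂ ^ 2)))).congr fun x hx => ?_
    change _ * poisson J₀ (poisson S.L₃ K₀) x = _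
    rw [hQ.poisson_poisson_L₃_K₀ hS hx]
    linear_combination S.L₃ x * 4 * S.p₁ * S.p₂ * hQ.poisson_J₀_K₁ hS hx
  · refine (L₂.mul (((((V S.Q).mul (V (MvPolynomial.pderiv 1 S.D₂))).mul J₂).const_mul
      (16 * S.p₁ ^ 2)).sub ((((J₂.mul K₂).mul hm).sub (((L₃.mul J₁).mul K₁).mul hp)).const_mul
      (16 * S.q₁ * S.p₁ ^ 2 * S.p₂)))).congr fun x hx => ?_
    change _ * poisson K₀ (poisson S.L₂ J₀) x = _
    rw [hQ.poisson_poisson_L₂_J₀ hS hx, poisson_antisymm]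
    linear_combination -S.L₂ x * 4 * S.p₁ * hQ.poisson_J₁_K₀ hS hx
  · refine ((L₂.mul (V S.Q)).mul ((((K₁.pow 2).const_mul (8 * S.p₁ ^ 2 * S.p₂ ^ 2)).sub
      ((V (MvPolynomial.pderiv 2 S.P₂)).const_mul (32 * S.p₁ ^ 2 * S.p₂ ^ 2))).add
      ((hK₀.mul K₂).const_mul (16 * S.p₁ ^ 2 * S.p₂ ^ 2)))).congr fun x hx => ?_
    change _ * poisson K₀ (poisson S.L₃ K₀) x = _
    rw [hQ.poisson_poisson_L₃_K₀ hS hx]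
    linear_combination S.L₂ x * S.val S.Q x * 4 * S.p₁ * S.p₂ * hQ.poisson_K₀_K₁ hS hx
  · refine ((L₂.mul L₃).mul ((((J₂.mul K₁).mul hm).add ((J₁.mul K₂).mul hp)).const_mul
      (64 * S.q₁ * S.p₁ ^ 3 * S.p₂ ^ 2))).congr fun x hx => ?_
    change _ * poisson (poisson S.L₂ J₀) (poisson S.L₃ K₀) x = _
    rw [hQ.poisson_poisson_L₃_K₀ hS hx, poisson_antisymm, hQ.poisson_poisson_L₂_J₀ hS hx,
      poisson_antisymm]
    have h := poisson_J_K hS hx 0 0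
    simp [Fin.rev] at h
    linear_combination 16 * S.L₂ x * S.L₃ x * S.p₁ ^ 2 * S.p₂ * h

theorem exists_isPolynomialIn_of_symmetryAlgebra {f : PhaseSpace 3 → ℝ}
    (hf : SymmetryAlgebra ![S.H, S.L₂, S.L₃, J₀, K₀] f) :
    ∃ m : ℕ, IsPolynomialIn S.region (S.extendedGenerators J₀ K₀)
      fun x => (S.L₂ x * S.L₃ x * S.val S.Q x) ^ m * f x := by
  have hw : AnalyticOnNhd ℝ (fun x => S.L₂ x * S.L₃ x * S.val S.Q x) S.phase := fun x hx =>
    ((analytic_L₂ x hx).fun_mul (analytic_L₃ x hx)).fun_mul (analytic_val S.Q x hx)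
  refine (IsRationalIn.of_symmetryAlgebra S.isOpen_region (fun i => ?_)
    (hQ.isPolynomialIn_mul_poisson hS)
    (((IsPolynomialIn.gen 1).mul (.gen 2)).mul (isPolynomialIn_val J₀ K₀ S.Q))
    (fun x hx => (hw x hx).differentiableAt)
    (fun i => ⟨Fin.castLE (by norm_num) i, by fin_cases i <;> rfl⟩) hf).2
  fin_cases i
  exacts [analytic_H, analytic_L₂, analytic_L₃, hQ.analytic_J₀, hQ.analytic_K₀,
    analytic_L₂.poisson hQ.analytic_J₀, analytic_L₃.poisson hQ.analytic_K₀]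

end IsQuotient

end KeplerCoulomb

theorem mainTheorem11 (S : KeplerCoulomb)
    (hp₁ : Odd S.p₁) (hq₁ : Odd S.q₁) (hp₂ : Odd S.p₂) (hq₂ : Odd S.q₂)
    (hk₁ : Nat.Coprime S.p₁ S.q₁) (hk₂ : Nat.Coprime S.p₂ S.q₂) :
    ∃ J₁ J₂ K₁ K₂ J₀ K₀ R₁ R₂ R₃ : PhaseSpace 3 → ℝ,
      -- the definition of the functions
      (∀ x : PhaseSpace 3, x.1 ∈ S.region → ∀ s t : ℂ,
        s ^ 2 = (S.L₂ x : ℂ) → t ^ 2 = (S.L₃ x : ℂ) →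
          s * J₁ x = S.Jminus s x + S.Jplus s x ∧
          Complex.I * J₂ x = S.Jminus s x - S.Jplus s x ∧
          t * K₁ x = S.Kminus t x + S.Kplus t x ∧
          Complex.I * K₂ x = S.Kminus t x - S.Kplus t x ∧
          S.Jplus s x * S.Jminus s x = (S.val S.P₁ x : ℂ) ∧
          S.Kplus t x * S.Kminus t x = (S.val S.P₂ x : ℂ)) ∧
      (∀ x : PhaseSpace 3, x.1 ∈ S.region →
        J₂ x = S.L₂ x * J₀ x + S.val S.D₁ x ∧ K₂ x = S.L₃ x * K₀ x + S.val S.D₂ x) ∧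
      R₁ = poisson S.L₂ J₀ ∧ R₂ = poisson S.L₃ K₀ ∧ R₃ = poisson J₀ K₀ ∧
      -- polynomials in the momenta, and their orders
      HasMomentumOrder S.region S.H 2 ∧
      HasMomentumOrder S.region S.L₂ 2 ∧
      HasMomentumOrder S.region S.L₃ 2 ∧
      HasMomentumOrder S.region J₂ (2 * S.q₁ + 4 * S.p₁) ∧
      HasMomentumOrder S.region J₁ (2 * S.q₁ + 4 * S.p₁ - 1) ∧
      HasMomentumOrder S.region J₀ (2 * S.q₁ + 4 * S.p₁ - 2) ∧
      HasMomentumOrder S.region K₂ (2 * S.p₁ * S.q₂ + 2 * S.p₂ * S.q₁) ∧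
      HasMomentumOrder S.region K₁ (2 * S.p₁ * S.q₂ + 2 * S.p₂ * S.q₁ - 1) ∧
      HasMomentumOrder S.region K₀ (2 * S.p₁ * S.q₂ + 2 * S.p₂ * S.q₁ - 2) ∧
      -- constants of the motion, involution, superintegrability
      (∀ f ∈ [S.L₂, S.L₃, J₁, J₂, K₁, K₂, J₀, K₀], IsConstantOfMotion S.region S.H f) ∧
      IsConstantOfMotion S.region S.L₂ S.L₃ ∧
      MaximallySuperintegrableBy S.region S.H ![S.H, S.L₂, S.L₃, J₀, K₀] ∧
      -- structure relations
      (∀ x : PhaseSpace 3, x.1 ∈ S.region → ∀ j k : Fin 2,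
        S.val S.Q x * poisson (![J₁, J₂] j) (![K₁, K₂] k) x =
          4 * S.q₁ * S.p₁ * S.p₂ *
            (![J₁, J₂] j.rev x * ![K₁, K₂] k x * (-S.L₂ x) ^ (j : ℕ) *
                (S.L₂ x - S.L₃ x - S.δ) +
              ![J₁, J₂] j x * ![K₁, K₂] k.rev x * (-S.L₃ x) ^ (k : ℕ) *
                (S.L₂ x - S.L₃ x + S.δ))) ∧
      (∀ x : PhaseSpace 3, x.1 ∈ S.region →
        poisson S.L₂ J₂ x = 4 * S.p₁ * S.L₂ x * J₁ x ∧
        poisson S.L₂ J₁ x = -4 * S.p₁ * J₂ x ∧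
        poisson S.L₃ J₁ x = 0 ∧ poisson S.L₃ J₂ x = 0 ∧ poisson S.L₃ J₀ x = 0 ∧
        poisson S.L₃ K₂ x = 4 * S.p₁ * S.p₂ * S.L₃ x * K₁ x ∧
        poisson S.L₃ K₁ x = -4 * S.p₁ * S.p₂ * K₂ x ∧
        poisson S.L₂ K₁ x = 0 ∧ poisson S.L₂ K₂ x = 0 ∧ poisson S.L₂ K₀ x = 0 ∧
        J₂ x ^ 2 = -S.L₂ x * J₁ x ^ 2 + 4 * S.val S.P₁ x ∧
        K₂ x ^ 2 = -S.L₃ x * K₁ x ^ 2 + 4 * S.val S.P₂ x ∧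
        poisson J₁ J₂ x =
          -2 * S.p₁ * J₁ x ^ 2 + 8 * S.p₁ * S.val (MvPolynomial.pderiv 1 S.P₁) x ∧
        poisson K₁ K₂ x =
          -2 * S.p₁ * S.p₂ * K₁ x ^ 2 +
            8 * S.p₁ * S.p₂ * S.val (MvPolynomial.pderiv 2 S.P₂) x ∧
        R₁ x = 4 * S.p₁ * J₁ x ∧ R₂ x = 4 * S.p₁ * S.p₂ * K₁ x ∧
        S.L₂ x * S.L₃ x * S.val S.Q x * R₃ x =
          S.L₂ x * (S.val S.Q x * S.val (MvPolynomial.pderiv 1 S.D₂) x -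
              S.q₁ * S.p₂ * (S.L₃ x * K₀ x + S.val S.D₂ x) * (S.L₂ x - S.L₃ x - S.δ)) * R₁ x -
          S.L₃ x * (S.val S.Q x * S.val (MvPolynomial.pderiv 2 S.D₁) x +
              S.q₁ * (S.L₂ x * J₀ x + S.val S.D₁ x) * (S.L₂ x - S.L₃ x + S.δ)) * R₂ x) ∧
      (∃ E₁ E₂ : MvPolynomial (Fin 3) ℝ,
        MvPolynomial.X 1 * E₁ = 4 * S.P₁ - S.D₁ ^ 2 ∧
        MvPolynomial.X 2 * E₂ = 4 * S.P₂ - S.D₂ ^ 2 ∧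
        ∀ x : PhaseSpace 3, x.1 ∈ S.region →
          R₁ x ^ 2 = 16 * S.p₁ ^ 2 *
            (-S.L₂ x * J₀ x ^ 2 - 2 * S.val S.D₁ x * J₀ x + S.val E₁ x) ∧
          R₂ x ^ 2 = 16 * S.p₁ ^ 2 * S.p₂ ^ 2 *
            (-S.L₃ x * K₀ x ^ 2 - 2 * S.val S.D₂ x * K₀ x + S.val E₂ x)) ∧
      -- the symmetry algebra does not close polynomially
      ¬ IsPolynomialIn S.region ![S.H, S.L₂, S.L₃, J₀, K₀] (fun x => R₁ x * R₂ x) ∧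
      ¬ ClosesPolynomially S.region ![S.H, S.L₂, S.L₃, J₀, K₀] ∧
      -- it closes rationally
      (∀ f : PhaseSpace 3 → ℝ, SymmetryAlgebra ![S.H, S.L₂, S.L₃, J₀, K₀] f →
        ∃ m : ℕ, IsPolynomialIn S.region ![S.H, S.L₂, S.L₃, J₀, K₀, R₁, R₂]
          (fun x => (S.L₂ x * S.L₃ x * S.val S.Q x) ^ m * f x)) ∧
      (∀ f ∈ [R₁, R₂, R₃],
        SatisfiesPolynomialEquation S.region ![S.H, S.L₂, S.L₃, J₀, K₀] f) := by
  have hS : S.HasOddParameters := ⟨hp₁, hq₁, hp₂, hq₂⟩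
  obtain ⟨J₀, K₀, hQ, hJ, hK⟩ := S.exists_isQuotient hS
  obtain ⟨oH, oL₂, oL₃⟩ := KeplerCoulomb.hasMomentumOrder_HL hS
  obtain ⟨oJ₂, oJ₁, oJ₀⟩ := KeplerCoulomb.hasMomentumOrder_J hS hQ hJ
  obtain ⟨oK₂, oK₁, oK₀⟩ := KeplerCoulomb.hasMomentumOrder_K hS hQ hK
  obtain ⟨E₁, hE₁⟩ := S.exists_E₁
  obtain ⟨E₂, hE₂⟩ := S.exists_E₂
  refine ⟨S.J₁, S.J₂, S.K₁, S.K₂, J₀, K₀, _, _, _,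
    fun x hx s t hs ht => KeplerCoulomb.ladder_relations hS hx hs ht,
    fun x hx => ⟨hQ.J₂_eq x hx, hQ.K₂_eq x hx⟩, rfl, rfl, rfl,
    oH, oL₂, oL₃, oJ₂, oJ₁, oJ₀, oK₂, oK₁, oK₀, ?_,
    fun x hx => KeplerCoulomb.poisson_L₂_L₃ hx, ⟨?_, ?_, hQ.exists_independent hS⟩,
    fun x hx => KeplerCoulomb.poisson_J_K hS hx, fun x hx => ⟨
      KeplerCoulomb.poisson_L₂_J₂ hS hx, KeplerCoulomb.poisson_L₂_J₁ hS hx,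
      KeplerCoulomb.poisson_L₃_J₁ hx, KeplerCoulomb.poisson_L₃_J₂ hx, hQ.poisson_L₃_J₀ x hx,
      KeplerCoulomb.poisson_L₃_K₂ hS hx, KeplerCoulomb.poisson_L₃_K₁ hS hx,
      KeplerCoulomb.poisson_L₂_K₁ hS hx, KeplerCoulomb.poisson_L₂_K₂ hS hx,
      hQ.poisson_L₂_K₀ hS x hx, KeplerCoulomb.J₂_sq hx, KeplerCoulomb.K₂_sq hx,
      KeplerCoulomb.poisson_J₁_J₂ hS x hx, KeplerCoulomb.poisson_K₁_K₂ hS x hx,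
      hQ.poisson_L₂_J₀ hS x hx, hQ.poisson_L₃_K₀ hS x hx, ?_⟩,
    ⟨E₁, E₂, hE₁, hE₂, fun x hx => ⟨?_, ?_⟩⟩,
    hQ.not_isPolynomialIn_mul_poisson hS, hQ.not_closesPolynomially hS,
    fun f hf => hQ.exists_isPolynomialIn_of_symmetryAlgebra hS hf,
    hQ.satisfiesPolynomialEquation hS⟩
  · intro f hf
    simp only [List.mem_cons, List.not_mem_nil, or_false] at hf
    obtain rfl | rfl | rfl | rfl | rfl | rfl | rfl | rfl := hf
    exacts [fun x hx => KeplerCoulomb.poisson_H_L₂ hx, fun x hx => KeplerCoulomb.poisson_H_L₃ hx,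
      fun x hx => KeplerCoulomb.poisson_H_J₁ hS hx, fun x hx => KeplerCoulomb.poisson_H_J₂ hS hx,
      fun x hx => KeplerCoulomb.poisson_H_K₁ hS hx, fun x hx => KeplerCoulomb.poisson_H_K₂ hS hx,
      hQ.poisson_H_J₀ hS, hQ.poisson_H_K₀ hS]
  · intro i
    fin_cases i
    exacts [⟨_, oH⟩, ⟨_, oL₂⟩, ⟨_, oL₃⟩, ⟨_, oJ₀⟩, ⟨_, oK₀⟩]
  · intro i
    fin_cases i
    exacts [fun x _ => poisson_self _ _, fun x hx => KeplerCoulomb.poisson_H_L₂ hx,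
      fun x hx => KeplerCoulomb.poisson_H_L₃ hx, hQ.poisson_H_J₀ hS, hQ.poisson_H_K₀ hS]
  · rw [hQ.poisson_L₂_J₀ hS x hx, hQ.poisson_L₃_K₀ hS x hx]
    exact hQ.poisson_J₀_K₀ hS hx
  · rw [hQ.poisson_L₂_J₀ hS x hx, ← hQ.J₁_sq hE₁ x hx]
    ring
  · rw [hQ.poisson_L₃_K₀ hS x hx, ← hQ.K₁_sq hE₂ x hx]
    ring
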